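/- Let $\mu,b>0$, $\omega\in\mathbb R$ with $\omega^2>2\mu^2$, $f=\frac{b\mu^3}{\omega^2-2\mu^2}$ (that is, $b\mu^3+2f\mu^2-f\omega^2=0$), and $V(\phi)=\mu^3\left[bf\left(1-\cos\frac{\phi}{f}\right)+\frac{\phi^2}{\mu}\right]$. Consider LRS Bianchi III cosmologies with line element $-dt^2+A(t)^2dr^2+B(t)^2\mathbf g_{H^2}$, $\mathbf g_{H^2}=d\vartheta^2+\sinh^2\vartheta\,d\zeta^2$, a scalar field $\phi$ with potential $V$, and a fluid of barotropic index $\gamma$ and density $\rho_m\ge 0$: $$\ddot\phi=-3H\dot\phi-V'(\phi),\quad \dot\rho_m=-3\gamma H\rho_m,\quad \dot K=-2(\sigma_++H)K,\quad \dot\sigma_+=-3H\sigma_++\tfrac K3,$$ $$\dot H=-H^2-2\sigma_+^2-\tfrac16(3\gamma-2)\rho_m-\tfrac13\dot\phi^2+\tfrac13V(\phi),\quad 3H^2=3\sigma_+^2+\rho_m+\tfrac12\dot\phi^2+V(\phi)+K,$$ where $K=B^{-2}$, $\dot A=(H-2\sigma_+)A$ and $\dot B=(H+\sigma_+)B$.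 The full system is this system written, for $H>0$ and $K\ge0$, in the variables $\Omega\ge 0$, $\Sigma=\sigma_+/H$, $\Omega_k=K/(3H^2)$, $\Phi$ and $H$, where $\phi=\sqrt6H\Omega\sin(t\omega-\Phi)/\omega$ and $\dot\phi=\sqrt6H\Omega\cos(t\omega-\Phi)$. Put $\bar\Omega_m=1-\bar\Sigma^2-\bar\Omega^2-\bar\Omega_k$ and $\bar q=-1+\frac12\left(3\gamma\bar\Omega_m+6\bar\Sigma^2+3\bar\Omega^2+2\bar\Omega_k\right)$. The averaged system is $$\bar\Omega'=\bar\Omega\left(\bar q-\tfrac12\right),\quad \bar\Sigma'=\bar\Sigma(\bar q-2)+\bar\Omega_k,\quad \bar\Omega_k'=2\bar\Omega_k(\bar q-\bar\Sigma),\quad \bar\Phi'=0,\quad H'=-(1+\bar q)H,\quad t'=1/H$$ ($'=d/d\tau$) on the phase space $\{\bar\Sigma^2+\bar\Omega^2+\bar\Omega_k\le1,\ \bar\Omega_k\ge0\}$. A point $p=(\Omega,\Sigma,\Omega_k)$ of the phase space is a late-time attractor of the averaged system if it is asymptotically stable within the phase space: solutions starting close to $p$ (with any $\Phi$ and any $H>0$)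 exist for all future times, stay close to $p$ and tend to $p$, with $H\to0$ and $t\to\infty$. If also $\Omega\ge0$ at $p$, it is a late-time attractor of the full system if the same holds for all physical solutions of the full system that start close to $p$ with $H>0$ small and any phase and initial time: they exist for all future times, stay close to $p$, and tend to $p$ with $H\to0$ as $t\to\infty$. The line element of $p$ is given by $\dot H=-(1+\bar q)H^2$, $\dot A=(1-2\Sigma)HA$, $\dot B=(1+\Sigma)HB$ with $\Sigma,\bar q$ constant and equal to their values at $p$, together with $B^{-2}=3\Omega_kH^2$ if $\Omega_k\neq0$ at $p$; $H_0,A_0,B_0>0$ denote the values at $t=0$. For every $\gamma\in(0,2]$ the averaged and the full system have exactly one late-time attractor, and it is the same for both: (i) For $0<\gamma\le\frac23$ it is the matter-dominated FLRW point $F_0=(0,0,0)$, with $\bar\Omega_m=1$ and line element $H=\frac{2H_0}{3\gamma H_0t+2}$, $\frac{A}{A_0}=\frac B{B_0}=\left(\frac{3\gamma H_0t}{2}+1\right)^{\frac2{3\gamma}}$. At $F_0$ one has $-1<\bar q<0$ (quintessence) for $\gamma<\frac23$ and $\bar q=0$ (zero acceleration) for $\gamma=\frac23$. As $\gamma\to0^+$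 one gets the de Sitter solution: $H\to H_0$ and $\left(\frac{3\gamma H_0t}{2}+1\right)^{\frac2{3\gamma}}\to e^{H_0t}$. (ii) For $\frac23<\gamma<1$ it is the matter-curvature scaling solution $MC=\left(0,\frac{3\gamma}2-1,-\frac{9\gamma^2}4+6\gamma-3\right)$, with $\bar\Omega_m=3(1-\gamma)$ and line element $H=\frac{2H_0}{3\gamma H_0t+2}$, $A=A_0\left(\frac{3\gamma H_0t}{2}+1\right)^{\frac{2(1-\gamma)}{\gamma}}$, $B=B_0\left(\frac{3\gamma H_0t}{2}+1\right)$, where $B_0^{-2}=3\left(-\frac{9\gamma^2}4+6\gamma-3\right)H_0^2$. (iii) For $1\le\gamma\le2$ it is the Bianchi III form of flat spacetime $D=\left(0,\frac12,\frac34\right)$, with line element $H=\frac{2H_0}{3H_0t+2}$, $A=A_0$, $B=\frac{B_0(3H_0t+2)}2$, $B_0=\frac2{3H_0}$, and this metric is flat. -/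

import Mathlib

open Filter Topology Set

noncomputable section

namespace LRSBianchiIII

/-! ## The scalar field potential -/

/-- Parameters of the generalized harmonic potential
`V(φ) = μ³ [b f (1 - cos (φ / f)) + φ² / μ]`, where the decay constant `f` is tuned to the angular
frequency `ω` by `b μ³ + 2 f μ² - f ω² = 0`, so that `V''(0) = ω²`. -/
structure HarmonicPotential where
  μ : ℝ
  b : ℝ
  ω : ℝ
  μ_pos : 0 < μ
  b_pos : 0 < b
  two_mul_sq_lt : 2 * μ ^ 2 < ω ^ 2

namespace HarmonicPotential

/-- The solution `f` of `b μ³ + 2 f μ² - f ω² = 0`. -/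
def f (P : HarmonicPotential) : ℝ := P.b * P.μ ^ 3 / (P.ω ^ 2 - 2 * P.μ ^ 2)

def V (P : HarmonicPotential) (φ : ℝ) : ℝ :=
  P.μ ^ 3 * (P.b * P.f * (1 - Real.cos (φ / P.f)) + φ ^ 2 / P.μ)

end HarmonicPotential

/-! ## The phase space and the equilibrium points

A point `p : ℝ × ℝ × ℝ` is read as `(Ω, Σ, Ω_k)`; `S` stands for the shear variable `Σ`. -/

/-- The matter fraction `Ω_m` in the averaged description. -/
def omegaM (p : ℝ × ℝ × ℝ) : ℝ := 1 - p.2.1 ^ 2 - p.1 ^ 2 - p.2.2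

/-- `Σ² + Ω² + Ω_k ≤ 1` and `Ω_k ≥ 0`. -/
def phaseSpace : Set (ℝ × ℝ × ℝ) := {p | p.2.1 ^ 2 + p.1 ^ 2 + p.2.2 ≤ 1 ∧ 0 ≤ p.2.2}

def pointF0 : ℝ × ℝ × ℝ := (0, 0, 0)

def pointMC (γ : ℝ) : ℝ × ℝ × ℝ := (0, 3 * γ / 2 - 1, -(9 * γ ^ 2 / 4) + 6 * γ - 3)

def pointD : ℝ × ℝ × ℝ := (0, 1 / 2, 3 / 4)

/-! ## The averaged system -/

/-- The right-hand side of the guiding system in the Hubble-normalized time `τ`. -/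
def averagedField (γ : ℝ) : ℝ × ℝ × ℝ → ℝ × ℝ × ℝ := fun (Ω, S, Ωk) =>
  (1 / 2 * Ω * (3 * γ * (1 - S ^ 2 - Ω ^ 2 - Ωk) + 6 * S ^ 2 + 3 * Ω ^ 2 + 2 * Ωk - 3),
   1 / 2 * (S * (3 * γ * (1 - S ^ 2 - Ω ^ 2 - Ωk) + 6 * S ^ 2 + 3 * Ω ^ 2 + 2 * Ωk - 6) + 2 * Ωk),
   Ωk * (3 * γ * (1 - S ^ 2 - Ω ^ 2 - Ωk) + 6 * S ^ 2 - 2 * S + 3 * Ω ^ 2 + 2 * Ωk - 2))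

/-- The averaged deceleration parameter; the averaged Raychaudhuri equation is
`dH/dτ = -(1 + q) H`. -/
def averagedQ (γ : ℝ) : ℝ × ℝ × ℝ → ℝ := fun (Ω, S, Ωk) =>
  -1 + 1 / 2 * (3 * γ * (1 - S ^ 2 - Ω ^ 2 - Ωk) + 6 * S ^ 2 + 3 * Ω ^ 2 + 2 * Ωk)

/-- `(x, Φ, H, t)`, with `x = (Ω, Σ, Ω_k)`, is a solution of the averaged system for `τ ≥ 0`, as
a curve in the phase space with `H > 0`. -/
structure IsAveragedSolution (γ : ℝ) (x : ℝ → ℝ × ℝ × ℝ) (Φ H t : ℝ → ℝ) : Prop where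
  mem : ∀ τ ∈ Ici (0 : ℝ), x τ ∈ phaseSpace
  H_pos : ∀ τ ∈ Ici (0 : ℝ), 0 < H τ
  deriv_x : ∀ τ ∈ Ici (0 : ℝ), HasDerivWithinAt x (averagedField γ (x τ)) (Ici 0) τ
  deriv_Φ : ∀ τ ∈ Ici (0 : ℝ), HasDerivWithinAt Φ 0 (Ici 0) τ
  deriv_H : ∀ τ ∈ Ici (0 : ℝ), HasDerivWithinAt H (-(1 + averagedQ γ (x τ)) * H τ) (Ici 0) τ
  deriv_t : ∀ τ ∈ Ici (0 : ℝ), HasDerivWithinAt t (1 / H τ) (Ici 0) τ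

/-- `p` is a (local) late-time attractor of the averaged system: it is asymptotically stable
relative to the phase space. Solutions starting close to `p` exist for all future times, remain
close to `p`, and tend to `p` with `H → 0` and `t → ∞`. -/
def IsAveragedAttractor (γ : ℝ) (p : ℝ × ℝ × ℝ) : Prop :=
  p ∈ phaseSpace ∧
  ∀ U ∈ 𝓝 p, ∃ W ∈ 𝓝 p, ∀ x₀ ∈ W, x₀ ∈ phaseSpace → ∀ Φ₀ H₀ t₀ : ℝ, 0 < H₀ →
    (∃ (x : ℝ → ℝ × ℝ × ℝ) (Φ H t : ℝ → ℝ), IsAveragedSolution γ x Φ H t ∧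
      x 0 = x₀ ∧ Φ 0 = Φ₀ ∧ H 0 = H₀ ∧ t 0 = t₀) ∧
    ∀ (x : ℝ → ℝ × ℝ × ℝ) (Φ H t : ℝ → ℝ), IsAveragedSolution γ x Φ H t →
      x 0 = x₀ → Φ 0 = Φ₀ → H 0 = H₀ → t 0 = t₀ →
        (∀ τ ∈ Ici (0 : ℝ), x τ ∈ U) ∧ Tendsto x atTop (𝓝 p) ∧
          Tendsto H atTop (𝓝 0) ∧ Tendsto t atTop atTop

/-! ## The full system

In the definitions below `θ = t ω - Φ`, so that `φ = √6 H Ω sin θ / ω` and `φ' = √6 H Ω cos θ`. -/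

/-- The matter fraction `Ω_m = ρ_m / (3 H²)`, from the constraint
`3 H² = 3 σ₊² + ρ_m + φ'² / 2 + V(φ) + K`. -/
def fullOmegaM (P : HarmonicPotential) (θ H : ℝ) : ℝ × ℝ × ℝ → ℝ := fun (Ω, S, Ωk) =>
  1 - S ^ 2 - Ωk - ((√6 * H * Ω * Real.cos θ) ^ 2 / 2
    + P.V (√6 * H * Ω * Real.sin θ / P.ω)) / (3 * H ^ 2)

/-- Physical states: `H > 0`, `Ω ≥ 0`, `Ω_k ≥ 0`, and the energy condition `Ω_m ≥ 0`. -/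
def IsPhysical (P : HarmonicPotential) (θ H : ℝ) (x : ℝ × ℝ × ℝ) : Prop :=
  0 < H ∧ 0 ≤ x.1 ∧ 0 ≤ x.2.2 ∧ 0 ≤ fullOmegaM P θ H x

/-- The right-hand sides of the equations for `Ω`, `Σ`, `Ω_k`. -/
def fullField (P : HarmonicPotential) (γ θ H : ℝ) : ℝ × ℝ × ℝ → ℝ × ℝ × ℝ := fun (Ω, S, Ωk) =>
  ( -(P.b * P.μ ^ 3 / (√6 * H)) * Real.cos θ * Real.sin (√6 * H * Real.sin θ * Ω / (P.f * P.ω))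
    - P.b * P.f * γ * Ω * P.μ ^ 3 / H
        * Real.sin (√(3 / 2) * H * Real.sin θ * Ω / (P.f * P.ω)) ^ 2
    + (P.ω ^ 2 - 2 * P.μ ^ 2) * Ω / (2 * P.ω) * Real.sin (2 * θ)
    + 3 * H * ((γ * (P.μ ^ 2 / P.ω ^ 2 - 1 / 2) + 1) * Ω ^ 3 - Ω) * Real.cos θ ^ 2
    + 1 / 2 * H * Ω * (-3 * (γ - 2) * S ^ 2 - 6 * γ * P.μ ^ 2 * Ω ^ 2 / P.ω ^ 2
        + 3 * γ + (2 - 3 * γ) * Ωk),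
    -(P.b * P.f * γ * S * P.μ ^ 3 / H)
        * Real.sin (√(3 / 2) * H * Real.sin θ * Ω / (P.f * P.ω)) ^ 2
    - 3 / 2 * (γ - 2) * H * S * Ω ^ 2 * Real.cos θ ^ 2
    + 1 / 4 * H * (4 * Ωk - 6 * (γ - 2) * S ^ 3
        + 2 * (-(6 * γ * P.μ ^ 2 * Ω ^ 2 / P.ω ^ 2) * Real.sin θ ^ 2
          + 3 * γ - 3 * γ * Ωk + 2 * Ωk - 6) * S),
    P.b * P.f * γ * Ωk * P.μ ^ 3 / H
        * (-1 + Real.cos (√6 * H * Real.sin θ * Ω / (P.f * P.ω)))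
    - 3 * (γ - 2) * H * Ω ^ 2 * Ωk * Real.cos θ ^ 2
    + 1 / 2 * H * (-6 * (γ - 2) * S ^ 2 - 4 * S - 2 * (3 * γ - 2) * (Ωk - 1)
        - 12 * γ * P.μ ^ 2 * Ω ^ 2 / P.ω ^ 2 * Real.sin θ ^ 2) * Ωk )

/-- The right-hand side of the equation for `Φ`. Its first term is
`-(b μ³ / (√6 H Ω)) sin θ sin (√6 H Ω sin θ / (f ω))`, with its removable singularity at `Ω = 0`
filled in; see `fullPhaseRate_eq`. -/
def fullPhaseRate (P : HarmonicPotential) (θ H Ω : ℝ) : ℝ :=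
  -(P.b * P.μ ^ 3 / (P.f * P.ω)) * Real.sin θ ^ 2
      * Real.sinc (√6 * H * Real.sin θ * Ω / (P.f * P.ω))
    + (P.ω ^ 2 - 2 * P.μ ^ 2) / P.ω * Real.sin θ ^ 2
    - 3 * Real.cos θ * H * Real.sin θ

/-- The deceleration parameter; the Raychaudhuri equation is `H' = -(1 + q) H²`. -/
def fullQ (P : HarmonicPotential) (γ θ H : ℝ) : ℝ × ℝ × ℝ → ℝ := fun (Ω, S, Ωk) =>
  -(P.b * P.f * γ * P.μ ^ 3 / H ^ 2)
      * Real.sin (√(3 / 2) * H * Real.sin θ * Ω / (P.f * P.ω)) ^ 2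
    - 3 / 2 * (γ - 2) * Real.cos θ ^ 2 * Ω ^ 2 - 3 / 2 * (γ - 2) * S ^ 2
    - 3 * γ * P.μ ^ 2 * Ω ^ 2 / P.ω ^ 2 * Real.sin θ ^ 2 - 1 / 2 * (3 * γ - 2) * (Ωk - 1)

theorem fullPhaseRate_eq (P : HarmonicPotential) (θ H Ω : ℝ) (hH : H ≠ 0) (hΩ : Ω ≠ 0) :
    fullPhaseRate P θ H Ω =
      -(P.b * P.μ ^ 3 / (√6 * H * Ω)) * Real.sin θ
          * Real.sin (√6 * H * Real.sin θ * Ω / (P.f * P.ω))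
        + (P.ω ^ 2 - 2 * P.μ ^ 2) / P.ω * Real.sin θ ^ 2
        - 3 * Real.cos θ * H * Real.sin θ := by
  have hω : P.ω ≠ 0 := by
    intro h
    have h1 := P.two_mul_sq_lt
    rw [h] at h1
    nlinarith [sq_nonneg P.μ]
  have hf : P.f ≠ 0 := by
    have h1 := P.two_mul_sq_lt
    have h2 : 0 < P.ω ^ 2 - 2 * P.μ ^ 2 := by linarith
    have h3 := P.μ_pos
    have h4 := P.b_pos
    unfold HarmonicPotential.f
    positivity
  have h6 : √(6 : ℝ) ≠ 0 := by positivity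
  unfold fullPhaseRate
  congr 2
  by_cases hs : Real.sin θ = 0
  · simp [hs]
  · rw [Real.sinc_of_ne_zero (by positivity)]
    field_simp

/-- `(x, Φ, H)`, with `x = (Ω, Σ, Ω_k)`, is a solution of the full system for `t ≥ t₀`, as a curve
of physical states. -/
structure IsFullSolution (P : HarmonicPotential) (γ t₀ : ℝ) (x : ℝ → ℝ × ℝ × ℝ) (Φ H : ℝ → ℝ) :
    Prop where
  physical : ∀ t ∈ Ici t₀, IsPhysical P (t * P.ω - Φ t) (H t) (x t)
  deriv_x : ∀ t ∈ Ici t₀,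
    HasDerivWithinAt x (fullField P γ (t * P.ω - Φ t) (H t) (x t)) (Ici t₀) t
  deriv_Φ : ∀ t ∈ Ici t₀,
    HasDerivWithinAt Φ (fullPhaseRate P (t * P.ω - Φ t) (H t) (x t).1) (Ici t₀) t
  deriv_H : ∀ t ∈ Ici t₀,
    HasDerivWithinAt H (-(1 + fullQ P γ (t * P.ω - Φ t) (H t) (x t)) * H t ^ 2) (Ici t₀) t

/-- `p` is a (local) late-time attractor of the full system in the regime of small `H`: solutions
starting from a physical state close to `p`, with `H` small and with arbitrary phase and initial
time, exist for all future times, remain close to `p`, and tend to `p` with `H → 0`. -/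
def IsFullAttractor (P : HarmonicPotential) (γ : ℝ) (p : ℝ × ℝ × ℝ) : Prop :=
  p ∈ phaseSpace ∧ 0 ≤ p.1 ∧
  ∀ U ∈ 𝓝 p, ∃ W ∈ 𝓝 p, ∃ h > 0, ∀ x₀ ∈ W, ∀ t₀ Φ₀ H₀ : ℝ, H₀ < h →
    IsPhysical P (t₀ * P.ω - Φ₀) H₀ x₀ →
    (∃ (x : ℝ → ℝ × ℝ × ℝ) (Φ H : ℝ → ℝ), IsFullSolution P γ t₀ x Φ H ∧
      x t₀ = x₀ ∧ Φ t₀ = Φ₀ ∧ H t₀ = H₀) ∧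
    ∀ (x : ℝ → ℝ × ℝ × ℝ) (Φ H : ℝ → ℝ), IsFullSolution P γ t₀ x Φ H →
      x t₀ = x₀ → Φ t₀ = Φ₀ → H t₀ = H₀ →
        (∀ t ∈ Ici t₀, x t ∈ U) ∧ Tendsto x atTop (𝓝 p) ∧ Tendsto H atTop (𝓝 0)

/-! ## Line elements -/

/-- The scale factors `A`, `B` (for `t ≥ 0`) of the line element
`-dt² + A(t)² dr² + B(t)² g_{H²}` obtained by evaluating the equations
`H' = -(1 + q) H²`, `A' = (H - 2 σ₊) A`, `B' = (H + σ₊) B`, with `σ₊ = Σ H`, at the constant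
state `p = (Ω, Σ, Ω_k)`. If `Ω_k ≠ 0`, the Gauss curvature `K = B⁻²` satisfies `K = 3 Ω_k H²`. -/
structure IsLineElementOf (γ : ℝ) (p : ℝ × ℝ × ℝ) (H A B : ℝ → ℝ) : Prop where
  H_pos : ∀ t ∈ Ici (0 : ℝ), 0 < H t
  A_pos : ∀ t ∈ Ici (0 : ℝ), 0 < A t
  B_pos : ∀ t ∈ Ici (0 : ℝ), 0 < B t
  deriv_H : ∀ t ∈ Ici (0 : ℝ), HasDerivWithinAt H (-(1 + averagedQ γ p) * H t ^ 2) (Ici 0) t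
  deriv_A : ∀ t ∈ Ici (0 : ℝ), HasDerivWithinAt A ((H t - 2 * (p.2.1 * H t)) * A t) (Ici 0) t
  deriv_B : ∀ t ∈ Ici (0 : ℝ), HasDerivWithinAt B ((H t + p.2.1 * H t) * B t) (Ici 0) t
  gauss : p.2.2 ≠ 0 → ∀ t ∈ Ici (0 : ℝ), 1 / B t ^ 2 = 3 * p.2.2 * H t ^ 2

/-- The metric `-dt² + A(t)² dr² + B(t)² (dϑ² + sinh² ϑ dζ²)` in the coordinates
`x = (t, r, ϑ, ζ)`, evaluated on two tangent vectors. -/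
def lrsMetric (A B : ℝ → ℝ) (x v w : Fin 4 → ℝ) : ℝ :=
  -(v 0 * w 0) + A (x 0) ^ 2 * (v 1 * w 1)
    + B (x 0) ^ 2 * (v 2 * w 2 + Real.sinh (x 2) ^ 2 * (v 3 * w 3))

def minkowski (v w : Fin 4 → ℝ) : ℝ := -(v 0 * w 0) + v 1 * w 1 + v 2 * w 2 + v 3 * w 3

/-- The metric `g` is flat on `s`: around every point of `s` there are smooth functions which pull
the Minkowski metric back to `g` (where `g` is nondegenerate these are local coordinates). -/
def IsFlatOn (g : (Fin 4 → ℝ) → (Fin 4 → ℝ) → (Fin 4 → ℝ) → ℝ) (s : Set (Fin 4 → ℝ)) : Prop :=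
  ∀ x ∈ s, ∃ N : Set (Fin 4 → ℝ), IsOpen N ∧ x ∈ N ∧ ∃ F : (Fin 4 → ℝ) → (Fin 4 → ℝ),
    ContDiffOn ℝ (⊤ : ℕ∞) F N ∧
      ∀ y ∈ N, ∀ v w, minkowski (fderiv ℝ F y v) (fderiv ℝ F y w) = g y v w

end LRSBianchiIII

end

open LRSBianchiIII

noncomputable section

namespace LRSBianchiIII

/-! ## Monotonicity along half-lines -/

/-! The oscillating scalar field enters the other equations only through its energy fraction E and
its pressure fraction w. In the variables X = (E, Σ, Ω_k), with E = (φ'²/2 + V)/(3H²), the full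
system reads X' = H (F(X) + w G(X)), H' = -(1 + q + 3w/2) H², where |w| ≤ E and F is the averaged
field rewritten with E = Ω². The pressure averages out by the virial theorem: Z = φφ'/(6H) satisfies
Z' = H w + r with Z = O(H E) and r = O(H² E), because 2V - φV' is at least cubic in φ. The averaged
system is the case w = 0, in the time τ. `IsFlow` covers both cases, so that every asymptotic
statement is proved once; `exists_isFlow_of_full` and `IsAveragedSolution.isFlow` supply the flows.

Sufficiency. For smooth L, the function L(X) - dL(G) Z has derivative h dL(F) up to O(h H), where h
is the rate of the time variable (`exists_corrected`). Near a point with E = 0 and 1 + q > 0, H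
decays at a rate at least c h, so a multiple of H absorbs the error. A strict Lyapunov function of F
thus yields a monotone quantity that differs from L by O(H), which gives stability and convergence
for small H (`IsStrictLyapunov.stable`, `IsStrictLyapunov.tendsto`). No exponential rate is
required. This is essential: F₀ is degenerate in the curvature direction at γ = 2/3, and D is
degenerate in the scalar field direction for every γ. The Lyapunov functions at F₀, MC and D are
explicit polynomials.

Necessity. If H → 0 then ∫ h dt is infinite (`IsFlow.exists_lt`). A limit p of a flow is therefore a
zero of F, and the logarithmic growth rates at p of those among E, Ω_k, Ω_m that are positive along
the flow cannot be positive. Flows with all three positive start arbitrarily close to every point of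
the phase space. The conditions F(p) = 0, q ≤ Σ, 2 + 2q ≤ 3γ and 2q ≤ 1 leave exactly one point for
each γ (`isSelected_of_limit_conditions`).

Solutions are global because Ω_k and Ω_m obey linear homogeneous equations, so that the physical
region is invariant, and H stays between explicit positive bounds on bounded time intervals. At
constant state the line elements integrate to powers of an affine function of time; at D the result
is a Milne-type wedge of Minkowski space. -/

theorem le_of_hasDerivWithinAt_nonpos {f f' : ℝ → ℝ} {t₀ a b : ℝ} (ha : t₀ ≤ a) (hab : a ≤ b)
    (hf : ∀ t ∈ Icc a b, HasDerivWithinAt f (f' t) (Ici t₀) t)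
    (h : ∀ t ∈ Icc a b, f' t ≤ 0) : f b ≤ f a := by
  have hanti : AntitoneOn f (Icc a b) := by
    refine antitoneOn_of_hasDerivWithinAt_nonpos (f' := f') (convex_Icc a b)
      (fun t ht => ((hf t ht).continuousWithinAt).mono fun s hs => ha.trans hs.1)
      (fun t ht => ?_) (fun t ht => h t (interior_subset ht))
    exact (hf t (interior_subset ht)).mono fun s hs => ha.trans (interior_subset hs).1
  exact hanti (left_mem_Icc.2 hab) (right_mem_Icc.2 hab) hab

theorem le_of_hasDerivWithinAt_nonneg {f f' : ℝ → ℝ} {t₀ a b : ℝ} (ha : t₀ ≤ a) (hab : a ≤ b)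
    (hf : ∀ t ∈ Icc a b, HasDerivWithinAt f (f' t) (Ici t₀) t)
    (h : ∀ t ∈ Icc a b, 0 ≤ f' t) : f a ≤ f b := by
  have := le_of_hasDerivWithinAt_nonpos (f := fun t => -f t) (f' := fun t => -f' t) ha hab
    (fun t ht => (hf t ht).neg) (fun t ht => by have := h t ht; linarith)
  linarith

/-- `f t * exp (C * t)` is nondecreasing. -/
theorem pos_of_hasDerivWithinAt_ge {f f' : ℝ → ℝ} {t₀ C : ℝ}
    (hf : ∀ t ∈ Ici t₀, HasDerivWithinAt f (f' t) (Ici t₀) t)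
    (h : ∀ t ∈ Ici t₀, -C * f t ≤ f' t) (h0 : 0 < f t₀) : ∀ t ∈ Ici t₀, 0 < f t := by
  intro t ht
  have key := le_of_hasDerivWithinAt_nonneg (f := fun s => f s * Real.exp (C * s))
    (f' := fun s => f' s * Real.exp (C * s) + f s * (Real.exp (C * s) * (C * 1)))
    (le_refl t₀) ht
    (fun s hs => (hf s hs.1).mul
      ((((hasDerivWithinAt_id s _).const_mul C)).exp))
    (fun s hs => by
      have h1 := h s hs.1
      have h2 := Real.exp_pos (C * s)
      have : f' s * Real.exp (C * s) + f s * (Real.exp (C * s) * (C * 1))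
        = (f' s - -C * f s) * Real.exp (C * s) := by ring
      rw [this]
      exact mul_nonneg (by linarith) h2.le)
  have h2 : 0 < f t₀ * Real.exp (C * t₀) := mul_pos h0 (Real.exp_pos _)
  exact pos_of_mul_pos_left (h2.trans_le key) (Real.exp_pos _).le

/-- A solution of a linear equation `f' = a f` which is nonnegative initially stays so. -/
theorem nonneg_of_linear {f a : ℝ → ℝ} {t₀ t₁ : ℝ}
    (ha : ContinuousOn a (Icc t₀ t₁))
    (hf : ∀ t ∈ Icc t₀ t₁, HasDerivWithinAt f (a t * f t) (Icc t₀ t₁) t)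
    (h0 : 0 ≤ f t₀) : ∀ t ∈ Icc t₀ t₁, 0 ≤ f t := by
  obtain ⟨C, hC⟩ := isCompact_Icc.exists_bound_of_continuousOn ha
  have hcont : ContinuousOn f (Icc t₀ t₁) := fun t ht => (hf t ht).continuousWithinAt
  -- zero at some time implies zero afterwards
  have hzero : ∀ s ∈ Icc t₀ t₁, f s = 0 → ∀ t ∈ Icc s t₁, f t = 0 := by
    intro s hs hs0
    refine eq_zero_of_abs_deriv_le_mul_abs_self_of_eq_zero_right (f' := fun t => a t * f t)
      (K := C) (hcont.mono (Icc_subset_Icc_left hs.1)) (fun t ht => ?_) hs0 (fun t ht => ?_)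
    · have ht' : t ∈ Icc t₀ t₁ := ⟨hs.1.trans ht.1, ht.2.le⟩
      refine (hf t ht').mono_of_mem_nhdsWithin ?_
      exact mem_of_superset (Icc_mem_nhdsGE ht.2) (Icc_subset_Icc_left ht'.1)
    · rw [norm_mul]
      exact mul_le_mul_of_nonneg_right (hC t ⟨hs.1.trans ht.1, ht.2.le⟩) (norm_nonneg _)
  intro t ht
  by_contra hneg
  push Not at hneg
  -- A negative value would be preceded by a zero, after which `f` vanishes identically.
  have : (0 : ℝ) ∈ f '' Icc t₀ t := by
    apply intermediate_value_Icc' ht.1 (hcont.mono (Icc_subset_Icc_right ht.2))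
    exact ⟨hneg.le, h0⟩
  obtain ⟨s, hs, hs0⟩ := this
  have := hzero s ⟨hs.1, hs.2.trans ht.2⟩ hs0 t ⟨hs.2, ht.2⟩
  linarith

/-! ## Global solutions of autonomous differential equations -/

section Global

variable {F : Type*} [NormedAddCommGroup F] [NormedSpace ℝ F] 

/-- `y` solves `y' = f(y)` on `[0, s]`, as a curve in `U`. -/
def SolvesOn (f : F → F) (U : Set F) (s : ℝ) (y : ℝ → F) : Prop :=
  ∀ t ∈ Icc 0 s, y t ∈ U ∧ HasDerivWithinAt y (f (y t)) (Icc 0 s) t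

theorem SolvesOn.mono {f : F → F} {U : Set F} {s s' : ℝ} {y : ℝ → F} (h : SolvesOn f U s y)
    (hs : s' ≤ s) : SolvesOn f U s' y := fun t ht =>
  ⟨(h t ⟨ht.1, ht.2.trans hs⟩).1, (h t ⟨ht.1, ht.2.trans hs⟩).2.mono (Icc_subset_Icc_right hs)⟩

/-- Picard–Lindelöf gives a local flow jointly continuous in initial value and time. Continuity
keeps it inside `U` on a product neighbourhood, which makes the lifetime uniform near `x₀`. -/
theorem exists_local_solutions [CompleteSpace F] {f : F → F} {U : Set F} (hU : IsOpen U) (hf : ContDiffOn ℝ 1 f U)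
    {x₀ : F} (hx₀ : x₀ ∈ U) : ∃ ε > 0, ∃ N ∈ 𝓝 x₀, ∀ x ∈ N, ∃ α : ℝ → F, α 0 = x ∧
      SolvesOn f U ε α := by
  obtain ⟨ε, hε, a, r, L, K, hr, hpl⟩ :=
    IsPicardLindelof.of_contDiffAt_one (hf.contDiffAt (hU.mem_nhds hx₀))
  obtain ⟨α, hα, hcont⟩ := (hpl 0).exists_forall_mem_closedBall_eq_hasDerivWithinAt_continuousOn
  have h0 : (x₀, (0 : ℝ)) ∈ Metric.closedBall x₀ r ×ˢ Icc (0 - ε) (0 + ε) :=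
    ⟨Metric.mem_closedBall_self r.2, by simp [hε.le]⟩
  have hmem : Metric.closedBall x₀ (r : ℝ) ×ˢ Icc (0 - ε) (0 + ε) ∈ 𝓝 (x₀, (0 : ℝ)) :=
    prod_mem_nhds (Metric.closedBall_mem_nhds _ hr) (Icc_mem_nhds (by linarith) (by linarith))
  have hca : ContinuousAt α (x₀, 0) := hcont.continuousAt hmem
  have hα0 : α (x₀, 0) = x₀ := (hα x₀ (Metric.mem_closedBall_self r.2)).1
  have hpre : α ⁻¹' U ∈ 𝓝 (x₀, (0 : ℝ)) := hca (by rw [hα0]; exact hU.mem_nhds hx₀)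
  obtain ⟨N, hN, T, hT, hsub⟩ := mem_nhds_prod_iff.1 (inter_mem hpre hmem)
  obtain ⟨δ, hδ, hδT⟩ := Metric.mem_nhds_iff.1 hT
  refine ⟨δ / 2, by positivity, N, hN, fun x hx => ⟨fun t => α (x, t), ?_, fun t ht => ?_⟩⟩
  · have : (x, (0 : ℝ)) ∈ N ×ˢ T := ⟨hx, mem_of_mem_nhds hT⟩
    exact (hα x (hsub this).2.1).1
  · have hin : ∀ s ∈ Icc 0 (δ / 2), (x, s) ∈ N ×ˢ T := fun s hs =>
      ⟨hx, hδT (by rw [Metric.mem_ball, Real.dist_eq, sub_zero, abs_of_nonneg hs.1]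
                   linarith [hs.2])⟩
    refine ⟨(hsub (hin t ht)).1, ?_⟩
    exact ((hα x (hsub (hin t ht)).2.1).2 t (hsub (hin t ht)).2.2).mono
      fun s hs => (hsub (hin s hs)).2.2

theorem exists_uniform_local_solutions [CompleteSpace F] {f : F → F} {U K : Set F} (hU : IsOpen U)
    (hf : ContDiffOn ℝ 1 f U) (hK : IsCompact K) (hKU : K ⊆ U) :
    ∃ ε > 0, ∀ x ∈ K, ∃ α : ℝ → F, α 0 = x ∧ SolvesOn f U ε α := by
  refine hK.induction_on (p := fun s => ∃ ε > 0, ∀ x ∈ s, ∃ α : ℝ → F, α 0 = x ∧ SolvesOn f U ε α)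
    ⟨1, one_pos, by simp⟩ ?_ ?_ ?_
  · rintro s t hst ⟨ε, hε, h⟩
    exact ⟨ε, hε, fun x hx => h x (hst hx)⟩
  · rintro s t ⟨ε, hε, h⟩ ⟨ε', hε', h'⟩
    refine ⟨min ε ε', lt_min hε hε', ?_⟩
    rintro x (hx | hx)
    · obtain ⟨α, h0, hα⟩ := h x hx
      exact ⟨α, h0, hα.mono (min_le_left _ _)⟩
    · obtain ⟨α, h0, hα⟩ := h' x hx
      exact ⟨α, h0, hα.mono (min_le_right _ _)⟩
  · intro x hx
    obtain ⟨ε, hε, N, hN, h⟩ := exists_local_solutions hU hf (hKU hx)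
    exact ⟨N, mem_nhdsWithin_of_mem_nhds hN, ε, hε, h⟩

theorem SolvesOn.glue {f : F → F} {U : Set F} {s ε : ℝ} (hs : 0 ≤ s) (hε : 0 ≤ ε) {y α : ℝ → F}
    (hy : SolvesOn f U s y) (hα : SolvesOn f U ε α) (h : α 0 = y s) :
    ∃ z : ℝ → F, z 0 = y 0 ∧ SolvesOn f U (s + ε) z := by
  set z : ℝ → F := fun t => if t ≤ s then y t else α (t - s) with hz
  have hz1 : ∀ t ∈ Icc 0 s, z t = y t := fun t ht => by simp [hz, ht.2]
  have hz2 : ∀ t ∈ Icc s (s + ε), z t = α (t - s) := fun t ht => by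
    rcases ht.1.eq_or_lt with rfl | hlt
    · simp [hz, h]
    · simp [hz, not_le.2 hlt]
  have hd1 : ∀ t ∈ Icc 0 s, HasDerivWithinAt z (f (z t)) (Icc 0 s) t := fun t ht => by
    rw [hz1 t ht]
    exact (hy t ht).2.congr hz1 (hz1 t ht)
  have hd2 : ∀ t ∈ Icc s (s + ε), HasDerivWithinAt z (f (z t)) (Icc s (s + ε)) t := fun t ht => by
    rw [hz2 t ht]
    have h1 : t - s ∈ Icc 0 ε := ⟨by linarith [ht.1], by linarith [ht.2]⟩
    have h2 : HasDerivWithinAt (fun t => α (t - s)) (f (α (t - s))) (Icc s (s + ε)) t := by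
      have hmaps : MapsTo (fun u : ℝ => u - s) (Icc s (s + ε)) (Icc 0 ε) := fun u hu =>
        ⟨sub_nonneg.2 hu.1, by simpa [add_comm] using hu.2⟩
      have := (hα _ h1).2.scomp t (((hasDerivAt_id t).sub_const s).hasDerivWithinAt
        (s := Icc s (s + ε))) hmaps
      rw [one_smul] at this
      exact this
    exact h2.congr hz2 (hz2 t ht)
  refine ⟨z, hz1 0 ⟨le_rfl, hs⟩, fun t ht => ⟨?_, ?_⟩⟩
  · rcases le_total t s with hts | hts
    · rw [hz1 t ⟨ht.1, hts⟩]; exact (hy t ⟨ht.1, hts⟩).1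
    · rw [hz2 t ⟨hts, ht.2⟩]; exact (hα _ ⟨by linarith, by linarith [ht.2]⟩).1
  · rw [← Icc_union_Icc_eq_Icc hs (by linarith : s ≤ s + ε)]
    rcases lt_trichotomy t s with hts | hts | hts
    · refine (hd1 t ⟨ht.1, hts.le⟩).mono_of_mem_nhdsWithin ?_
      filter_upwards [self_mem_nhdsWithin, mem_nhdsWithin_of_mem_nhds (Iio_mem_nhds hts)]
        with u hu hus
      rcases hu with hu | hu
      · exact hu
      · exact absurd hu.1 (not_le.2 hus)
    · exact (hd1 t ⟨ht.1, hts.le⟩).union (hd2 t ⟨hts.ge, ht.2⟩)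
    · refine (hd2 t ⟨hts.le, ht.2⟩).mono_of_mem_nhdsWithin ?_
      filter_upwards [self_mem_nhdsWithin, mem_nhdsWithin_of_mem_nhds (Ioi_mem_nhds hts)]
        with u hu hus
      rcases hu with hu | hu
      · exact absurd hu.2 (not_le.2 hus)
      · exact hu

/-- Both curves run in one compact subset of `U`, on which the locally Lipschitz field is Lipschitz,
so Grönwall uniqueness applies. -/
theorem SolvesOn.eqOn {f : F → F} {U : Set F} (hU : IsOpen U) (hf : ContDiffOn ℝ 1 f U)
    {s : ℝ} {y z : ℝ → F} (hy : SolvesOn f U s y) (hz : SolvesOn f U s z) (h0 : y 0 = z 0) :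
    EqOn y z (Icc 0 s) := by
  have hyc : ContinuousOn y (Icc 0 s) := fun t ht => (hy t ht).2.continuousWithinAt
  have hzc : ContinuousOn z (Icc 0 s) := fun t ht => (hz t ht).2.continuousWithinAt
  set K := y '' Icc 0 s ∪ z '' Icc 0 s with hKdef
  have hK : IsCompact K := (isCompact_Icc.image_of_continuousOn hyc).union
    (isCompact_Icc.image_of_continuousOn hzc)
  have hKU : K ⊆ U := by
    rintro _ (⟨t, ht, rfl⟩ | ⟨t, ht, rfl⟩)
    exacts [(hy t ht).1, (hz t ht).1]
  have hloc : LocallyLipschitzOn K f := fun x hx => by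
    obtain ⟨C, t, ht, hl⟩ := (hf.contDiffAt (hU.mem_nhds (hKU hx))).exists_lipschitzOnWith
    exact ⟨C, t, mem_nhdsWithin_of_mem_nhds ht, hl⟩
  obtain ⟨C, hC⟩ := hloc.exists_lipschitzOnWith_of_compact hK
  have hd : ∀ {u : ℝ → F}, SolvesOn f U s u → ∀ t ∈ Ico 0 s,
      HasDerivWithinAt u (f (u t)) (Ici t) t := fun hu t ht => by
    refine (hu t ⟨ht.1, ht.2.le⟩).2.mono_of_mem_nhdsWithin ?_
    exact mem_of_superset (Icc_mem_nhdsGE ht.2) (Icc_subset_Icc_left ht.1)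
  exact ODE_solution_unique_of_mem_Icc_right (v := fun _ => f) (s := fun _ => K)
    (fun _ _ => hC) hyc (hd hy) (fun t ht => Or.inl ⟨t, ⟨ht.1, ht.2.le⟩, rfl⟩) hzc (hd hz)
    (fun t ht => Or.inr ⟨t, ⟨ht.1, ht.2.le⟩, rfl⟩) h0

/-- Compactness of `K` provides one step length `ε` valid at every endpoint, so finitely many
extensions reach `T`. -/
theorem exists_solvesOn [CompleteSpace F] {f : F → F} {U : Set F} (hU : IsOpen U) (hf : ContDiffOn ℝ 1 f U)
    {y₀ : F} (hy₀ : y₀ ∈ U) {T : ℝ} {K : Set F} (hK : IsCompact K) (hKU : K ⊆ U)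
    (hap : ∀ s ∈ Icc 0 T, ∀ y : ℝ → F, y 0 = y₀ → SolvesOn f U s y → y s ∈ K) :
    ∃ y : ℝ → F, y 0 = y₀ ∧ SolvesOn f U T y := by
  obtain ⟨ε, hε, hext⟩ := exists_uniform_local_solutions hU hf hK hKU
  have step : ∀ n : ℕ, ∃ y : ℝ → F, y 0 = y₀ ∧ SolvesOn f U (min (n * ε) T) y := by
    intro n
    induction n with
    | zero =>
      refine ⟨fun _ => y₀, rfl, fun t ht => ⟨hy₀, ?_⟩⟩
      have h1 : t = 0 := le_antisymm (ht.2.trans (by simp)) ht.1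
      have h2 : (Icc 0 (min (((0 : ℕ) : ℝ) * ε) T)).Subsingleton := by
        apply subsingleton_Icc_of_ge
        simp
      exact HasFDerivWithinAt.of_subsingleton h2
    | succ n ih =>
      obtain ⟨y, hy0, hy⟩ := ih
      rcases le_total T (n * ε) with hT | hT
      · refine ⟨y, hy0, ?_⟩
        rw [min_eq_right hT] at hy
        exact hy.mono (min_le_right _ _)
      · rw [min_eq_left hT] at hy
        have hn : 0 ≤ n * ε := by positivity
        obtain ⟨α, hα0, hα⟩ := hext (y (n * ε)) (hap _ ⟨hn, hT⟩ y hy0 hy)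
        obtain ⟨z, hz0, hz⟩ := hy.glue hn hε.le hα hα0
        refine ⟨z, hz0.trans hy0, hz.mono ((min_le_left _ _).trans ?_)⟩
        push_cast; linarith
  obtain ⟨n, hn⟩ := exists_nat_gt (T / ε)
  obtain ⟨y, hy0, hy⟩ := step n
  rw [min_eq_right ((div_lt_iff₀ hε).1 hn).le] at hy
  exact ⟨y, hy0, hy⟩

/-- If every solution starting at `y₀` is confined to a compact subset of `U` on bounded time
intervals, then there is a global solution. -/
theorem exists_global_solution [CompleteSpace F] {f : F → F} {U : Set F} (hU : IsOpen U) (hf : ContDiffOn ℝ 1 f U)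
    {y₀ : F} (hy₀ : y₀ ∈ U)
    (hap : ∀ T : ℝ, 0 < T → ∃ K ⊆ U, IsCompact K ∧
      ∀ s ∈ Icc 0 T, ∀ y : ℝ → F, y 0 = y₀ → SolvesOn f U s y → y s ∈ K) :
    ∃ y : ℝ → F, y 0 = y₀ ∧ (∀ s, 0 ≤ s → SolvesOn f U s y) ∧
      ∀ t ∈ Ici (0 : ℝ), HasDerivWithinAt y (f (y t)) (Ici 0) t := by
  have h1 : ∀ n : ℕ, ∃ y : ℝ → F, y 0 = y₀ ∧ SolvesOn f U (n + 1 : ℝ) y := fun n => by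
    obtain ⟨K, hKU, hK, h⟩ := hap (n + 1) (by positivity)
    exact exists_solvesOn hU hf hy₀ hK hKU h
  choose Y hY0 hY using h1
  -- The piece used at `t` lives on `[0, ⌊t⌋ + 1]`, so `t` lies strictly before its right end; by
  -- uniqueness the pieces agree.
  set y : ℝ → F := fun t => Y ⌊t⌋₊ t with hydef
  have heq : ∀ n : ℕ, EqOn y (Y n) (Icc 0 (n + 1 : ℝ)) := by
    intro n t ht
    rcases le_total (⌊t⌋₊) n with h | h
    · have h' : ((⌊t⌋₊ : ℕ) : ℝ) + 1 ≤ n + 1 := by exact_mod_cast Nat.succ_le_succ h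
      exact SolvesOn.eqOn hU hf (hY ⌊t⌋₊) ((hY n).mono h') (by rw [hY0, hY0])
        ⟨ht.1, (Nat.lt_floor_add_one t).le⟩
    · have h' : (n : ℝ) + 1 ≤ ((⌊t⌋₊ : ℕ) : ℝ) + 1 := by exact_mod_cast Nat.succ_le_succ h
      exact SolvesOn.eqOn hU hf ((hY ⌊t⌋₊).mono h') (hY n) (by rw [hY0, hY0]) ht
  have hsol : ∀ n : ℕ, SolvesOn f U (n + 1 : ℝ) y := fun n t ht => by
    have h2 := hY n t ht
    rw [heq n ht]
    exact ⟨h2.1, h2.2.congr (heq n) (heq n ht)⟩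
  refine ⟨y, ?_, fun s hs => ?_, fun t ht => ?_⟩
  · simp [hydef, hY0]
  · exact (hsol ⌊s⌋₊).mono (Nat.lt_floor_add_one s).le
  · have h3 := (hsol ⌊t⌋₊ t ⟨ht, (Nat.lt_floor_add_one t).le⟩).2
    refine h3.mono_of_mem_nhdsWithin ?_
    filter_upwards [self_mem_nhdsWithin,
      mem_nhdsWithin_of_mem_nhds (Iio_mem_nhds (Nat.lt_floor_add_one t))] with u hu hut
    exact ⟨hu, hut.le⟩

end Global

/-! ## Smoothness of the sinc function -/

/-- The difference quotient of the complex sine at `0` is entire, by removal of singularities, and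
restricts to sinc on the real line. -/
theorem contDiff_sinc {n : WithTop ℕ∞} : ContDiff ℝ n Real.sinc := by
  have h1 : Differentiable ℂ (dslope Complex.sin 0) := by
    rw [← differentiableOn_univ, Complex.differentiableOn_dslope univ_mem,
      differentiableOn_univ]
    exact Complex.differentiable_sin
  have h2 : ContDiff ℝ n fun x : ℝ => (dslope Complex.sin 0 (x : ℂ)).re :=
    (h1.contDiff (n := n)).real_of_complex
  convert h2 using 1
  ext x
  by_cases hx : x = 0
  · simp [hx]
  · have hx' : (x : ℂ) ≠ 0 := by exact_mod_cast hx
    rw [Real.sinc_of_ne_zero hx, dslope_of_ne _ hx', slope_def_field]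
    simp only [Complex.sin_zero, sub_zero]
    rw [← Complex.ofReal_sin, ← Complex.ofReal_div, Complex.ofReal_re]

/-! ## Oscillatory perturbations of the guiding system

In the variables `X = (E, Σ, Ω_k)`, where `E` is the energy fraction of the scalar field, both the
averaged and the full system take the form `X' = h (F(X) + w G(X))` with an oscillating term `w`
whose integral is small. -/

/-- The states with `E ≥ 0`, `Ω_k ≥ 0` and `Ω_m ≥ 0`. -/
def region : Set (ℝ × ℝ × ℝ) := {X | 0 ≤ X.1 ∧ 0 ≤ X.2.2 ∧ X.1 + X.2.1 ^ 2 + X.2.2 ≤ 1}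

/-- The deceleration parameter with the scalar field counted as dust; the pressure adds `3 w / 2`
(`fullQ_eq`). -/
def energyQ (γ : ℝ) (X : ℝ × ℝ × ℝ) : ℝ :=
  2 * X.2.1 ^ 2 + (3 * γ - 2) / 2 * (1 - X.1 - X.2.1 ^ 2 - X.2.2) + X.1 / 2

def energyField (γ : ℝ) (X : ℝ × ℝ × ℝ) : ℝ × ℝ × ℝ :=
  (X.1 * (2 * energyQ γ X - 1), X.2.1 * (energyQ γ X - 2) + X.2.2,
    2 * X.2.2 * (energyQ γ X - X.2.1))

/-- The effect of the pressure: it shifts `q` by `3 w / 2` in all three equations, and its work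
against the expansion contributes the further `-3 w` to the first one. -/
def oscField (X : ℝ × ℝ × ℝ) : ℝ × ℝ × ℝ := (-3 * (1 - X.1), 3 / 2 * X.2.1, 3 * X.2.2)

/-- `X' = h (F(X) + w G(X))` and `H' = -h (1 + q + 3 w / 2) H`, where `w = (Z' - r) / h` is small
on average. -/
structure IsFlow (γ C t₀ : ℝ) (h H w Z r : ℝ → ℝ) (X : ℝ → ℝ × ℝ × ℝ) : Prop where
  mem : ∀ t ∈ Ici t₀, X t ∈ region
  H_pos : ∀ t ∈ Ici t₀, 0 < H t
  -- `h` is the rate of the time variable: `H` in cosmic time, `1` in the time `τ`.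
  H_le : ∀ t ∈ Ici t₀, H t ≤ h t
  w_le : ∀ t ∈ Ici t₀, |w t| ≤ (X t).1
  -- The factor `E` in the bounds on `w`, `Z` and `r` permits division by `E` when the growth rate
  -- of `E` itself is averaged.
  Z_le : ∀ t ∈ Ici t₀, |Z t| ≤ C * H t * (X t).1
  r_le : ∀ t ∈ Ici t₀, |r t| ≤ C * h t * H t * (X t).1
  deriv_X : ∀ t ∈ Ici t₀,
    HasDerivWithinAt X (h t • (energyField γ (X t) + w t • oscField (X t))) (Ici t₀) t
  deriv_H : ∀ t ∈ Ici t₀,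
    HasDerivWithinAt H (-(h t * (1 + energyQ γ (X t) + 3 / 2 * w t) * H t)) (Ici t₀) t
  deriv_Z : ∀ t ∈ Ici t₀, HasDerivWithinAt Z (h t * w t + r t) (Ici t₀) t

theorem isCompact_region : IsCompact region := by
  have hsub : region ⊆ Icc (0 : ℝ) 1 ×ˢ (Icc (-1 : ℝ) 1 ×ˢ Icc (0 : ℝ) 1) := by
    rintro ⟨a, b, c⟩ ⟨h1, h2, h3⟩
    simp only at h1 h2 h3
    refine ⟨⟨h1, by nlinarith⟩, abs_le.1 (abs_le_one_iff_mul_self_le_one.2 (by nlinarith)),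
      ⟨h2, by nlinarith⟩⟩
  have hcl : IsClosed region := by
    have : region = {X : ℝ × ℝ × ℝ | 0 ≤ X.1} ∩ ({X | 0 ≤ X.2.2} ∩
        {X | X.1 + X.2.1 ^ 2 + X.2.2 ≤ 1}) := rfl
    rw [this]
    exact (isClosed_le (by fun_prop) (by fun_prop)).inter
      ((isClosed_le (by fun_prop) (by fun_prop)).inter (isClosed_le (by fun_prop) (by fun_prop)))
  exact (isCompact_Icc.prod (isCompact_Icc.prod isCompact_Icc)).of_isClosed_subset hcl hsub

theorem contDiff_energyQ (γ : ℝ) {n : WithTop ℕ∞} : ContDiff ℝ n (energyQ γ) := by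
  unfold energyQ; fun_prop

theorem contDiff_energyField (γ : ℝ) {n : WithTop ℕ∞} : ContDiff ℝ n (energyField γ) := by
  have := contDiff_energyQ γ (n := n)
  unfold energyField; fun_prop

theorem contDiff_oscField {n : WithTop ℕ∞} : ContDiff ℝ n oscField := by
  unfold oscField; fun_prop

theorem exists_abs_le_region {f : ℝ × ℝ × ℝ → ℝ} (hf : Continuous f) :
    ∃ B : ℝ, 0 ≤ B ∧ ∀ X ∈ region, |f X| ≤ B := by
  obtain ⟨B, hB⟩ := isCompact_region.exists_bound_of_continuousOn hf.continuousOn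
  exact ⟨max B 0, le_max_right _ _, fun X hX => (hB X hX).trans (le_max_left _ _)⟩

theorem fst_le_one_of_mem_region {X : ℝ × ℝ × ℝ} (hX : X ∈ region) : X.1 ≤ 1 := by
  have h1 := hX.2.1
  have h2 := hX.2.2
  nlinarith [sq_nonneg X.2.1]

namespace IsFlow

variable {γ C t₀ : ℝ} {h H w Z r : ℝ → ℝ} {X : ℝ → ℝ × ℝ × ℝ}

theorem restrict (hX : IsFlow γ C t₀ h H w Z r X) {t₁ : ℝ} (h1 : t₀ ≤ t₁) :
    IsFlow γ C t₁ h H w Z r X := by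
  have hsub : Ici t₁ ⊆ Ici t₀ := Ici_subset_Ici.2 h1
  exact ⟨fun t ht => hX.mem t (hsub ht), fun t ht => hX.H_pos t (hsub ht),
    fun t ht => hX.H_le t (hsub ht), fun t ht => hX.w_le t (hsub ht),
    fun t ht => hX.Z_le t (hsub ht), fun t ht => hX.r_le t (hsub ht),
    fun t ht => (hX.deriv_X t (hsub ht)).mono hsub, fun t ht => (hX.deriv_H t (hsub ht)).mono hsub,
    fun t ht => (hX.deriv_Z t (hsub ht)).mono hsub⟩

theorem h_pos (hX : IsFlow γ C t₀ h H w Z r X) {t : ℝ} (ht : t ∈ Ici t₀) : 0 < h t :=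
  (hX.H_pos t ht).trans_le (hX.H_le t ht)

theorem abs_w_le_one (hX : IsFlow γ C t₀ h H w Z r X) {t : ℝ} (ht : t ∈ Ici t₀) : |w t| ≤ 1 :=
  (hX.w_le t ht).trans (fst_le_one_of_mem_region (hX.mem t ht))

theorem abs_Z_le (hX : IsFlow γ C t₀ h H w Z r X) (hC : 0 ≤ C) {t : ℝ} (ht : t ∈ Ici t₀) :
    |Z t| ≤ C * H t :=
  (hX.Z_le t ht).trans (mul_le_of_le_one_right (mul_nonneg hC (hX.H_pos t ht).le)
    (fst_le_one_of_mem_region (hX.mem t ht)))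

theorem abs_r_le (hX : IsFlow γ C t₀ h H w Z r X) (hC : 0 ≤ C) {t : ℝ} (ht : t ∈ Ici t₀) :
    |r t| ≤ C * h t * H t :=
  (hX.r_le t ht).trans (mul_le_of_le_one_right
    (mul_nonneg (mul_nonneg hC (hX.h_pos ht).le) (hX.H_pos t ht).le)
    (fst_le_one_of_mem_region (hX.mem t ht)))

theorem deriv_fst (hX : IsFlow γ C t₀ h H w Z r X) {t : ℝ} (ht : t ∈ Ici t₀) :
    HasDerivWithinAt (fun s => (X s).1)
      (h t * ((X t).1 * (2 * energyQ γ (X t) - 1) + w t * (-3 * (1 - (X t).1)))) (Ici t₀) t :=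
  (hX.deriv_X t ht).fst

theorem deriv_snd_fst (hX : IsFlow γ C t₀ h H w Z r X) {t : ℝ} (ht : t ∈ Ici t₀) :
    HasDerivWithinAt (fun s => (X s).2.1) (h t * ((X t).2.1 * (energyQ γ (X t) - 2) + (X t).2.2
      + w t * (3 / 2 * (X t).2.1))) (Ici t₀) t :=
  (hX.deriv_X t ht).snd.fst

theorem deriv_snd_snd (hX : IsFlow γ C t₀ h H w Z r X) {t : ℝ} (ht : t ∈ Ici t₀) :
    HasDerivWithinAt (fun s => (X s).2.2) (h t * (2 * (X t).2.2 * (energyQ γ (X t) - (X t).2.1)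
      + w t * (3 * (X t).2.2))) (Ici t₀) t :=
  (hX.deriv_X t ht).snd.snd

end IsFlow

/-- The first-order near-identity transformation: a function `L` of the state can be corrected so
that its derivative is that along the averaged field, up to `O(h H)`. -/
theorem exists_corrected (γ : ℝ) {C : ℝ} (hC : 0 ≤ C) {L : ℝ × ℝ × ℝ → ℝ} (hL : ContDiff ℝ 2 L) :
    ∃ A B : ℝ, 0 ≤ A ∧ 0 ≤ B ∧ ∀ (t₀ : ℝ) (h H w Z r : ℝ → ℝ) (X : ℝ → ℝ × ℝ × ℝ),
      IsFlow γ C t₀ h H w Z r X → ∃ Λ Λ' : ℝ → ℝ, ∀ t ∈ Ici t₀,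
        HasDerivWithinAt Λ (Λ' t) (Ici t₀) t ∧ |Λ t - L (X t)| ≤ B * H t ∧
        |Λ' t - h t * fderiv ℝ L (X t) (energyField γ (X t))| ≤ A * h t * H t := by
  set g : ℝ × ℝ × ℝ → ℝ := fun X => fderiv ℝ L X (oscField X) with hg
  have hg1 : ContDiff ℝ 1 g :=
    (hL.fderiv_right (m := 1) (by norm_num)).clm_apply contDiff_oscField
  have hgd : Continuous (fderiv ℝ g) := hg1.continuous_fderiv (by norm_num)
  obtain ⟨B₁, hB₁, hgB⟩ := exists_abs_le_region hg1.continuous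
  obtain ⟨B₂, hB₂, hgF⟩ := exists_abs_le_region (f := fun X => fderiv ℝ g X (energyField γ X))
    (hgd.clm_apply (contDiff_energyField γ (n := 0)).continuous)
  obtain ⟨B₃, hB₃, hgG⟩ := exists_abs_le_region (f := fun X => fderiv ℝ g X (oscField X))
    (hgd.clm_apply (contDiff_oscField (n := 0)).continuous)
  refine ⟨C * (B₁ + B₂ + B₃), C * B₁, by positivity, by positivity, ?_⟩
  intro t₀ h H w Z r X hX
  -- With `g = dL(G)`, the leading part `h w g(X)` of the derivative of `g(X) Z` cancels the
  -- oscillating part of the derivative of `L(X)`; what is left carries a factor `Z` or `r`.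
  refine ⟨fun t => L (X t) - g (X t) * Z t,
    fun t => fderiv ℝ L (X t) (h t • (energyField γ (X t) + w t • oscField (X t)))
      - (fderiv ℝ g (X t) (h t • (energyField γ (X t) + w t • oscField (X t))) * Z t
        + g (X t) * (h t * w t + r t)), fun t ht => ⟨?_, ?_, ?_⟩⟩
  · have h1 := ((hL.differentiable (by norm_num)) (X t)).hasFDerivAt.comp_hasDerivWithinAt t
      (hX.deriv_X t ht)
    have h2 := ((hg1.differentiable (by norm_num)) (X t)).hasFDerivAt.comp_hasDerivWithinAt t
      (hX.deriv_X t ht)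
    exact h1.sub (h2.mul (hX.deriv_Z t ht))
  · have h1 := hgB _ (hX.mem t ht)
    have h2 := hX.abs_Z_le hC ht
    rw [sub_sub_cancel_left, abs_neg, abs_mul]
    calc |g (X t)| * |Z t| ≤ B₁ * (C * H t) := by gcongr
      _ = C * B₁ * H t := by ring
  · have h0 := (hX.h_pos ht).le
    have hH := (hX.H_pos t ht).le
    have h1 := hgB _ (hX.mem t ht)
    have h2 := hgF _ (hX.mem t ht)
    have h3 := hgG _ (hX.mem t ht)
    have h4 := hX.abs_w_le_one ht
    have h5 := hX.abs_Z_le hC ht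
    have h6 := hX.abs_r_le hC ht
    have key : fderiv ℝ L (X t) (h t • (energyField γ (X t) + w t • oscField (X t)))
      - (fderiv ℝ g (X t) (h t • (energyField γ (X t) + w t • oscField (X t))) * Z t
        + g (X t) * (h t * w t + r t)) - h t * fderiv ℝ L (X t) (energyField γ (X t))
      = -(h t * (fderiv ℝ g (X t) (energyField γ (X t))
          + w t * fderiv ℝ g (X t) (oscField (X t))) * Z t + g (X t) * r t) := by
      simp only [map_smul, map_add, smul_eq_mul, hg]
      ring
    rw [key, abs_neg]
    calc _ ≤ |h t * (fderiv ℝ g (X t) (energyField γ (X t))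
          + w t * fderiv ℝ g (X t) (oscField (X t))) * Z t| + |g (X t) * r t| := abs_add_le _ _
      _ = h t * |fderiv ℝ g (X t) (energyField γ (X t))
          + w t * fderiv ℝ g (X t) (oscField (X t))| * |Z t| + |g (X t)| * |r t| := by
        rw [abs_mul, abs_mul, abs_mul, abs_of_nonneg h0]
      _ ≤ h t * (B₂ + 1 * B₃) * (C * H t) + B₁ * (C * h t * H t) := by
        gcongr
        refine (abs_add_le _ _).trans (add_le_add h2 ?_)
        rw [abs_mul]
        gcongr
      _ = C * (B₁ + B₂ + B₃) * h t * H t := by ring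

/-- As `H → 0` the time `∫ h dt` is infinite, so that no function decreasing at a rate
proportional to `h` is bounded below. -/
theorem IsFlow.exists_lt {γ C t₀ : ℝ} {h H w Z r : ℝ → ℝ} {X : ℝ → ℝ × ℝ × ℝ}
    (hX : IsFlow γ C t₀ h H w Z r X) (hH : Tendsto H atTop (𝓝 0)) {g g' : ℝ → ℝ} {a T : ℝ}
    (ha : 0 < a) (hT : t₀ ≤ T) (hg : ∀ t ∈ Ici T, HasDerivWithinAt g (g' t) (Ici t₀) t)
    (hg' : ∀ t ∈ Ici T, g' t ≤ -a * h t) (m : ℝ) : ∃ t ∈ Ici T, g t < m := by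
  obtain ⟨Q, hQ, hQ'⟩ := exists_abs_le_region (contDiff_energyQ γ (n := 0)).continuous
  -- `c` makes `(log H)' ≥ -c h`. Hence `g - (a / c) log H` is nonincreasing, while `log H` tends to
  -- `-∞`.
  set c := 1 + Q + 3 / 2 with hc
  have hc0 : 0 < c := by positivity
  have hmono : ∀ t ∈ Ici T, g t - a / c * Real.log (H t) ≤ g T - a / c * Real.log (H T) := by
    intro t ht
    refine le_of_hasDerivWithinAt_nonpos (f := fun t => g t - a / c * Real.log (H t))
      (f' := fun t => g' t - a / c * (-(h t * (1 + energyQ γ (X t) + 3 / 2 * w t) * H t) / H t))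
      hT ht (fun s hs => ?_) (fun s hs => ?_)
    · have hs0 : s ∈ Ici t₀ := hT.trans hs.1
      exact (hg s hs.1).sub (((hX.deriv_H s hs0).log (hX.H_pos s hs0).ne').const_mul _)
    · have hs0 : s ∈ Ici t₀ := hT.trans hs.1
      have h1 := hg' s hs.1
      have h2 := hX.h_pos hs0
      have h3 := (abs_le.1 (hQ' _ (hX.mem s hs0))).2
      have h4 := (abs_le.1 (hX.abs_w_le_one hs0)).2
      have h5 : -(h s * (1 + energyQ γ (X s) + 3 / 2 * w s) * H s) / H s
          = -(h s * (1 + energyQ γ (X s) + 3 / 2 * w s)) := by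
        rw [← neg_mul, mul_div_cancel_right₀ _ (hX.H_pos s hs0).ne']
      rw [h5]
      have h6 : h s * (1 + energyQ γ (X s) + 3 / 2 * w s) ≤ h s * c := by
        apply mul_le_mul_of_nonneg_left _ h2.le
        rw [hc]; linarith
      have h7 : a / c * (h s * (1 + energyQ γ (X s) + 3 / 2 * w s)) ≤ a / c * (h s * c) :=
        mul_le_mul_of_nonneg_left h6 (by positivity)
      have h8 : a / c * (h s * c) = a * h s := by field_simp
      linarith
  have hlog : Tendsto (fun t => Real.log (H t)) atTop atBot := by
    refine Real.tendsto_log_nhdsGT_zero.comp (tendsto_nhdsWithin_iff.2 ⟨hH, ?_⟩)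
    filter_upwards [Ici_mem_atTop t₀] with t ht using hX.H_pos t ht
  have hbot : Tendsto (fun t => a / c * Real.log (H t) + (g T - a / c * Real.log (H T)))
      atTop atBot := tendsto_atBot_add_const_right _ _ (hlog.const_mul_atBot (by positivity))
  obtain ⟨t, ht1, ht2⟩ := ((hbot.eventually_lt_atBot m).and (Ici_mem_atTop T)).exists
  exact ⟨t, ht2, by have := hmono t ht2; linarith⟩

/-! ## The direct method of Lyapunov -/

/-- `L` is a strict Lyapunov function for the averaged system at `p` within `region`; moreover
the scalar field has no energy at `p` and `H` decreases there. -/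
structure IsStrictLyapunov (γ : ℝ) (p : ℝ × ℝ × ℝ) (L : ℝ × ℝ × ℝ → ℝ) (ρ : ℝ) : Prop where
  contDiff : ContDiff ℝ 2 L
  ρ_pos : 0 < ρ
  mem : p ∈ region
  fst_eq_zero : p.1 = 0
  q_pos : 0 < 1 + energyQ γ p
  zero : L p = 0
  pos : ∀ X ∈ region, X ∈ Metric.closedBall p ρ → X ≠ p → 0 < L X
  decreasing : ∀ X ∈ region, X ∈ Metric.closedBall p ρ → X ≠ p →
    fderiv ℝ L X (energyField γ X) < 0

namespace IsStrictLyapunov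

variable {γ : ℝ} {p : ℝ × ℝ × ℝ} {L : ℝ × ℝ × ℝ → ℝ} {ρ : ℝ}

/-- Strict decrease is not assumed at `p`. There the weak inequality follows by continuity, since
the convex region contains a segment ending at `p`. -/
theorem decreasing_le (hL : IsStrictLyapunov γ p L ρ) {X : ℝ × ℝ × ℝ} (hX : X ∈ region)
    (hp : X ∈ Metric.closedBall p ρ) : fderiv ℝ L X (energyField γ X) ≤ 0 := by
  by_cases hXp : X = p
  · subst hXp
    have hmin : IsLocalMinOn L region X := by
      filter_upwards [self_mem_nhdsWithin,
        mem_nhdsWithin_of_mem_nhds (Metric.closedBall_mem_nhds X hL.ρ_pos)] with Y hY hY'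
      by_cases hYX : Y = X
      · rw [hYX]
      · rw [hL.zero]; exact (hL.pos Y hY hY' hYX).le
    by_contra hcon
    push Not at hcon
    set U := {Y | 0 < fderiv ℝ L Y (energyField γ Y)} with hU
    have hUo : IsOpen U := isOpen_lt continuous_const
      ((hL.contDiff.continuous_fderiv (by norm_num)).clm_apply
        (contDiff_energyField γ (n := 0)).continuous)
    have hnhds : U ∩ Metric.closedBall X ρ ∈ 𝓝 X :=
      inter_mem (hUo.mem_nhds hcon) (Metric.closedBall_mem_nhds X hL.ρ_pos)
    -- a point of the region other than `X` close to `X`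
    have hcurve : ∃ c : ℝ → ℝ × ℝ × ℝ, Continuous c ∧ c 0 = X ∧
        ∀ s ∈ Ioo (0 : ℝ) 1, c s ∈ region ∧ c s ≠ X := by
      have hbig : ∃ Y ∈ region, Y ≠ X := by
        by_cases h0 : X = (0, 0, 0)
        · exact ⟨(1, 0, 0), by simp [region], by simp [h0]⟩
        · exact ⟨(0, 0, 0), by simp [region], fun h => h0 h.symm⟩
      obtain ⟨Y, hY, hYX⟩ := hbig
      refine ⟨fun s => X + s • (Y - X), by fun_prop, by simp, fun s hs => ⟨?_, ?_⟩⟩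
      · obtain ⟨h1, h2, h3⟩ := hX
        obtain ⟨g1, g2, g3⟩ := hY
        obtain ⟨s0, s1⟩ := hs
        refine ⟨?_, ?_, ?_⟩
        · simp only [Prod.fst_add, Prod.smul_fst, Prod.fst_sub, smul_eq_mul]; nlinarith
        · simp only [Prod.snd_add, Prod.smul_snd, Prod.snd_sub, smul_eq_mul]; nlinarith
        · simp only [Prod.fst_add, Prod.smul_fst, Prod.fst_sub, Prod.snd_add, Prod.smul_snd,
            Prod.snd_sub, smul_eq_mul]
          nlinarith [mul_nonneg (mul_nonneg s0.le (sub_nonneg.2 s1.le))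
            (sq_nonneg (X.2.1 - Y.2.1))]
      · simp [sub_eq_zero, hYX, hs.1.ne']
    obtain ⟨c, hc, hc0, hcs⟩ := hcurve
    have hev : ∀ᶠ s in 𝓝[>] (0 : ℝ), c s ∈ U ∩ Metric.closedBall X ρ :=
      (hc.tendsto' 0 X hc0).mono_left nhdsWithin_le_nhds hnhds
    obtain ⟨s, hs1, hs2⟩ := (hev.and (Ioo_mem_nhdsGT one_pos)).exists
    have h3 := hL.decreasing (c s) (hcs s hs2).1 hs1.2 (hcs s hs2).2
    exact lt_asymm h3 hs1.1
  · exact (hL.decreasing X hX hp hXp).le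

/-- Near `p` the energy fraction is small, hence so is `w`, and `H' ≤ -c h H`. Adding `(A / c) H` to
the corrected function absorbs its error `A h H`. -/
theorem exists_adiabatic (hL : IsStrictLyapunov γ p L ρ) {C : ℝ} (hC : 0 ≤ C) :
    ∃ ρ' c B : ℝ, 0 < ρ' ∧ ρ' ≤ ρ ∧ 0 < c ∧ 0 ≤ B ∧
      ∀ (t₀ : ℝ) (h H w Z r : ℝ → ℝ) (X : ℝ → ℝ × ℝ × ℝ), IsFlow γ C t₀ h H w Z r X →
        ∃ Λ Λ' : ℝ → ℝ, ∀ t ∈ Ici t₀, HasDerivWithinAt Λ (Λ' t) (Ici t₀) t ∧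
          |Λ t - L (X t)| ≤ B * H t ∧ (X t ∈ Metric.closedBall p ρ' →
            Λ' t ≤ h t * fderiv ℝ L (X t) (energyField γ (X t)) ∧
            c ≤ 1 + energyQ γ (X t) + 3 / 2 * w t) := by
  obtain ⟨A, B, hA, hB, hcor⟩ := exists_corrected γ hC hL.contDiff
  set c := (1 + energyQ γ p) / 2 with hc
  have hc0 : 0 < c := half_pos hL.q_pos
  have hopen : {X : ℝ × ℝ × ℝ | c < 1 + energyQ γ X - 3 / 2 * X.1} ∈ 𝓝 p := by
    refine (isOpen_lt continuous_const ?_).mem_nhds ?_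
    · have := (contDiff_energyQ γ (n := 0)).continuous
      fun_prop
    · simp only [mem_ofPred_eq, hL.fst_eq_zero, hc]
      linarith [hL.q_pos]
  obtain ⟨ρ₁, hρ₁, hball⟩ := Metric.nhds_basis_closedBall.mem_iff.1 hopen
  refine ⟨min ρ ρ₁, c, B + A / c, lt_min hL.ρ_pos hρ₁, min_le_left _ _, hc0, by positivity, ?_⟩
  intro t₀ h H w Z r X hX
  obtain ⟨Λ, Λ', hΛ⟩ := hcor t₀ h H w Z r X hX
  refine ⟨fun t => Λ t + A / c * H t, fun t => Λ' t
    + A / c * -(h t * (1 + energyQ γ (X t) + 3 / 2 * w t) * H t), fun t ht => ⟨?_, ?_, ?_⟩⟩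
  · exact (hΛ t ht).1.add ((hX.deriv_H t ht).const_mul _)
  · have h1 := (hΛ t ht).2.1
    have h2 := hX.H_pos t ht
    have h3 : Λ t + A / c * H t - L (X t) = (Λ t - L (X t)) + A / c * H t := by ring
    rw [h3, add_mul]
    refine (abs_add_le _ _).trans (add_le_add h1 ?_)
    rw [abs_of_nonneg (by positivity)]
  · intro hball'
    have h1 : X t ∈ Metric.closedBall p ρ₁ :=
      Metric.closedBall_subset_closedBall (min_le_right _ _) hball'
    have h2 : c < 1 + energyQ γ (X t) - 3 / 2 * (X t).1 := hball h1
    have h3 := (abs_le.1 (hX.w_le t ht)).1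
    have h4 : c ≤ 1 + energyQ γ (X t) + 3 / 2 * w t := by linarith
    refine ⟨?_, h4⟩
    have h5 := (abs_le.1 (hΛ t ht).2.2).2
    have h6 : h t * H t * c ≤ h t * H t * (1 + energyQ γ (X t) + 3 / 2 * w t) :=
      mul_le_mul_of_nonneg_left h4 (mul_pos (hX.h_pos ht) (hX.H_pos t ht)).le
    have h7 := mul_le_mul_of_nonneg_left h6 (div_nonneg hA hc0.le)
    have h8 : A / c * (h t * H t * c) = A * h t * H t := by field_simp
    have h9 : A / c * -(h t * (1 + energyQ γ (X t) + 3 / 2 * w t) * H t)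
      = -(A / c * (h t * H t * (1 + energyQ γ (X t) + 3 / 2 * w t))) := by ring
    beta_reduce
    rw [h9]
    linarith

/-- The usual barrier argument, applied to `Λ` instead of `L`: as long as the curve stays near `p`,
both `Λ` and `H` are nonincreasing. -/
theorem stable (hL : IsStrictLyapunov γ p L ρ) {C : ℝ} (hC : 0 ≤ C) {ε : ℝ} (hε : 0 < ε) :
    ∃ δ > 0, ∃ η > 0, ∀ (t₀ : ℝ) (h H w Z r : ℝ → ℝ) (X : ℝ → ℝ × ℝ × ℝ),
      IsFlow γ C t₀ h H w Z r X → X t₀ ∈ Metric.ball p δ → H t₀ < η →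
        ∀ t ∈ Ici t₀, X t ∈ Metric.ball p ε := by
  obtain ⟨ρ', c, B, hρ', hρρ, hc, hB, had⟩ := hL.exists_adiabatic hC
  set e := min (ε / 2) ρ' with he
  have he0 : 0 < e := lt_min (half_pos hε) hρ'
  have hcomp : IsCompact (region ∩ Metric.sphere p e) :=
    isCompact_region.inter_right Metric.isClosed_sphere
  obtain ⟨m, hm, hmL⟩ : ∃ m > 0, ∀ X ∈ region ∩ Metric.sphere p e, m ≤ L X := by
    rcases (region ∩ Metric.sphere p e).eq_empty_or_nonempty with hne | hne
    · exact ⟨1, one_pos, by simp [hne]⟩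
    · obtain ⟨X, hX, hmin⟩ := hcomp.exists_isMinOn hne hL.contDiff.continuous.continuousOn
      refine ⟨L X, hL.pos X hX.1 ?_ ?_, fun Y hY => hmin hY⟩
      · exact Metric.closedBall_subset_closedBall ((min_le_right _ _).trans hρρ)
          (Metric.sphere_subset_closedBall hX.2)
      · rintro rfl
        have := hX.2
        simp at this
        exact he0.ne this
  have hnear : {X | L X < m / 4} ∩ Metric.ball p e ∈ 𝓝 p := by
    refine inter_mem ((isOpen_lt hL.contDiff.continuous continuous_const).mem_nhds ?_)
      (Metric.ball_mem_nhds p he0)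
    simp only [mem_ofPred_eq, hL.zero]; positivity
  obtain ⟨δ, hδ, hδs⟩ := Metric.mem_nhds_iff.1 hnear
  -- Initially `L < m / 4` and `B H < m / 4`, so `Λ < m / 2`; on the sphere `Λ ≥ m - B H > 3 m / 4`.
  refine ⟨δ, hδ, m / (4 * (B + 1)), by positivity, ?_⟩
  intro t₀ h H w Z r X hX hX0 hH0 t ht
  obtain ⟨Λ, Λ', hΛ⟩ := had t₀ h H w Z r X hX
  have hXc : ContinuousOn X (Ici t₀) := fun s hs => (hX.deriv_X s hs).continuousWithinAt
  have hlt : ∀ s ∈ Ici t₀, dist (X s) p < e := by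
    by_contra hcon
    push Not at hcon
    obtain ⟨s, hs, hse⟩ := hcon
    have hd : ContinuousOn (fun s => dist (X s) p) (Icc t₀ s) :=
      continuous_dist.comp_continuousOn
        ((hXc.mono Icc_subset_Ici_self).prodMk continuousOn_const)
    set S := Icc t₀ s ∩ (fun s => dist (X s) p) ⁻¹' Ici e with hS
    have hScomp : IsCompact S :=
      isCompact_Icc.of_isClosed_subset (hd.preimage_isClosed_of_isClosed isClosed_Icc isClosed_Ici)
        inter_subset_left
    obtain ⟨s₁, hs₁, hleast⟩ := hScomp.exists_isLeast ⟨s, ⟨hs, le_rfl⟩, hse⟩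
    -- `s₁` is the first time at which the distance to `p` reaches `e`.
    have h0 : t₀ ≤ s₁ := hs₁.1.1
    have hbefore : ∀ u ∈ Icc t₀ s₁, u < s₁ → dist (X u) p < e := by
      intro u hu hlt
      by_contra hge
      push Not at hge
      exact absurd (hleast ⟨⟨hu.1, hu.2.trans hs₁.1.2⟩, hge⟩) (not_le.2 hlt)
    have hle : dist (X s₁) p ≤ e := by
      rcases h0.eq_or_lt with heq | hlt
      · rw [← heq]; exact (hδs hX0).2.le
      · have hcw : ContinuousWithinAt (fun s => dist (X s) p) (Icc t₀ s₁) s₁ :=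
          (hd.mono (Icc_subset_Icc_right hs₁.1.2)) s₁ ⟨h0, le_rfl⟩
        have hcw' := hcw.mono (Ico_subset_Icc_self)
        have : (𝓝[Ico t₀ s₁] s₁).NeBot := by
          rw [nhdsWithin_Ico_eq_nhdsLT hlt]; infer_instance
        refine le_of_tendsto hcw' ?_
        filter_upwards [self_mem_nhdsWithin] with u hu
        exact (hbefore u ⟨hu.1, hu.2.le⟩ hu.2).le
    have hin : ∀ u ∈ Icc t₀ s₁, X u ∈ Metric.closedBall p ρ' := by
      intro u hu
      rw [Metric.mem_closedBall]
      refine le_trans ?_ (min_le_right (ε / 2) ρ')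
      rcases hu.2.eq_or_lt with heq | hlt
      · rw [heq]; exact hle
      · exact (hbefore u hu hlt).le
    have hdecΛ : Λ s₁ ≤ Λ t₀ := by
      refine le_of_hasDerivWithinAt_nonpos le_rfl h0 (fun u hu => (hΛ u hu.1).1) fun u hu => ?_
      refine ((hΛ u hu.1).2.2 (hin u hu)).1.trans ?_
      exact mul_nonpos_of_nonneg_of_nonpos (hX.h_pos hu.1).le
        (hL.decreasing_le (hX.mem u hu.1)
          (Metric.closedBall_subset_closedBall hρρ (hin u hu)))
    have hdecH : H s₁ ≤ H t₀ := by
      refine le_of_hasDerivWithinAt_nonpos le_rfl h0 (fun u hu => hX.deriv_H u hu.1) fun u hu => ?_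
      have h1 := ((hΛ u hu.1).2.2 (hin u hu)).2
      have h2 := hX.h_pos hu.1
      have h3 := hX.H_pos u hu.1
      have : 0 ≤ h u * (1 + energyQ γ (X u) + 3 / 2 * w u) * H u := by
        have : 0 < 1 + energyQ γ (X u) + 3 / 2 * w u := hc.trans_le h1
        positivity
      linarith
    have hm1 : m ≤ L (X s₁) := hmL _ ⟨hX.mem s₁ h0, le_antisymm hle hs₁.2⟩
    have hm2 : L (X t₀) < m / 4 := (hδs hX0).1
    have h4 := (abs_le.1 (hΛ s₁ h0).2.1).1
    have h5 := (abs_le.1 (hΛ t₀ (le_refl t₀)).2.1).2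
    have h6 : (B + 1) * H t₀ < m / 4 := by
      rw [lt_div_iff₀ (by positivity)] at hH0
      linarith
    have h7 : B * H s₁ ≤ B * H t₀ := mul_le_mul_of_nonneg_left hdecH hB
    have h8 := hX.H_pos t₀ (le_refl t₀)
    linarith
  have := hlt t ht
  rw [Metric.mem_ball]
  have h1 : e ≤ ε / 2 := min_le_left _ _
  linarith

/-- Since `H ≤ h`, `1 / H` grows at least linearly. If the curve stayed away from `p`, `Λ` would
decrease at a rate proportional to `h` and become unbounded. So the curve enters every ball around
`p` at late times, when `H` is small, and `stable` restarted there keeps it close. -/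
theorem tendsto (hL : IsStrictLyapunov γ p L ρ) {C : ℝ} (hC : 0 ≤ C) :
    ∃ δ > 0, ∃ η > 0, ∀ (t₀ : ℝ) (h H w Z r : ℝ → ℝ) (X : ℝ → ℝ × ℝ × ℝ),
      IsFlow γ C t₀ h H w Z r X → X t₀ ∈ Metric.ball p δ → H t₀ < η →
        Tendsto X atTop (𝓝 p) ∧ Tendsto H atTop (𝓝 0) := by
  obtain ⟨ρ', c, B, hρ', hρρ, hc, hB, had⟩ := hL.exists_adiabatic hC
  obtain ⟨δ, hδ, η, hη, hst⟩ := hL.stable hC hρ'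
  refine ⟨δ, hδ, η, hη, fun t₀ h H w Z r X hX hX0 hH0 => ?_⟩
  have hin : ∀ t ∈ Ici t₀, X t ∈ Metric.closedBall p ρ' := fun t ht =>
    Metric.ball_subset_closedBall (hst t₀ h H w Z r X hX hX0 hH0 t ht)
  obtain ⟨Λ, Λ', hΛ⟩ := had t₀ h H w Z r X hX
  have hHinv : ∀ t ∈ Ici t₀, c * (t - t₀) ≤ (H t)⁻¹ := by
    intro t ht
    have := le_of_hasDerivWithinAt_nonneg (f := fun s => (H s)⁻¹ - c * (s - t₀))
      (f' := fun s => -(-(h s * (1 + energyQ γ (X s) + 3 / 2 * w s) * H s)) / H s ^ 2 - c * 1)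
      le_rfl ht (fun s hs => ((hX.deriv_H s hs.1).inv (hX.H_pos s hs.1).ne').sub
        (((hasDerivWithinAt_id s _).sub_const t₀).const_mul c)) (fun s hs => by
        have h1 := ((hΛ s hs.1).2.2 (hin s hs.1)).2
        have h2 := hX.H_le s hs.1
        have h3 := hX.H_pos s hs.1
        have h4 : c * H s ^ 2 ≤ h s * (1 + energyQ γ (X s) + 3 / 2 * w s) * H s := by
          rw [pow_two, ← mul_assoc]
          apply mul_le_mul_of_nonneg_right _ h3.le
          rw [mul_comm c]
          exact mul_le_mul h2 h1 hc.le (h3.le.trans h2)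
        rw [neg_neg, mul_one, sub_nonneg, le_div_iff₀ (by positivity)]
        exact h4)
    simp only [sub_self, mul_zero, sub_zero] at this
    have h1 : 0 < (H t₀)⁻¹ := inv_pos.2 (hX.H_pos t₀ (le_refl t₀))
    linarith
  have hH : Tendsto H atTop (𝓝 0) := by
    have h1 : Tendsto (fun t => (H t)⁻¹) atTop atTop := by
      refine tendsto_atTop_mono' atTop ?_ ((tendsto_atTop_add_const_right atTop (-t₀)
        tendsto_id).const_mul_atTop hc)
      filter_upwards [Ici_mem_atTop t₀] with t ht using hHinv t ht
    simpa using h1.inv_tendsto_atTop.congr fun t => by simp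
  refine ⟨?_, hH⟩
  -- the curve comes back to every ball around `p`
  have hreturn : ∀ d > 0, ∀ T, t₀ ≤ T → ∃ t ∈ Ici T, X t ∈ Metric.ball p d := by
    intro d hd T hT
    by_contra hcon
    push Not at hcon
    set K := region ∩ (Metric.closedBall p ρ' \ Metric.ball p d) with hK
    have hKc : IsCompact K := isCompact_region.inter_right
      (Metric.isClosed_closedBall.sdiff Metric.isOpen_ball)
    have hXK : ∀ t ∈ Ici T, X t ∈ K := fun t ht =>
      ⟨hX.mem t (hT.trans ht), hin t (hT.trans ht), hcon t ht⟩
    obtain ⟨Y, hY, hmax⟩ := hKc.exists_isMaxOn ⟨X T, hXK T (le_refl T)⟩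
      (f := fun X => fderiv ℝ L X (energyField γ X))
      ((hL.contDiff.continuous_fderiv (by norm_num)).clm_apply
        (contDiff_energyField γ (n := 0)).continuous).continuousOn
    have hYneg : fderiv ℝ L Y (energyField γ Y) < 0 := by
      refine hL.decreasing Y hY.1 (Metric.closedBall_subset_closedBall hρρ hY.2.1) ?_
      rintro rfl
      exact hY.2.2 (Metric.mem_ball_self hd)
    obtain ⟨M, hM, hML⟩ := exists_abs_le_region hL.contDiff.continuous
    have hHle : ∀ t ∈ Ici T, H t ≤ H T := by
      intro t ht
      refine le_of_hasDerivWithinAt_nonpos hT ht (fun u hu => hX.deriv_H u (hT.trans hu.1))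
        fun u hu => ?_
      have hu0 : u ∈ Ici t₀ := hT.trans hu.1
      have h1 := ((hΛ u hu0).2.2 (hin u hu0)).2
      have h2 := hX.h_pos hu0
      have h3 := hX.H_pos u hu0
      have : 0 ≤ h u * (1 + energyQ γ (X u) + 3 / 2 * w u) * H u := by
        have : 0 < 1 + energyQ γ (X u) + 3 / 2 * w u := hc.trans_le h1
        positivity
      linarith
    obtain ⟨t, ht, hlt⟩ := hX.exists_lt hH (g := Λ) (g' := Λ') (neg_pos.2 hYneg) hT
      (fun t ht => (hΛ t (hT.trans ht)).1) (fun t ht => by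
        refine ((hΛ t (hT.trans ht)).2.2 (hin t (hT.trans ht))).1.trans ?_
        rw [neg_neg, mul_comm]
        exact mul_le_mul_of_nonneg_right (hmax (hXK t ht)) (hX.h_pos (hT.trans ht)).le)
      (-M - B * H T)
    have h1 := (abs_le.1 (hΛ t (hT.trans ht)).2.1).1
    have h2 := (abs_le.1 (hML _ (hX.mem t (hT.trans ht)))).1
    have h3 := mul_le_mul_of_nonneg_left (hHle t ht) hB
    linarith
  rw [Metric.tendsto_atTop]
  intro ε hε
  obtain ⟨d, hd, θ, hθ, hst'⟩ := hL.stable hC hε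
  obtain ⟨T, hT⟩ := Filter.eventually_atTop.1
    ((hH.eventually (gt_mem_nhds hθ)).and (Ici_mem_atTop t₀))
  obtain ⟨t₁, ht₁, hXt₁⟩ := hreturn d hd T (hT T le_rfl).2
  have ht₁' := hT t₁ ht₁
  exact ⟨t₁, fun t ht => hst' t₁ h H w Z r X (hX.restrict ht₁'.2) hXt₁ ht₁'.1 t ht⟩

end IsStrictLyapunov

/-! ## Necessary conditions for a limit point -/

namespace IsFlow

variable {γ C t₀ : ℝ} {h H w Z r : ℝ → ℝ} {X : ℝ → ℝ × ℝ × ℝ} {p : ℝ × ℝ × ℝ}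

theorem limit_mem_region (hX : IsFlow γ C t₀ h H w Z r X) (hp : Tendsto X atTop (𝓝 p)) :
    p ∈ region := by
  refine isCompact_region.isClosed.mem_of_tendsto hp ?_
  filter_upwards [Ici_mem_atTop t₀] with t ht using hX.mem t ht

/-- Otherwise the corrected function would eventually decrease at a rate proportional to `h`,
although it is bounded. Applied to a linear functional and its negative, this forces the averaged
field to vanish at the limit. -/
theorem fderiv_limit_nonneg (hX : IsFlow γ C t₀ h H w Z r X) (hC : 0 ≤ C)
    (hp : Tendsto X atTop (𝓝 p)) (hH : Tendsto H atTop (𝓝 0)) {L : ℝ × ℝ × ℝ → ℝ}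
    (hL : ContDiff ℝ 2 L) : 0 ≤ fderiv ℝ L p (energyField γ p) := by
  by_contra hneg
  push Not at hneg
  obtain ⟨A, B, hA, hB, hcor⟩ := exists_corrected γ hC hL
  obtain ⟨Λ, Λ', hΛ⟩ := hcor t₀ h H w Z r X hX
  obtain ⟨M, hM, hML⟩ := exists_abs_le_region hL.continuous
  set a := -fderiv ℝ L p (energyField γ p) / 2 with ha
  have ha0 : 0 < a := by rw [ha]; linarith
  have hlim : Tendsto (fun t => fderiv ℝ L (X t) (energyField γ (X t)) + A * H t) atTop
      (𝓝 (fderiv ℝ L p (energyField γ p) + A * 0)) := by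
    refine Tendsto.add ?_ (hH.const_mul A)
    exact ((((hL.continuous_fderiv (by norm_num)).clm_apply
      (contDiff_energyField γ (n := 0)).continuous).tendsto p).comp hp)
  have hev := hlim.eventually (gt_mem_nhds (show fderiv ℝ L p (energyField γ p) + A * 0 < -a by
    rw [ha]; linarith))
  obtain ⟨T, hT⟩ := Filter.eventually_atTop.1
    ((hev.and (hH.eventually (gt_mem_nhds one_pos))).and (Ici_mem_atTop t₀))
  obtain ⟨t, ht, hlt⟩ := hX.exists_lt hH (g := Λ) (g' := Λ') ha0 (hT T le_rfl).2
    (fun t ht => (hΛ t (hT t ht).2).1) (fun t ht => by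
      have h1 := (abs_le.1 (hΛ t (hT t ht).2).2.2).2
      have h2 := mul_le_mul_of_nonneg_left (hT t ht).1.1.le (hX.h_pos (hT t ht).2).le
      linarith) (-M - B)
  have h1 := (abs_le.1 (hΛ t (hT t ht).2).2.1).1
  have h2 := (abs_le.1 (hML _ (hX.mem t (hT t ht).2))).1
  have h3 := mul_le_mul_of_nonneg_left (hT t ht).1.2.le hB
  linarith

/-- The limit of a flow is an equilibrium point of the averaged system. -/
theorem energyField_limit (hX : IsFlow γ C t₀ h H w Z r X) (hC : 0 ≤ C)
    (hp : Tendsto X atTop (𝓝 p)) (hH : Tendsto H atTop (𝓝 0)) : energyField γ p = 0 := by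
  have key : ∀ ℓ : ℝ × ℝ × ℝ →L[ℝ] ℝ, ℓ (energyField γ p) = 0 := by
    intro ℓ
    have h1 := hX.fderiv_limit_nonneg hC hp hH (L := ℓ) ℓ.contDiff
    have h2 := hX.fderiv_limit_nonneg hC hp hH (L := (-ℓ : ℝ × ℝ × ℝ →L[ℝ] ℝ))
      (ContinuousLinearMap.contDiff _)
    rw [ContinuousLinearMap.fderiv] at h1 h2
    simp only [neg_apply] at h2
    linarith
  have h1 := key (ContinuousLinearMap.fst ℝ ℝ (ℝ × ℝ))
  have h2 := key ((ContinuousLinearMap.fst ℝ ℝ ℝ).comp (ContinuousLinearMap.snd ℝ ℝ (ℝ × ℝ)))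
  have h3 := key ((ContinuousLinearMap.snd ℝ ℝ ℝ).comp (ContinuousLinearMap.snd ℝ ℝ (ℝ × ℝ)))
  exact Prod.ext h1 (Prod.ext h2 h3)

/-- The averaged growth rate of a positive bounded quantity is nonpositive at a limit point. -/
theorem growth_rate_nonpos (hX : IsFlow γ C t₀ h H w Z r X)
    (hp : Tendsto X atTop (𝓝 p)) (hH : Tendsto H atTop (𝓝 0)) {α : ℝ × ℝ × ℝ → ℝ}
    (hα : Continuous α) {y β ζ s : ℝ → ℝ} {D : ℝ} (hD : 0 ≤ D)
    (hy0 : ∀ t ∈ Ici t₀, 0 < y t) (hy1 : ∀ t ∈ Ici t₀, y t ≤ 1)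
    (hy : ∀ t ∈ Ici t₀, HasDerivWithinAt y (h t * y t * (α (X t) + β t)) (Ici t₀) t)
    (hζ : ∀ t ∈ Ici t₀, HasDerivWithinAt ζ (h t * β t + s t) (Ici t₀) t)
    (hs : ∀ t ∈ Ici t₀, |s t| ≤ D * h t * H t) (hζD : ∀ t ∈ Ici t₀, |ζ t| ≤ D * H t) :
    α p ≤ 0 := by
  by_contra hpos
  push Not at hpos
  have hlim : Tendsto (fun t => α (X t) - D * H t) atTop (𝓝 (α p - D * 0)) :=
    ((hα.tendsto p).comp hp).sub (hH.const_mul D)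
  have hev := hlim.eventually (lt_mem_nhds (show α p / 2 < α p - D * 0 by linarith))
  obtain ⟨T, hT⟩ := Filter.eventually_atTop.1
    ((hev.and (hH.eventually (gt_mem_nhds one_pos))).and (Ici_mem_atTop t₀))
  -- The oscillating part `β` of the growth rate cancels against `ζ'`; the remaining function is
  -- bounded below because `y ≤ 1`.
  obtain ⟨t, ht, hlt⟩ := hX.exists_lt hH (g := fun t => ζ t - Real.log (y t))
    (g' := fun t => (h t * β t + s t) - h t * y t * (α (X t) + β t) / y t)
    (half_pos hpos) (hT T le_rfl).2
    (fun t ht => (hζ t (hT t ht).2).sub ((hy t (hT t ht).2).log (hy0 t (hT t ht).2).ne'))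
    (fun t ht => by
      have ht0 := (hT t ht).2
      have h1 : h t * y t * (α (X t) + β t) / y t = h t * (α (X t) + β t) := by
        rw [mul_right_comm, mul_div_cancel_right₀ _ (hy0 t ht0).ne']
      have h2 := mul_le_mul_of_nonneg_left (hT t ht).1.1.le (hX.h_pos ht0).le
      have h3 := (abs_le.1 (hs t ht0)).2
      rw [h1]
      linarith) (-D)
  have ht0 := (hT t ht).2
  have h1 := (abs_le.1 (hζD t ht0)).1
  have h2 := Real.log_nonpos (hy0 t ht0).le (hy1 t ht0)
  have h3 := mul_le_mul_of_nonneg_left (hT t ht).1.2.le hD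
  linarith

/-- Conservation of the fluid: the logarithmic rate is `2 (1 + q) - 3 γ` with `q = energyQ + 3 w /
2`. -/
theorem deriv_matter (hX : IsFlow γ C t₀ h H w Z r X) {t : ℝ} (ht : t ∈ Ici t₀) :
    HasDerivWithinAt (fun s => 1 - (X s).1 - (X s).2.1 ^ 2 - (X s).2.2)
      (h t * (1 - (X t).1 - (X t).2.1 ^ 2 - (X t).2.2)
        * (2 + 2 * energyQ γ (X t) - 3 * γ + 3 * w t)) (Ici t₀) t := by
  have h1 := (((hasDerivWithinAt_const t (Ici t₀) (1 : ℝ)).sub (hX.deriv_fst ht)).sub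
    ((hX.deriv_snd_fst ht).pow 2)).sub (hX.deriv_snd_snd ht)
  refine h1.congr_deriv ?_
  have hq : energyQ γ (X t) = 2 * (X t).2.1 ^ 2
    + (3 * γ - 2) / 2 * (1 - (X t).1 - (X t).2.1 ^ 2 - (X t).2.2) + (X t).1 / 2 := rfl
  simp only [Nat.cast_ofNat, Nat.add_one_sub_one, pow_one]
  have : (3 * γ - 2) * (1 - (X t).1 - (X t).2.1 ^ 2 - (X t).2.2)
    = 2 * energyQ γ (X t) - 4 * (X t).2.1 ^ 2 - (X t).1 := by rw [hq]; ring
  linear_combination (h t) * this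

/-- The conditions satisfied by the limit of a flow along which scalar field, curvature and matter
are present. -/
theorem limit_conditions (hX : IsFlow γ C t₀ h H w Z r X) (hC : 0 ≤ C)
    (hp : Tendsto X atTop (𝓝 p)) (hH : Tendsto H atTop (𝓝 0))
    (hE : ∀ t ∈ Ici t₀, 0 < (X t).1) (hk : ∀ t ∈ Ici t₀, 0 < (X t).2.2)
    (hM : ∀ t ∈ Ici t₀, 0 < 1 - (X t).1 - (X t).2.1 ^ 2 - (X t).2.2) :
    energyField γ p = 0 ∧ energyQ γ p ≤ p.2.1 ∧ 2 + 2 * energyQ γ p ≤ 3 * γ ∧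
      2 * energyQ γ p ≤ 1 := by
  have hqc := (contDiff_energyQ γ (n := 0)).continuous
  have h3Z : ∀ t ∈ Ici t₀, HasDerivWithinAt (fun t => 3 * Z t) (h t * (3 * w t) + 3 * r t)
      (Ici t₀) t := fun t ht => ((hX.deriv_Z t ht).const_mul 3).congr_deriv (by ring)
  have h3r : ∀ t ∈ Ici t₀, |3 * r t| ≤ 3 * C * h t * H t := fun t ht => by
    rw [abs_mul, abs_of_pos (by norm_num : (0 : ℝ) < 3)]
    linarith [hX.abs_r_le hC ht]
  have h3Zl : ∀ t ∈ Ici t₀, |3 * Z t| ≤ 3 * C * H t := fun t ht => by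
    rw [abs_mul, abs_of_pos (by norm_num : (0 : ℝ) < 3)]
    linarith [hX.abs_Z_le hC ht]
  refine ⟨hX.energyField_limit hC hp hH, ?_, ?_, ?_⟩
  · have := hX.growth_rate_nonpos hp hH (α := fun X => 2 * (energyQ γ X - X.2.1)) (by fun_prop)
      (D := 3 * C) (by positivity) hk (fun t ht => by
        have h1 := (hX.mem t ht).1
        have h2 := (hX.mem t ht).2.2
        nlinarith [sq_nonneg (X t).2.1])
      (fun t ht => (hX.deriv_snd_snd ht).congr_deriv (by ring)) h3Z h3r h3Zl
    linarith
  · have := hX.growth_rate_nonpos hp hH (α := fun X => 2 + 2 * energyQ γ X - 3 * γ) (by fun_prop)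
      (D := 3 * C) (by positivity) hM (fun t ht => by
        have h1 := (hX.mem t ht).1
        have h2 := (hX.mem t ht).2.1
        nlinarith [sq_nonneg (X t).2.1])
      (fun t ht => hX.deriv_matter ht) h3Z h3r h3Zl
    linarith
  · obtain ⟨Q, hQ, hQ'⟩ := exists_abs_le_region hqc
    -- The equation for `E` divided by `h E` leaves the oscillating term `3 w - 3 w / E`, whose
    -- approximate primitive is `3 Z - 3 Z / E`. In `2 Q + 9`, the bound `2 Q + 7` of the growth
    -- rate of `E` is increased by one each for `r` and `r / E`.
    have := hX.growth_rate_nonpos hp hH (α := fun X => 2 * energyQ γ X - 1) (by fun_prop)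
      (D := 3 * C * (2 * Q + 9)) (by positivity) hE
      (fun t ht => fst_le_one_of_mem_region (hX.mem t ht))
      (β := fun t => 3 * w t - 3 * w t / (X t).1) (ζ := fun t => 3 * Z t - 3 * Z t / (X t).1)
      (s := fun t => 3 * r t - 3 * r t / (X t).1 + 3 * Z t / (X t).1
        * (h t * ((2 * energyQ γ (X t) - 1) + (3 * w t - 3 * w t / (X t).1))))
      (fun t ht => (hX.deriv_fst ht).congr_deriv (by have := (hE t ht).ne'; field_simp; ring))
      (fun t ht => by
        have h1 := (hE t ht).ne'
        refine ((h3Z t ht).sub ((h3Z t ht).div (hX.deriv_fst ht) h1)).congr_deriv ?_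
        field_simp
        ring)
      (fun t ht => ?_) (fun t ht => ?_)
    · linarith
    · have hE0 := hE t ht
      have hh := (hX.h_pos ht).le
      have hHt := (hX.H_pos t ht).le
      have h1 : |r t / (X t).1| ≤ C * h t * H t := by
        rw [abs_div, abs_of_pos hE0, div_le_iff₀ hE0]; exact hX.r_le t ht
      have h2 : |Z t / (X t).1| ≤ C * H t := by
        rw [abs_div, abs_of_pos hE0, div_le_iff₀ hE0]; exact hX.Z_le t ht
      have h3 : |w t / (X t).1| ≤ 1 := by
        rw [abs_div, abs_of_pos hE0, div_le_iff₀ hE0, one_mul]; exact hX.w_le t ht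
      have h4 := hX.abs_w_le_one ht
      have h5 := hX.abs_r_le hC ht
      have h6 := hQ' _ (hX.mem t ht)
      have h7 : |(2 * energyQ γ (X t) - 1) + (3 * w t - 3 * (w t / (X t).1))| ≤ 2 * Q + 7 := by
        rw [abs_le] at *
        constructor <;> linarith
      calc |3 * r t - 3 * r t / (X t).1 + 3 * Z t / (X t).1
            * (h t * ((2 * energyQ γ (X t) - 1) + (3 * w t - 3 * w t / (X t).1)))|
          = |(3 * r t - 3 * (r t / (X t).1)) + 3 * (h t * ((Z t / (X t).1)
            * ((2 * energyQ γ (X t) - 1) + (3 * w t - 3 * (w t / (X t).1)))))| := by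
            congr 1; ring
        _ ≤ (3 * |r t| + 3 * |r t / (X t).1|) + 3 * (h t * (|Z t / (X t).1|
            * |(2 * energyQ γ (X t) - 1) + (3 * w t - 3 * (w t / (X t).1))|)) := by
            refine (abs_add_le _ _).trans (add_le_add ((abs_sub _ _).trans (le_of_eq ?_))
              (le_of_eq ?_))
            · rw [abs_mul, abs_mul, abs_of_pos (by norm_num : (0 : ℝ) < 3)]
            · rw [abs_mul, abs_mul, abs_mul, abs_of_nonneg hh,
                abs_of_pos (by norm_num : (0 : ℝ) < 3)]
        _ ≤ (3 * (C * h t * H t) + 3 * (C * h t * H t))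
            + 3 * (h t * ((C * H t) * (2 * Q + 7))) := by gcongr
        _ = 3 * C * (2 * Q + 9) * h t * H t := by ring
    · have hE0 := hE t ht
      have hHt := (hX.H_pos t ht).le
      have h2 : |Z t / (X t).1| ≤ C * H t := by
        rw [abs_div, abs_of_pos hE0, div_le_iff₀ hE0]; exact hX.Z_le t ht
      have h5 := hX.abs_Z_le hC ht
      have h8 : 0 ≤ C * H t * Q := by positivity
      have h9 : 0 ≤ C * H t := by positivity
      rw [mul_div_assoc]
      rw [abs_le] at *
      constructor <;> nlinarith

/-- Scalar field, curvature and matter stay present. -/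
theorem fst_pos (hX : IsFlow γ C t₀ h H w Z r X) {b : ℝ} (hb : ∀ t ∈ Ici t₀, h t ≤ b)
    (h0 : 0 < (X t₀).1) : ∀ t ∈ Ici t₀, 0 < (X t).1 := by
  obtain ⟨Q, hQ, hQ'⟩ := exists_abs_le_region (contDiff_energyQ γ (n := 0)).continuous
  refine pos_of_hasDerivWithinAt_ge (C := b * (2 * Q + 4)) (fun t ht => hX.deriv_fst ht)
    (fun t ht => ?_) h0
  have h1 := (hX.mem t ht).1
  have h2 := fst_le_one_of_mem_region (hX.mem t ht)
  have h3 := (abs_le.1 (hQ' _ (hX.mem t ht))).1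
  have h4 := (abs_le.1 (hX.w_le t ht)).2
  have h5 := hX.h_pos ht
  -- The pressure term has no explicit factor `E`; the bound `|w| ≤ E` provides it.
  have h6 : -(2 * Q + 4) * (X t).1
      ≤ (X t).1 * (2 * energyQ γ (X t) - 1) + w t * (-3 * (1 - (X t).1)) := by
    have h7 : w t * (1 - (X t).1) ≤ (X t).1 * (1 - (X t).1) :=
      mul_le_mul_of_nonneg_right h4 (by linarith)
    nlinarith
  have h8 := mul_le_mul_of_nonneg_left h6 h5.le
  have h9 : h t * ((2 * Q + 4) * (X t).1) ≤ b * ((2 * Q + 4) * (X t).1) :=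
    mul_le_mul_of_nonneg_right (hb t ht) (by positivity)
  linarith

theorem snd_snd_pos (hX : IsFlow γ C t₀ h H w Z r X) {b : ℝ} (hb : ∀ t ∈ Ici t₀, h t ≤ b)
    (h0 : 0 < (X t₀).2.2) : ∀ t ∈ Ici t₀, 0 < (X t).2.2 := by
  obtain ⟨Q, hQ, hQ'⟩ := exists_abs_le_region (f := fun X => 2 * (energyQ γ X - X.2.1))
    (by have := (contDiff_energyQ γ (n := 0)).continuous; fun_prop)
  refine pos_of_hasDerivWithinAt_ge (C := b * (Q + 3)) (fun t ht => hX.deriv_snd_snd ht)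
    (fun t ht => ?_) h0
  have h1 := (hX.mem t ht).2.1
  have h3 := (abs_le.1 (hQ' _ (hX.mem t ht))).1
  have h4 := (abs_le.1 (hX.abs_w_le_one ht)).1
  have h5 := hX.h_pos ht
  have h6 : -(Q + 3) * (X t).2.2 ≤ (2 * (energyQ γ (X t) - (X t).2.1) + 3 * w t) * (X t).2.2 :=
    mul_le_mul_of_nonneg_right (by linarith) h1
  have h8 := mul_le_mul_of_nonneg_left h6 h5.le
  have h9 : h t * ((Q + 3) * (X t).2.2) ≤ b * ((Q + 3) * (X t).2.2) :=
    mul_le_mul_of_nonneg_right (hb t ht) (by positivity)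
  linarith

theorem matter_pos (hX : IsFlow γ C t₀ h H w Z r X) {b : ℝ} (hb : ∀ t ∈ Ici t₀, h t ≤ b)
    (h0 : 0 < 1 - (X t₀).1 - (X t₀).2.1 ^ 2 - (X t₀).2.2) :
    ∀ t ∈ Ici t₀, 0 < 1 - (X t).1 - (X t).2.1 ^ 2 - (X t).2.2 := by
  obtain ⟨Q, hQ, hQ'⟩ := exists_abs_le_region (f := fun X => 2 + 2 * energyQ γ X - 3 * γ)
    (by have := (contDiff_energyQ γ (n := 0)).continuous; fun_prop)
  refine pos_of_hasDerivWithinAt_ge (C := b * (Q + 3)) (fun t ht => hX.deriv_matter ht)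
    (fun t ht => ?_) h0
  have h1 : 0 ≤ 1 - (X t).1 - (X t).2.1 ^ 2 - (X t).2.2 := by linarith [(hX.mem t ht).2.2]
  have h3 := (abs_le.1 (hQ' _ (hX.mem t ht))).1
  have h4 := (abs_le.1 (hX.abs_w_le_one ht)).1
  have h5 := hX.h_pos ht
  have h6 : -(Q + 3) * (1 - (X t).1 - (X t).2.1 ^ 2 - (X t).2.2)
      ≤ (2 + 2 * energyQ γ (X t) - 3 * γ + 3 * w t) * (1 - (X t).1 - (X t).2.1 ^ 2 - (X t).2.2) :=
    mul_le_mul_of_nonneg_right (by linarith) h1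
  have h8 := mul_le_mul_of_nonneg_left h6 h5.le
  have h9 : h t * ((Q + 3) * (1 - (X t).1 - (X t).2.1 ^ 2 - (X t).2.2))
      ≤ b * ((Q + 3) * (1 - (X t).1 - (X t).2.1 ^ 2 - (X t).2.2)) :=
    mul_le_mul_of_nonneg_right (hb t ht) (by positivity)
  linarith

end IsFlow

/-! ## Lyapunov functions at the three equilibrium points -/

/-- Reduces the derivative of a Lyapunov function along the field to a derivative in one variable.
-/
theorem fderiv_apply_eq {L : ℝ × ℝ × ℝ → ℝ} (hL : ContDiff ℝ 2 L) {X v : ℝ × ℝ × ℝ} {e : ℝ}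
    (h : HasDerivAt (fun t : ℝ => L (X + t • v)) e 0) : fderiv ℝ L X v = e := by
  have h1 : HasFDerivAt L (fderiv ℝ L X) (X + (0 : ℝ) • v) := by
    rw [zero_smul, add_zero]
    exact ((hL.differentiable (by norm_num)) X).hasFDerivAt
  have h2 : HasDerivAt (fun t : ℝ => X + t • v) ((1 : ℝ) • v) 0 :=
    ((hasDerivAt_id (0 : ℝ)).smul_const v).const_add X
  have h3 := h1.comp_hasDerivAt (0 : ℝ) h2
  rw [one_smul] at h3
  exact h3.unique h

theorem mem_closedBall_triple {X p : ℝ × ℝ × ℝ} {ρ : ℝ} :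
    X ∈ Metric.closedBall p ρ ↔
      |X.1 - p.1| ≤ ρ ∧ |X.2.1 - p.2.1| ≤ ρ ∧ |X.2.2 - p.2.2| ≤ ρ := by
  rw [Metric.mem_closedBall, Prod.dist_eq, Prod.dist_eq, max_le_iff, max_le_iff]
  simp only [Real.dist_eq]

section Line

variable (X v : ℝ × ℝ × ℝ)

theorem hasDerivAt_line_fst : HasDerivAt (fun t : ℝ => (X + t • v).1) v.1 0 := by
  simpa using ((hasDerivAt_id (0 : ℝ)).mul_const v.1).const_add X.1

theorem hasDerivAt_line_snd_fst : HasDerivAt (fun t : ℝ => (X + t • v).2.1) v.2.1 0 := by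
  simpa using ((hasDerivAt_id (0 : ℝ)).mul_const v.2.1).const_add X.2.1

theorem hasDerivAt_line_snd_snd : HasDerivAt (fun t : ℝ => (X + t • v).2.2) v.2.2 0 := by
  simpa using ((hasDerivAt_id (0 : ℝ)).mul_const v.2.2).const_add X.2.2

end Line

/-- At `γ = 2 / 3` the linear part does not damp `k`; the decay is `k' ≈ -2 k S` with `S ≈ k / 2`.
The term `-k S` in the function turns this into the negative definite form `-4 S² + 2 k S - k²`. -/
theorem isStrictLyapunov_F0 {γ : ℝ} (h0 : 0 < γ) (h1 : γ ≤ 2 / 3) :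
    IsStrictLyapunov γ (0, 0, 0) (fun X => X.1 + X.2.1 ^ 2 + X.2.2 - X.2.2 * X.2.1) (1 / 10) := by
  have hcd : ContDiff ℝ 2 fun X : ℝ × ℝ × ℝ => X.1 + X.2.1 ^ 2 + X.2.2 - X.2.2 * X.2.1 := by
    fun_prop
  refine ⟨hcd, by norm_num, by simp [region], rfl, ?_, by simp, ?_, ?_⟩
  · simp only [energyQ]; linarith
  · rintro ⟨E, S, k⟩ ⟨hE, hk, -⟩ hball hne
    rw [mem_closedBall_triple] at hball
    simp only [sub_zero] at hball hE hk ⊢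
    obtain ⟨-, hS, -⟩ := hball
    rw [abs_le] at hS
    rcases hk.eq_or_lt with rfl | hk'
    · rcases hE.eq_or_lt with rfl | hE'
      · have : S ≠ 0 := by rintro rfl; exact hne rfl
        have := pow_pos (abs_pos.2 this) 2
        rw [sq_abs] at this
        linarith
      · nlinarith [sq_nonneg S]
    · nlinarith [sq_nonneg S]
  · rintro ⟨E, S, k⟩ ⟨hE, hk, hreg⟩ hball hne
    have hd := (((hasDerivAt_line_fst (E, S, k) (energyField γ (E, S, k))).add
      ((hasDerivAt_line_snd_fst (E, S, k) (energyField γ (E, S, k))).pow 2)).add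
      (hasDerivAt_line_snd_snd (E, S, k) (energyField γ (E, S, k)))).sub
      ((hasDerivAt_line_snd_snd (E, S, k) (energyField γ (E, S, k))).mul
      (hasDerivAt_line_snd_fst (E, S, k) (energyField γ (E, S, k))))
    rw [fderiv_apply_eq hcd hd]
    rw [mem_closedBall_triple] at hball
    simp only [sub_zero] at hball hE hk hreg
    obtain ⟨hE', hS, hk'⟩ := hball
    rw [abs_le] at hE' hS hk'
    -- `-a` is the deceleration parameter at the point; `M` is the matter fraction, close to `1` in
    -- the ball.
    obtain ⟨a, rfl⟩ : ∃ a, γ = (2 - 2 * a) / 3 := ⟨(2 - 3 * γ) / 2, by ring⟩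
    have ha0 : 0 ≤ a := by linarith
    have ha1 : a ≤ 1 := by linarith
    set M := 1 - E - S ^ 2 - k with hM
    have hM1 : M ≤ 1 := by nlinarith [sq_nonneg S]
    have hM0 : 3 / 4 ≤ M := by nlinarith
    have key : (E * (2 * energyQ ((2 - 2 * a) / 3) (E, S, k) - 1)
        + 2 * S * (S * (energyQ ((2 - 2 * a) / 3) (E, S, k) - 2) + k)
        + 2 * k * (energyQ ((2 - 2 * a) / 3) (E, S, k) - S)
        - (2 * k * (energyQ ((2 - 2 * a) / 3) (E, S, k) - S) * S
          + k * (S * (energyQ ((2 - 2 * a) / 3) (E, S, k) - 2) + k)))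
        = -M * ((4 + 2 * a) * S ^ 2 + (1 + 2 * a) * E + 2 * a * k) - k ^ 2 + 2 * k * S
          - 3 * k * S * (2 * S ^ 2 + E / 2) + 3 * a * k * S * M + 2 * k * S ^ 2 := by
      simp only [energyQ, hM]; ring
    have hval : -M * ((4 + 2 * a) * S ^ 2 + (1 + 2 * a) * E + 2 * a * k) - k ^ 2 + 2 * k * S
          - 3 * k * S * (2 * S ^ 2 + E / 2) + 3 * a * k * S * M + 2 * k * S ^ 2
        ≤ -(1 / 2) * S ^ 2 - (1 / 2) * E - (1 / 4) * k ^ 2 := by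
      have hS2 := sq_nonneg S
      have e1 : 3 / 4 * ((4 + 2 * a) * S ^ 2 + (1 + 2 * a) * E)
          ≤ M * ((4 + 2 * a) * S ^ 2 + (1 + 2 * a) * E) :=
        mul_le_mul_of_nonneg_right hM0 (by positivity)
      have e2 : 0 ≤ a * S ^ 2 := by positivity
      have e3 : 0 ≤ a * E := by positivity
      have hkS : |k * S| ≤ 1 / 100 := by
        rw [abs_mul]
        calc |k| * |S| ≤ (1 / 10) * (1 / 10) := by
              gcongr <;> rw [abs_le] <;> constructor <;> linarith
          _ = 1 / 100 := by norm_num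
      rw [abs_le] at hkS
      have e4 : -(1 / 100) * (2 * S ^ 2 + E / 2) ≤ k * S * (2 * S ^ 2 + E / 2) :=
        mul_le_mul_of_nonneg_right (by linarith) (by positivity)
      have e5 : a * k * M * S ≤ a * k * M * (1 / 10) :=
        mul_le_mul_of_nonneg_left (by linarith) (by positivity)
      have e6 : 0 ≤ a * k * M := by positivity
      have e7 : k * S ^ 2 ≤ 1 / 10 * S ^ 2 := mul_le_mul_of_nonneg_right (by linarith) hS2
      nlinarith [sq_nonneg (3 * k - 4 * S), sq_nonneg (k - S)]
    have hpos : 0 < (1 / 2) * S ^ 2 + (1 / 2) * E + (1 / 4) * k ^ 2 := by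
      rcases hE.eq_or_lt with rfl | hE''
      · by_cases hS0 : S = 0
        · subst hS0
          have : k ≠ 0 := by rintro rfl; exact hne rfl
          positivity
        · positivity
      · positivity
    refine lt_of_eq_of_lt ?_ (lt_of_le_of_lt hval (by linarith))
    rw [← key]
    simp only [energyField, zero_smul, add_zero]
    norm_num

/-- To leading order the left side is `-N² + 4 N y - 12 y²`, which is negative definite, minus the
nonnegative `2 η M`. The bounds `1 / 50` absorb the cubic terms. -/
theorem bound_D {N y M η R : ℝ} (hη0 : 0 ≤ η) (hη1 : η ≤ 3 / 2) (hM0 : 0 ≤ M) (hMN : M ≤ N)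
    (hN1 : N ≤ 1 / 50) (hy1 : |y| ≤ 1 / 50)
    (hR : R = 2 * y - N / 2 + η * M + 2 * (y - N / 2) ^ 2) :
    2 * N * R - 2 * η * M + 8 * y * (-(3 / 2) * y - η * M / 2 + R * (y + N / 2))
      ≤ -(1 / 4) * N ^ 2 - y ^ 2 := by
  have hN0 : 0 ≤ N := hM0.trans hMN
  have hηM : η * M ≤ 3 / 2 * N := mul_le_mul hη1 hMN hM0 (by norm_num)
  have hηM0 : 0 ≤ η * M := mul_nonneg hη0 hM0
  have hyl := abs_le.1 hy1
  have hu : (y - N / 2) ^ 2 ≤ 2 * y ^ 2 + N ^ 2 / 2 := by nlinarith [sq_nonneg (y + N / 2)]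
  have hu1 : (y - N / 2) ^ 2 ≤ (1 / 10) ^ 2 := sq_le_sq' (by linarith) (by linarith)
  have hu0 := sq_nonneg (y - N / 2)
  have hRb : |R| ≤ 1 / 10 := by
    rw [hR, abs_le]; constructor <;> linarith
  have e1 : N * (y - N / 2) ^ 2 ≤ 1 / 50 * (2 * y ^ 2 + N ^ 2 / 2) :=
    mul_le_mul hN1 hu (sq_nonneg _) (by norm_num)
  have e2 : 0 ≤ η * M * (1 - N + 2 * y) := mul_nonneg hηM0 (by linarith)
  have hyN : |y * (y + N / 2)| ≤ 5 / 4 * y ^ 2 + N ^ 2 / 4 := by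
    rw [abs_le]
    constructor
    · linarith [sq_nonneg (y + N / 2), sq_nonneg y, sq_nonneg N,
        show (y + N / 2) ^ 2 = y ^ 2 + y * N + N ^ 2 / 4 by ring,
        show y * (y + N / 2) = y ^ 2 + y * N / 2 by ring]
    · linarith [sq_nonneg (y - N / 2), sq_nonneg y, sq_nonneg N, sq_nonneg (y / 2 - N / 2),
        show (y / 2 - N / 2) ^ 2 = y ^ 2 / 4 - y * N / 2 + N ^ 2 / 4 by ring,
        show y * (y + N / 2) = y ^ 2 + y * N / 2 by ring]
  have e3 : y * (y + N / 2) * R ≤ (5 / 4 * y ^ 2 + N ^ 2 / 4) * (1 / 10) := by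
    refine (le_abs_self _).trans ?_
    rw [abs_mul]
    exact mul_le_mul hyN hRb (abs_nonneg _) (by positivity)
  have expand : 2 * N * R - 2 * η * M
      + 8 * y * (-(3 / 2) * y - η * M / 2 + R * (y + N / 2))
      = 4 * N * y - N ^ 2 - 12 * y ^ 2 - 2 * (η * M * (1 - N + 2 * y))
        + 4 * (N * (y - N / 2) ^ 2) + 8 * (y * (y + N / 2) * R) := by
    rw [hR]; ring
  rw [expand]
  linarith [sq_nonneg (N - 4 * y), sq_nonneg N, sq_nonneg y,
    show (N - 4 * y) ^ 2 = N ^ 2 - 8 * (N * y) + 16 * y ^ 2 by ring,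
    show 4 * N * y = 4 * (N * y) by ring]

/-- Here `q = 1 / 2`, so the scalar field is neutral at linear order, as is matter when `γ = 1`. The
centre direction is measured by `N = 1 - Σ² - Ω_k`, for which `N' = 2 N R - 2 η M` with `R = q - 1 /
2`, and `y = Σ - 1 / 2 + N / 2` is the coordinate damped at rate `3 / 2`. The function is `N + 4
y²`. -/
theorem isStrictLyapunov_D {γ : ℝ} (h1 : 1 ≤ γ) (h2 : γ ≤ 2) :
    IsStrictLyapunov γ (0, 1 / 2, 3 / 4) (fun X => (1 - X.2.1 ^ 2 - X.2.2)
      + 4 * (X.2.1 - 1 / 2 + (1 - X.2.1 ^ 2 - X.2.2) / 2) ^ 2) (1 / 200) := by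
  have hcd : ContDiff ℝ 2 fun X : ℝ × ℝ × ℝ => (1 - X.2.1 ^ 2 - X.2.2)
      + 4 * (X.2.1 - 1 / 2 + (1 - X.2.1 ^ 2 - X.2.2) / 2) ^ 2 := by
    fun_prop
  -- The function does not contain `E`; but `N = E + Ω_m` with both terms nonnegative, so `N = 0`
  -- forces `E = 0`.
  have hzero : ∀ X ∈ region, X ≠ (0, 1 / 2, 3 / 4) → 0 < 1 - X.2.1 ^ 2 - X.2.2 ∨
      X.2.1 - 1 / 2 + (1 - X.2.1 ^ 2 - X.2.2) / 2 ≠ 0 := by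
    rintro ⟨E, S, k⟩ ⟨hE, hk, hreg⟩ hne
    simp only at hE hk hreg ⊢
    by_contra hcon
    push Not at hcon
    obtain ⟨hN, hy⟩ := hcon
    have hN0 : 1 - S ^ 2 - k = 0 := by linarith
    rw [hN0] at hy
    have hS : S = 1 / 2 := by linarith
    subst hS
    apply hne
    have hE0 : E = 0 := by linarith
    have hk0 : k = 3 / 4 := by linarith
    rw [hE0, hk0]
  refine ⟨hcd, by norm_num, by norm_num [region], rfl, by norm_num [energyQ], by norm_num, ?_, ?_⟩
  · intro X hX _ hne
    have hN : 0 ≤ 1 - X.2.1 ^ 2 - X.2.2 := by linarith [hX.1, hX.2.2]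
    rcases hzero X hX hne with h | h
    · positivity
    · positivity
  · intro X hX hball hne
    have h0 := hzero X hX hne
    obtain ⟨E, S, k⟩ := X
    obtain ⟨hE, hk, hreg⟩ := hX
    have hN' := ((hasDerivAt_const (0 : ℝ) (1 : ℝ)).sub
      ((hasDerivAt_line_snd_fst (E, S, k) (energyField γ (E, S, k))).pow 2)).sub
      (hasDerivAt_line_snd_snd (E, S, k) (energyField γ (E, S, k)))
    have hd := hN'.add (((((hasDerivAt_line_snd_fst (E, S, k)
      (energyField γ (E, S, k))).sub_const (1 / 2)).add (hN'.div_const 2)).pow 2).const_mul 4)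
    rw [fderiv_apply_eq hcd hd]
    rw [mem_closedBall_triple] at hball
    simp only at hball hE hk hreg h0
    obtain ⟨-, hS, hk'⟩ := hball
    obtain ⟨N, hN⟩ : ∃ N, N = 1 - S ^ 2 - k := ⟨_, rfl⟩
    obtain ⟨y, hy⟩ : ∃ y, y = S - 1 / 2 + (1 - S ^ 2 - k) / 2 := ⟨_, rfl⟩
    obtain ⟨M, hM⟩ : ∃ M, M = 1 - E - S ^ 2 - k := ⟨_, rfl⟩
    obtain ⟨η, hη⟩ : ∃ η, η = (3 * γ - 3) / 2 := ⟨_, rfl⟩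
    obtain ⟨R, hR⟩ : ∃ R, R = 2 * y - N / 2 + η * M + 2 * (y - N / 2) ^ 2 := ⟨_, rfl⟩
    have hη0 : 0 ≤ η := by rw [hη]; linarith
    have hη1 : η ≤ 3 / 2 := by rw [hη]; linarith
    have hM0 : 0 ≤ M := by rw [hM]; linarith
    have hMN : M ≤ N := by rw [hM, hN]; linarith
    rw [abs_le] at hS hk'
    have hN1 : N ≤ 1 / 50 := by rw [hN]; nlinarith
    have hy1 : |y| ≤ 1 / 50 := by rw [hy, abs_le]; constructor <;> nlinarith
    have hq : energyQ γ (E, S, k) = 1 / 2 + R := by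
      simp only [energyQ, hR, hy, hN, hM, hη]; ring
    have key : 0 - 2 * S * (S * (energyQ γ (E, S, k) - 2) + k)
          - 2 * k * (energyQ γ (E, S, k) - S)
        + 4 * (2 * (S - 1 / 2 + (1 - S ^ 2 - k) / 2)
          * ((S * (energyQ γ (E, S, k) - 2) + k)
            + (0 - 2 * S * (S * (energyQ γ (E, S, k) - 2) + k)
              - 2 * k * (energyQ γ (E, S, k) - S)) / 2))
        = 2 * N * R - 2 * η * M
          + 8 * y * (-(3 / 2) * y - η * M / 2 + R * (y + N / 2)) := by
      rw [hq]
      have e1 : S = 1 / 2 + y - N / 2 := by rw [hy, hN]; ring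
      have e2 : k = 1 - S ^ 2 - N := by rw [hN]; ring
      have e3 : S - 1 / 2 + (1 - S ^ 2 - k) / 2 = y := hy.symm
      rw [e3, e2]
      rw [hR, e1]
      ring
    have hval := bound_D hη0 hη1 hM0 hMN hN1 hy1 hR
    have hpos : 0 < (1 / 4) * N ^ 2 + y ^ 2 := by
      rcases h0 with h | h
      · rw [← hN] at h; positivity
      · rw [← hy] at h; positivity
    refine lt_of_eq_of_lt ?_ (lt_of_le_of_lt hval (by linarith))
    rw [← key]
    simp only [energyField, zero_smul, add_zero]
    norm_num

/-- For a 2 × 2 matrix J with determinant D, the form D |v|² + |adj(J) v|² has derivative 2 D v·(J +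
adj J) v along v' = J v, because adj(J) J = D; and J + adj J is the trace times the identity. This
produces the term `-2 (2 - s) D (u² + z²)`; the rest collects the nonlinear terms and those in `E`.
-/
theorem deriv_quadratic_MC {s κ a b c d D u z R E : ℝ} (hdet : a * d - b * c = D)
    (htr : a + d = -(2 - s)) :
    D * (2 * u * (a * u + b * z + s * (2 - s) * u ^ 2 + u * R + s * (1 / 2 - s) * E)
        + 2 * z * (c * u + d * z + 2 * κ * ((2 - s) * u ^ 2 + (1 / 2 - s) * E) + 2 * z * (R - u)))
      + 2 * (d * u - b * z) * (d * (a * u + b * z + s * (2 - s) * u ^ 2 + u * R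
          + s * (1 / 2 - s) * E)
        - b * (c * u + d * z + 2 * κ * ((2 - s) * u ^ 2 + (1 / 2 - s) * E) + 2 * z * (R - u)))
      + 2 * (a * z - c * u) * (a * (c * u + d * z + 2 * κ * ((2 - s) * u ^ 2 + (1 / 2 - s) * E)
          + 2 * z * (R - u))
        - c * (a * u + b * z + s * (2 - s) * u ^ 2 + u * R + s * (1 / 2 - s) * E))
      + E * (2 * s - 1 + 2 * R)
    = -2 * (2 - s) * D * (u ^ 2 + z ^ 2)
      + (u ^ 2 * (s * (2 - s) * (2 * (D + d ^ 2 + c ^ 2) * u + -2 * (b * d + a * c) * z)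
          + 2 * κ * (2 - s) * (-2 * (b * d + a * c) * u + 2 * (D + b ^ 2 + a ^ 2) * z)
          + R * (2 * (D + d ^ 2 + c ^ 2)))
        + u * z * (R * (-2 * (b * d + a * c)) + 2 * (R - u) * (-2 * (b * d + a * c)))
        + z ^ 2 * (2 * (R - u) * (2 * (D + b ^ 2 + a ^ 2))))
      + E * ((1 / 2 - s) * (s * (2 * (D + d ^ 2 + c ^ 2) * u + -2 * (b * d + a * c) * z)
          + 2 * κ * (-2 * (b * d + a * c) * u + 2 * (D + b ^ 2 + a ^ 2) * z)) + 2 * R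
          - (1 - 2 * s)) := by
  have e1 : -2 * (2 - s) * D * (u ^ 2 + z ^ 2)
      = 2 * (a + d) * (a * d - b * c) * (u ^ 2 + z ^ 2) := by rw [hdet, htr]; ring
  rw [e1, ← hdet]
  ring

/-- Since `|u z| ≤ (u² + z²) / 2`, the three small terms use at most `3 / 2` of the available `2 m
(u² + z²)`. -/
theorem quadratic_add_neg {m u z α₁ α₂ α₃ β E : ℝ} (hm : 0 < m) (hE : 0 ≤ E) (h1 : |α₁| < m)
    (h2 : |α₂| < m) (h3 : |α₃| < m) (hβ : β < 0) (h : 0 < u ^ 2 + z ^ 2 ∨ 0 < E) :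
    -2 * (m * (u ^ 2 + z ^ 2)) + (u ^ 2 * α₁ + u * z * α₂ + z ^ 2 * α₃) + E * β < 0 := by
  have g1 : u ^ 2 * α₁ ≤ u ^ 2 * m :=
    mul_le_mul_of_nonneg_left ((le_abs_self _).trans h1.le) (sq_nonneg _)
  have g3 : z ^ 2 * α₃ ≤ z ^ 2 * m :=
    mul_le_mul_of_nonneg_left ((le_abs_self _).trans h3.le) (sq_nonneg _)
  have g2 : u * z * α₂ ≤ (u ^ 2 + z ^ 2) / 2 * m := by
    refine (le_abs_self _).trans ?_
    rw [abs_mul]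
    refine mul_le_mul ?_ h2.le (abs_nonneg _) (by positivity)
    rw [abs_le]; constructor <;> nlinarith [sq_nonneg (u + z), sq_nonneg (u - z)]
  have g4 : E * β ≤ 0 := mul_nonpos_of_nonneg_of_nonpos hE hβ.le
  have g5 : 0 ≤ m * (u ^ 2 + z ^ 2) := by positivity
  rcases h with h | h
  · have : 0 < m * (u ^ 2 + z ^ 2) := mul_pos hm h
    linarith
  · have : E * β < 0 := mul_neg_of_pos_of_neg h hβ
    linarith

/-- `s` is the common value of `q` and `Σ` at the point. For `0 < s < 1 / 2` the linear part in `(Σ,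
Ω_k)` has negative trace `-(2 - s)` and positive determinant `D`, and `E` decays at rate `1 - 2 s`.
So the adjugate quadratic form plus `E` works on a small ball. -/
theorem exists_isStrictLyapunov_MC {s : ℝ} (h0 : 0 < s) (h1 : s < 1 / 2) :
    ∃ L ρ, IsStrictLyapunov (2 / 3 * (1 + s)) (0, s, s * (2 - s)) L ρ := by
  obtain ⟨κ, hκ⟩ : ∃ κ, κ = s * (2 - s) := ⟨_, rfl⟩
  obtain ⟨a, ha⟩ : ∃ a, a = -(2 - s) * (1 - 2 * s ^ 2) := ⟨_, rfl⟩
  obtain ⟨b, hb⟩ : ∃ b, b = 1 - s ^ 2 := ⟨_, rfl⟩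
  obtain ⟨c, hc⟩ : ∃ c, c = 2 * κ * (4 * s - 2 * s ^ 2 - 1) := ⟨_, rfl⟩
  obtain ⟨d, hd⟩ : ∃ d, d = -2 * κ * s := ⟨_, rfl⟩
  obtain ⟨D, hD⟩ : ∃ D, D = 2 * κ * (1 - 2 * s) := ⟨_, rfl⟩
  have hκ0 : 0 < κ := by rw [hκ]; exact mul_pos h0 (by linarith)
  have hD0 : 0 < D := by rw [hD]; exact mul_pos (by positivity) (by linarith)
  have hdet : a * d - b * c = D := by rw [ha, hb, hc, hd, hD]; ring
  have htr : a + d = -(2 - s) := by rw [ha, hd, hκ]; ring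
  set L : ℝ × ℝ × ℝ → ℝ := fun X => D * ((X.2.1 - s) ^ 2 + (X.2.2 - κ) ^ 2)
    + (d * (X.2.1 - s) - b * (X.2.2 - κ)) ^ 2 + (a * (X.2.2 - κ) - c * (X.2.1 - s)) ^ 2 + X.1
    with hL
  have hcd : ContDiff ℝ 2 L := by rw [hL]; fun_prop
  -- `c₁`, `c₂`, `c₃` are the entries of the Hessian of the quadratic part of `L`; below, `α₁`,
  -- `α₂`, `α₃` vanish at the point and `β` equals `-(1 - 2 s)` there.
  set c₁ := 2 * (D + d ^ 2 + c ^ 2) with hc₁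
  set c₂ := -2 * (b * d + a * c) with hc₂
  set c₃ := 2 * (D + b ^ 2 + a ^ 2) with hc₃
  set R : ℝ × ℝ × ℝ → ℝ := fun X => (2 - s) * (2 * s * (X.2.1 - s) + (X.2.1 - s) ^ 2)
    - s * (X.2.2 - κ) + (1 / 2 - s) * X.1 with hR
  set α₁ : ℝ × ℝ × ℝ → ℝ := fun X => s * (2 - s) * (c₁ * (X.2.1 - s) + c₂ * (X.2.2 - κ))
    + 2 * κ * (2 - s) * (c₂ * (X.2.1 - s) + c₃ * (X.2.2 - κ)) + R X * c₁ with hα₁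
  set α₂ : ℝ × ℝ × ℝ → ℝ := fun X => R X * c₂ + 2 * (R X - (X.2.1 - s)) * c₂ with hα₂
  set α₃ : ℝ × ℝ × ℝ → ℝ := fun X => 2 * (R X - (X.2.1 - s)) * c₃ with hα₃
  set β : ℝ × ℝ × ℝ → ℝ := fun X => (1 / 2 - s) * (s * (c₁ * (X.2.1 - s) + c₂ * (X.2.2 - κ))
    + 2 * κ * (c₂ * (X.2.1 - s) + c₃ * (X.2.2 - κ))) + 2 * R X - (1 - 2 * s) with hβ
  have hm : 0 < (2 - s) * D := mul_pos (by linarith) hD0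
  have hopen : {X | |α₁ X| < (2 - s) * D ∧ |α₂ X| < (2 - s) * D ∧ |α₃ X| < (2 - s) * D ∧ β X < 0}
      ∈ 𝓝 ((0, s, κ) : ℝ × ℝ × ℝ) := by
    have hRc : Continuous R := by rw [hR]; fun_prop
    have hR0 : R (0, s, κ) = 0 := by simp [hR]
    have e1 : ∀ᶠ X in 𝓝 ((0, s, κ) : ℝ × ℝ × ℝ), |α₁ X| < (2 - s) * D := by
      refine Continuous.continuousAt (by rw [hα₁]; fun_prop) |>.eventually_lt
        continuousAt_const (by simpa [hα₁, hR0] using hm)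
    have e2 : ∀ᶠ X in 𝓝 ((0, s, κ) : ℝ × ℝ × ℝ), |α₂ X| < (2 - s) * D := by
      refine Continuous.continuousAt (by rw [hα₂]; fun_prop) |>.eventually_lt
        continuousAt_const (by simpa [hα₂, hR0] using hm)
    have e3 : ∀ᶠ X in 𝓝 ((0, s, κ) : ℝ × ℝ × ℝ), |α₃ X| < (2 - s) * D := by
      refine Continuous.continuousAt (by rw [hα₃]; fun_prop) |>.eventually_lt
        continuousAt_const (by simpa [hα₃, hR0] using hm)
    have e4 : ∀ᶠ X in 𝓝 ((0, s, κ) : ℝ × ℝ × ℝ), β X < 0 := by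
      refine Continuous.continuousAt (by rw [hβ]; fun_prop) |>.eventually_lt
        continuousAt_const ?_
      simp only [hβ, hR0]
      linarith
    filter_upwards [e1, e2, e3, e4] with X g1 g2 g3 g4 using ⟨g1, g2, g3, g4⟩
  obtain ⟨ρ, hρ, hsub⟩ := Metric.nhds_basis_closedBall.mem_iff.1 hopen
  have hne_pos : ∀ X : ℝ × ℝ × ℝ, 0 ≤ X.1 → X ≠ (0, s, κ) →
      0 < (X.2.1 - s) ^ 2 + (X.2.2 - κ) ^ 2 ∨ 0 < X.1 := by
    rintro ⟨E, S, k⟩ hE hne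
    simp only at hE ⊢
    by_contra hcon
    push Not at hcon
    have hS : S - s = 0 := by nlinarith [sq_nonneg (S - s), sq_nonneg (k - κ)]
    have hk : k - κ = 0 := by nlinarith [sq_nonneg (S - s), sq_nonneg (k - κ)]
    apply hne
    rw [sub_eq_zero.1 hS, sub_eq_zero.1 hk, le_antisymm hcon.2 hE]
  rw [← hκ]
  refine ⟨L, ρ, hcd, hρ, ⟨le_rfl, hκ0.le, ?_⟩, rfl, ?_, by simp [hL], ?_, ?_⟩
  · simp only [hκ]; nlinarith
  · simp only [energyQ, hκ]; nlinarith
  · intro X hX _ hne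
    have hE := hX.1
    rcases hne_pos X hE hne with h | h <;> simp only [hL] <;> positivity
  · intro X hX hball hne
    obtain ⟨hb1, hb2, hb3, hb4⟩ := hsub hball
    have h00 := hne_pos X hX.1 hne
    have hE := hX.1
    obtain ⟨E, S, k⟩ := X
    set v := energyField (2 / 3 * (1 + s)) (E, S, k) with hv
    have hu' := (hasDerivAt_line_snd_fst (E, S, k) v).sub_const s
    have hv' := (hasDerivAt_line_snd_snd (E, S, k) v).sub_const κ
    have hder := ((((hu'.pow 2).add (hv'.pow 2)).const_mul D).add
      (((hu'.const_mul d).sub (hv'.const_mul b)).pow 2)).add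
      (((hv'.const_mul a).sub (hu'.const_mul c)).pow 2) |>.add (hasDerivAt_line_fst (E, S, k) v)
    rw [fderiv_apply_eq hcd hder]
    have hq : energyQ (2 / 3 * (1 + s)) (E, S, k) = s + R (E, S, k) := by
      simp only [energyQ, hR, hκ]; ring
    have hv1 : v.1 = E * (2 * s - 1 + 2 * R (E, S, k)) := by
      simp only [hv, energyField, hq]; ring
    have hv2 : v.2.1 = a * (S - s) + b * (k - κ) + s * (2 - s) * (S - s) ^ 2
        + (S - s) * R (E, S, k) + s * (1 / 2 - s) * E := by
      simp only [hv, energyField, hq, hR, ha, hb, hκ]; ring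
    have hv3 : v.2.2 = c * (S - s) + d * (k - κ) + 2 * κ * ((2 - s) * (S - s) ^ 2
        + (1 / 2 - s) * E) + 2 * (k - κ) * (R (E, S, k) - (S - s)) := by
      simp only [hv, energyField, hq, hR, hc, hd]; ring
    set u := S - s with hu
    set z := k - κ with hz
    have key := deriv_quadratic_MC (κ := κ) (u := u) (z := z) (R := R (E, S, k)) (E := E) hdet htr
    rw [← hv1, ← hv2, ← hv3] at key
    have hfin : -2 * (2 - s) * D * (u ^ 2 + z ^ 2) + (u ^ 2 * α₁ (E, S, k)
        + u * z * α₂ (E, S, k) + z ^ 2 * α₃ (E, S, k)) + E * β (E, S, k) < 0 := by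
      have := quadratic_add_neg hm hE hb1 hb2 hb3 hb4 h00
      linarith
    refine lt_of_eq_of_lt ?_ hfin
    refine Eq.trans ?_ key
    simp only [Pi.sub_apply, zero_smul, add_zero, Nat.cast_ofNat, Nat.add_one_sub_one, pow_one, ← hu, ← hz]

/-! ## The possible limit points -/

/-- `p` is the late-time attractor for the barotropic index `γ`. -/
def IsSelected (γ : ℝ) (p : ℝ × ℝ × ℝ) : Prop :=
  (γ ≤ 2 / 3 ∧ p = pointF0) ∨ (2 / 3 < γ ∧ γ < 1 ∧ p = pointMC γ) ∨ (1 ≤ γ ∧ p = pointD)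

/-- If `Ω_k = 0`, then `2 q ≤ 1` forces `Σ = 0`, next `q ≤ Σ` forces `E = 0`, and the point is `F₀`.
If `Ω_k ≠ 0`, then `q = Σ` and `Ω_k = q (2 - q)`. The value `q = 1 / 2` exhausts the energy budget
and gives `D`; for `q < 1 / 2` the scalar field vanishes, `Ω_m = 1 - 2 q > 0`, and the matter
equation gives `3 γ = 2 + 2 q`, that is `MC`. -/
theorem isSelected_of_limit_conditions {γ : ℝ} {p : ℝ × ℝ × ℝ} (hp : p ∈ region)
    (h0 : energyField γ p = 0) (hk : energyQ γ p ≤ p.2.1) (hM : 2 + 2 * energyQ γ p ≤ 3 * γ)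
    (hE : 2 * energyQ γ p ≤ 1) :
    IsSelected γ p := by
  obtain ⟨E, S, k⟩ := p
  obtain ⟨hE0, hk0, hreg⟩ := hp
  simp only at hE0 hk0 hreg hk
  obtain ⟨q, hq⟩ : ∃ q, q = energyQ γ (E, S, k) := ⟨_, rfl⟩
  have hqv : q = 2 * S ^ 2 + (3 * γ - 2) / 2 * (1 - E - S ^ 2 - k) + E / 2 := hq
  simp only [energyField, Prod.mk_eq_zero, ← hq] at h0
  rw [← hq] at hk hM hE
  obtain ⟨f1, f2, f3⟩ := h0
  -- The equilibrium equation for the matter fraction, a consequence of the other three.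
  have f4 : (1 - E - S ^ 2 - k) * (2 + 2 * q - 3 * γ) = 0 := by
    have : (3 * γ - 2) * (1 - E - S ^ 2 - k) = 2 * q - 4 * S ^ 2 - E := by rw [hqv]; ring
    linear_combination -f1 - 2 * S * f2 - f3 - this
  rcases eq_or_ne k 0 with rfl | hkne
  · left
    have hS : S = 0 := by
      have : S * (q - 2) = 0 := by linarith
      rcases mul_eq_zero.1 this with h | h
      · exact h
      · linarith
    subst hS
    have hE' : E = 0 := by
      rcases mul_eq_zero.1 f1 with h | h
      · exact h
      · linarith
    subst hE'
    refine ⟨by nlinarith, rfl⟩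
  · right
    have hqS : q = S := by
      rcases mul_eq_zero.1 f3 with h | h
      · exact absurd (by linarith) hkne
      · linarith
    subst hqS
    have hkv : k = q * (2 - q) := by linarith
    rcases (by linarith : q ≤ 1 / 2).eq_or_lt with h | h
    · right
      subst h
      have hE' : E = 0 := by linarith
      refine ⟨by linarith, ?_⟩
      rw [hE', hkv, pointD]
      norm_num
    · left
      have hE' : E = 0 := by
        rcases mul_eq_zero.1 f1 with h | h
        · exact h
        · linarith
      subst hE'
      have hMne : 1 - 0 - q ^ 2 - k ≠ 0 := by rw [hkv]; intro hh; linarith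
      have hγ : 2 + 2 * q - 3 * γ = 0 := (mul_eq_zero.1 f4).resolve_left hMne
      have hq0 : 0 < q := by
        have hk1 : 0 < q * (2 - q) := hkv ▸ lt_of_le_of_ne hk0 hkne.symm
        exact pos_of_mul_pos_left hk1 (by linarith)
      refine ⟨by linarith, by linarith, ?_⟩
      have hqγ : q = 3 * γ / 2 - 1 := by linarith
      rw [hkv, hqγ, pointMC]
      congr 2
      ring

/-- At the candidate `p` for the late-time attractor there is a strict Lyapunov function. -/
theorem exists_isStrictLyapunov {γ : ℝ} (h0 : 0 < γ) (h2 : γ ≤ 2) {p : ℝ × ℝ × ℝ}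
    (hp : IsSelected γ p) : ∃ L ρ, IsStrictLyapunov γ p L ρ := by
  rcases hp with ⟨h, rfl⟩ | ⟨h, h', rfl⟩ | ⟨h, rfl⟩
  · exact ⟨_, _, isStrictLyapunov_F0 h0 h⟩
  · obtain ⟨L, ρ, hL⟩ := exists_isStrictLyapunov_MC (s := 3 * γ / 2 - 1) (by linarith) (by linarith)
    refine ⟨L, ρ, ?_⟩
    convert hL using 1
    · ring
    · rw [pointMC]; congr 2; ring
  · exact ⟨_, _, isStrictLyapunov_D h h2⟩

/-! ## The averaged system -/

section Components

variable {A B : Type*} [NormedAddCommGroup A] [NormedSpace ℝ A] [NormedAddCommGroup B]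
  [NormedSpace ℝ B] {f : ℝ → A × B} {f' : A × B} {s : Set ℝ} {t : ℝ}

theorem hasDerivWithinAt_fst (h : HasDerivWithinAt f f' s t) :
    HasDerivWithinAt (fun u => (f u).1) f'.1 s t := h.fst

theorem hasDerivWithinAt_snd (h : HasDerivWithinAt f f' s t) :
    HasDerivWithinAt (fun u => (f u).2) f'.2 s t := h.snd

end Components

/-- Passage from the amplitude `Ω` to the energy fraction `E = Ω²`. -/
def toEnergy (x : ℝ × ℝ × ℝ) : ℝ × ℝ × ℝ := (x.1 ^ 2, x.2)

theorem continuous_toEnergy : Continuous toEnergy := by unfold toEnergy; fun_prop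

theorem toEnergy_mem_region {x : ℝ × ℝ × ℝ} : toEnergy x ∈ region ↔ x ∈ phaseSpace := by
  simp only [toEnergy, region, phaseSpace, mem_ofPred_eq]
  constructor
  · rintro ⟨-, h2, h3⟩
    exact ⟨by linarith, h2⟩
  · rintro ⟨h1, h2⟩
    exact ⟨sq_nonneg _, h2, by linarith⟩

theorem toEnergy_eq_self {p : ℝ × ℝ × ℝ} (hp : p.1 = 0) : toEnergy p = p := by
  ext <;> simp [toEnergy, hp]

theorem IsSelected.fst_eq_zero {γ : ℝ} {p : ℝ × ℝ × ℝ} (h : IsSelected γ p) : p.1 = 0 := by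
  rcases h with ⟨-, rfl⟩ | ⟨-, -, rfl⟩ | ⟨-, rfl⟩ <;> rfl

theorem IsSelected.of_toEnergy {γ : ℝ} {p : ℝ × ℝ × ℝ} (h : IsSelected γ (toEnergy p)) :
    IsSelected γ p := by
  have h1 : p.1 = 0 := by
    have : p.1 ^ 2 = 0 := h.fst_eq_zero
    exact pow_eq_zero_iff (two_ne_zero) |>.1 this
  rwa [toEnergy_eq_self h1] at h

theorem isCompact_phaseSpace : IsCompact phaseSpace := by
  have hsub : phaseSpace ⊆ Icc (-1 : ℝ) 1 ×ˢ (Icc (-1 : ℝ) 1 ×ˢ Icc (0 : ℝ) 1) := by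
    rintro ⟨a, b, c⟩ ⟨h1, h2⟩
    simp only at h1 h2
    exact ⟨abs_le.1 (abs_le_one_iff_mul_self_le_one.2 (by nlinarith)),
      abs_le.1 (abs_le_one_iff_mul_self_le_one.2 (by nlinarith)), ⟨h2, by nlinarith⟩⟩
  have hcl : IsClosed phaseSpace := by
    have : phaseSpace = {p : ℝ × ℝ × ℝ | p.2.1 ^ 2 + p.1 ^ 2 + p.2.2 ≤ 1} ∩ {p | 0 ≤ p.2.2} := rfl
    rw [this]
    exact (isClosed_le (by fun_prop) (by fun_prop)).inter (isClosed_le (by fun_prop) (by fun_prop))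
  exact (isCompact_Icc.prod (isCompact_Icc.prod isCompact_Icc)).of_isClosed_subset hcl hsub

/-- Every neighbourhood of a point of the phase space contains states with scalar field, curvature
and matter. -/
theorem exists_interior_near {p : ℝ × ℝ × ℝ} (hp : p ∈ phaseSpace) {W : Set (ℝ × ℝ × ℝ)}
    (hW : W ∈ 𝓝 p) : ∃ x ∈ W, x.1 ≠ 0 ∧ (0 ≤ p.1 → 0 < x.1) ∧ 0 < x.2.2 ∧ 0 < omegaM x := by
  obtain ⟨σ, hσ, hσp, hσ1⟩ : ∃ σ : ℝ, σ ^ 2 = 1 ∧ 0 ≤ σ * p.1 ∧ (0 ≤ p.1 → σ = 1) := by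
    rcases le_or_gt 0 p.1 with h | h
    · exact ⟨1, by norm_num, by linarith, fun _ => rfl⟩
    · exact ⟨-1, by norm_num, by linarith, fun h' => absurd h' (not_le.2 h)⟩
  -- An interior point on the same side of `Ω = 0` as `p`; the matter fraction is concave, hence
  -- positive on the segment from `p` to it, apart from `p`.
  set m : ℝ × ℝ × ℝ := (σ / 2, 0, 1 / 4) with hm
  have hc : Continuous fun s : ℝ => p + s • (m - p) := by fun_prop
  have hev : ∀ᶠ s in 𝓝[>] (0 : ℝ), p + s • (m - p) ∈ W :=
    (hc.tendsto' 0 p (by simp)).mono_left nhdsWithin_le_nhds hW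
  obtain ⟨s, hs, hs0, hs1⟩ := (hev.and (Ioo_mem_nhdsGT one_pos)).exists
  have e1 : (p + s • (m - p)).1 = (1 - s) * p.1 + s * (σ / 2) := by simp [hm]; ring
  have e2 : (p + s • (m - p)).2.1 = (1 - s) * p.2.1 := by simp [hm]; ring
  have e3 : (p + s • (m - p)).2.2 = (1 - s) * p.2.2 + s * (1 / 4) := by simp [hm]; ring
  obtain ⟨h1, h2⟩ := hp
  have hsig : 0 < σ * (p + s • (m - p)).1 := by
    rw [e1]
    have : σ * ((1 - s) * p.1 + s * (σ / 2)) = (1 - s) * (σ * p.1) + s * (σ ^ 2 / 2) := by ring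
    rw [this, hσ]
    have := mul_nonneg (sub_nonneg.2 hs1.le) hσp
    linarith
  refine ⟨_, hs, ?_, ?_, ?_, ?_⟩
  · intro h; rw [h] at hsig; simp at hsig
  · intro h; rwa [hσ1 h, one_mul] at hsig
  · rw [e3]
    have := mul_nonneg (sub_nonneg.2 hs1.le) h2
    linarith
  · rw [omegaM, e1, e2, e3]
    have g1 : 0 ≤ (1 - s) * (1 - p.2.1 ^ 2 - p.1 ^ 2 - p.2.2) :=
      mul_nonneg (sub_nonneg.2 hs1.le) (by linarith)
    have g2 : 0 ≤ s * (1 - s) * (p.2.1 ^ 2 + (p.1 - σ / 2) ^ 2) :=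
      mul_nonneg (mul_nonneg hs0.le (sub_nonneg.2 hs1.le)) (by positivity)
    have g3 : 1 - ((1 - s) * p.2.1) ^ 2 - ((1 - s) * p.1 + s * (σ / 2)) ^ 2
        - ((1 - s) * p.2.2 + s * (1 / 4))
        = (1 - s) * (1 - p.2.1 ^ 2 - p.1 ^ 2 - p.2.2) + s * (1 - σ ^ 2 / 4 - 1 / 4)
          + s * (1 - s) * (p.2.1 ^ 2 + (p.1 - σ / 2) ^ 2) := by ring
    rw [g3, hσ]
    linarith

theorem averagedQ_eq (γ : ℝ) (x : ℝ × ℝ × ℝ) : averagedQ γ x = energyQ γ (toEnergy x) := by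
  simp only [averagedQ, energyQ, toEnergy]; ring

theorem one_add_averagedQ_nonneg {γ : ℝ} (hγ : 0 < γ) {x : ℝ × ℝ × ℝ} (hx : x ∈ phaseSpace) :
    0 ≤ 1 + averagedQ γ x := by
  obtain ⟨h1, h2⟩ := hx
  have h3 : 0 ≤ γ * (1 - x.2.1 ^ 2 - x.1 ^ 2 - x.2.2) := mul_nonneg hγ.le (by linarith)
  have h4 : 1 + averagedQ γ x = 3 / 2 * (γ * (1 - x.2.1 ^ 2 - x.1 ^ 2 - x.2.2)) + 3 * x.2.1 ^ 2
    + 3 / 2 * x.1 ^ 2 + x.2.2 := by simp only [averagedQ]; ring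
  rw [h4]
  positivity

theorem contDiff_averagedQ (γ : ℝ) {n : WithTop ℕ∞} : ContDiff ℝ n (averagedQ γ) := by
  unfold averagedQ; fun_prop

theorem contDiff_averagedField (γ : ℝ) {n : WithTop ℕ∞} : ContDiff ℝ n (averagedField γ) := by
  unfold averagedField; fun_prop

theorem averagedField_fst (γ : ℝ) (x : ℝ × ℝ × ℝ) :
    (averagedField γ x).1 = x.1 * (averagedQ γ x - 1 / 2) := by
  simp only [averagedField, averagedQ]; ring

theorem averagedField_snd_fst (γ : ℝ) (x : ℝ × ℝ × ℝ) :
    (averagedField γ x).2.1 = x.2.1 * (averagedQ γ x - 2) + x.2.2 := by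
  simp only [averagedField, averagedQ]; ring

theorem averagedField_snd_snd (γ : ℝ) (x : ℝ × ℝ × ℝ) :
    (averagedField γ x).2.2 = 2 * (averagedQ γ x - x.2.1) * x.2.2 := by
  simp only [averagedField, averagedQ]; ring

theorem hasDerivWithinAt_omegaM {γ : ℝ} {x : ℝ → ℝ × ℝ × ℝ} {s : Set ℝ} {t : ℝ}
    (h : HasDerivWithinAt x (averagedField γ (x t)) s t) :
    HasDerivWithinAt (fun u => omegaM (x u))
      ((2 + 2 * averagedQ γ (x t) - 3 * γ) * omegaM (x t)) s t := by
  have := (((hasDerivWithinAt_const t s (1 : ℝ)).sub ((hasDerivWithinAt_fst (hasDerivWithinAt_snd h)).pow 2)).sub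
    ((hasDerivWithinAt_fst h).pow 2)).sub (hasDerivWithinAt_snd (hasDerivWithinAt_snd h))
  refine this.congr_deriv ?_
  rw [averagedField_fst, averagedField_snd_fst, averagedField_snd_snd]
  simp only [omegaM, averagedQ, Nat.cast_ofNat, Nat.add_one_sub_one, pow_one]
  ring

theorem hasDerivWithinAt_toEnergy {γ : ℝ} {x : ℝ → ℝ × ℝ × ℝ} {s : Set ℝ} {t : ℝ}
    (h : HasDerivWithinAt x (averagedField γ (x t)) s t) :
    HasDerivWithinAt (fun u => toEnergy (x u)) (energyField γ (toEnergy (x t))) s t := by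
  have h1 := ((hasDerivWithinAt_fst h).pow 2).prodMk (hasDerivWithinAt_snd h)
  refine h1.congr_deriv ?_
  refine Prod.ext ?_ (Prod.ext ?_ ?_)
  · simp only [averagedField_fst, energyField, averagedQ_eq, toEnergy]
    norm_num; ring
  · simp only [averagedField_snd_fst, energyField, averagedQ_eq, toEnergy]
  · simp only [averagedField_snd_snd, energyField, averagedQ_eq, toEnergy]; ring

theorem IsAveragedSolution.H_le {γ : ℝ} (hγ : 0 < γ) {x : ℝ → ℝ × ℝ × ℝ} {Φ H t : ℝ → ℝ}
    (h : IsAveragedSolution γ x Φ H t) : ∀ τ ∈ Ici (0 : ℝ), H τ ≤ H 0 := by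
  intro τ hτ
  refine le_of_hasDerivWithinAt_nonpos le_rfl hτ (fun u hu => h.deriv_H u hu.1) fun u hu => ?_
  have := mul_nonneg (one_add_averagedQ_nonneg hγ (h.mem u hu.1)) (h.H_pos u hu.1).le
  linarith

/-- The equation for `x` does not contain `H`, and that for `H` is linear, so `H` may be rescaled by
any `a > 0`. This removes the smallness condition on `H` in the averaged case. -/
theorem IsAveragedSolution.isFlow {γ : ℝ} (hγ : 0 < γ) {x : ℝ → ℝ × ℝ × ℝ} {Φ H t : ℝ → ℝ}
    (h : IsAveragedSolution γ x Φ H t) {a : ℝ} (ha : 0 < a) (ha1 : a * H 0 ≤ 1) :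
    IsFlow γ 0 0 (fun _ => 1) (fun τ => a * H τ) (fun _ => 0) (fun _ => 0) (fun _ => 0)
      (fun τ => toEnergy (x τ)) where
  mem τ hτ := toEnergy_mem_region.2 (h.mem τ hτ)
  H_pos τ hτ := mul_pos ha (h.H_pos τ hτ)
  H_le τ hτ := (mul_le_mul_of_nonneg_left (h.H_le hγ τ hτ) ha.le).trans ha1
  w_le τ hτ := by rw [abs_zero]; exact (toEnergy_mem_region.2 (h.mem τ hτ)).1
  Z_le τ _ := by simp
  r_le τ _ := by simp
  deriv_X τ hτ := by
    simpa using hasDerivWithinAt_toEnergy (h.deriv_x τ hτ)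
  deriv_H τ hτ := by
    refine ((h.deriv_H τ hτ).const_mul a).congr_deriv ?_
    rw [averagedQ_eq]; ring
  deriv_Z τ _ := by simpa using hasDerivWithinAt_const τ (Ici 0) (0 : ℝ)

/-- The averaged system as an autonomous equation for `(x, H, t)`. -/
def averagedVectorField (γ : ℝ) (y : (ℝ × ℝ × ℝ) × ℝ × ℝ) : (ℝ × ℝ × ℝ) × ℝ × ℝ :=
  (averagedField γ y.1, -(1 + averagedQ γ y.1) * y.2.1, 1 / y.2.1)

/-- `Ω_k` and `Ω_m` solve linear homogeneous equations, so `x` stays in the compact phase space.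
There `0 ≤ 1 + q ≤ 1 + Q`, so `H` decreases, at most exponentially, and `t` grows at a bounded rate
on bounded intervals. -/
theorem exists_averagedSolution {γ : ℝ} (hγ : 0 < γ) {x₀ : ℝ × ℝ × ℝ} (hx₀ : x₀ ∈ phaseSpace)
    (Φ₀ : ℝ) {H₀ : ℝ} (hH₀ : 0 < H₀) (t₀ : ℝ) :
    ∃ (x : ℝ → ℝ × ℝ × ℝ) (Φ H t : ℝ → ℝ), IsAveragedSolution γ x Φ H t ∧
      x 0 = x₀ ∧ Φ 0 = Φ₀ ∧ H 0 = H₀ ∧ t 0 = t₀ := by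
  set U : Set ((ℝ × ℝ × ℝ) × ℝ × ℝ) := {y | 0 < y.2.1} with hU
  have hUo : IsOpen U := isOpen_lt continuous_const (by fun_prop)
  have hf : ContDiffOn ℝ 1 (averagedVectorField γ) U := by
    have h1 := contDiff_averagedField γ (n := 1)
    have h2 := contDiff_averagedQ γ (n := 1)
    unfold averagedVectorField
    refine ContDiffOn.prodMk (by fun_prop) (ContDiffOn.prodMk (by fun_prop) ?_)
    exact contDiffOn_const.div (by fun_prop) fun y hy => (show 0 < y.2.1 from hy).ne'
  have hmem : ∀ s : ℝ, 0 ≤ s → ∀ y : ℝ → (ℝ × ℝ × ℝ) × ℝ × ℝ, y 0 = (x₀, H₀, t₀) →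
      SolvesOn (averagedVectorField γ) U s y → ∀ t ∈ Icc 0 s, (y t).1 ∈ phaseSpace := by
    intro s hs y hy0 hy t ht
    have hyc : ContinuousOn y (Icc 0 s) := fun u hu => (hy u hu).2.continuousWithinAt
    have hqc := (contDiff_averagedQ γ (n := 0)).continuous
    have hk := nonneg_of_linear (f := fun u => (y u).1.2.2)
      (a := fun u => 2 * (averagedQ γ (y u).1 - (y u).1.2.1)) (t₀ := 0) (t₁ := s)
      ((by fun_prop : Continuous fun z : (ℝ × ℝ × ℝ) × ℝ × ℝ =>
        2 * (averagedQ γ z.1 - z.1.2.1)).comp_continuousOn hyc)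
      (fun u hu => (hasDerivWithinAt_snd (hasDerivWithinAt_snd
        (hasDerivWithinAt_fst (hy u hu).2))).congr_deriv (averagedField_snd_snd γ _))
      (by simp only [hy0]; exact hx₀.2) t ht
    have hM := nonneg_of_linear (f := fun u => omegaM (y u).1)
      (a := fun u => 2 + 2 * averagedQ γ (y u).1 - 3 * γ) (t₀ := 0) (t₁ := s)
      ((by fun_prop : Continuous fun z : (ℝ × ℝ × ℝ) × ℝ × ℝ =>
        2 + 2 * averagedQ γ z.1 - 3 * γ).comp_continuousOn hyc)
      (fun u hu => hasDerivWithinAt_omegaM (x := fun u => (y u).1) (hy u hu).2.fst)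
      (by simp only [hy0, omegaM]; linarith [hx₀.1]) t ht
    simp only [omegaM] at hM
    exact ⟨by linarith, hk⟩
  obtain ⟨Q, hQ⟩ := isCompact_phaseSpace.exists_bound_of_continuousOn
    (contDiff_averagedQ γ (n := 0)).continuous.continuousOn
  have hy₀U : ((x₀, H₀, t₀) : (ℝ × ℝ × ℝ) × ℝ × ℝ) ∈ U := hH₀
  obtain ⟨y, hy0, hsol, hder⟩ := exists_global_solution hUo hf hy₀U (by
    intro T hT
    set η := H₀ * Real.exp (-(1 + Q) * T) with hη
    have hη0 : 0 < η := by positivity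
    have hQ0 : 0 ≤ 1 + Q := by
      have := (one_add_averagedQ_nonneg hγ hx₀).trans
        (add_le_add_right ((le_abs_self _).trans (hQ x₀ hx₀)) 1)
      linarith
    refine ⟨phaseSpace ×ˢ (Icc η H₀ ×ˢ Icc t₀ (t₀ + 1 / η * T)), ?_,
      isCompact_phaseSpace.prod (isCompact_Icc.prod isCompact_Icc), ?_⟩
    · rintro z ⟨-, hz, -⟩
      exact hη0.trans_le hz.1
    · intro s hs y hy0 hy
      have hph := hmem s hs.1 y hy0 hy
      have hyc : ContinuousOn y (Icc 0 s) := fun u hu => (hy u hu).2.continuousWithinAt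
      have hint : ∀ u ∈ interior (Icc 0 s), HasDerivWithinAt y (averagedVectorField γ (y u))
          (interior (Icc 0 s)) u := fun u hu =>
        (hy u (interior_subset hu)).2.mono interior_subset
      have hHu : ∀ u ∈ Icc 0 s, (y u).2.1 ≤ H₀ := by
        intro u hu
        have := antitoneOn_of_hasDerivWithinAt_nonpos (f := fun u => (y u).2.1) (convex_Icc 0 s)
          hyc.snd.fst (fun u hu => hasDerivWithinAt_fst (hasDerivWithinAt_snd (hint u hu))) (fun u hu => by
            have h1 := one_add_averagedQ_nonneg hγ (hph u (interior_subset hu))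
            have h2 : 0 < (y u).2.1 := (hy u (interior_subset hu)).1
            have := mul_nonneg h1 h2.le
            simp only [averagedVectorField]
            linarith) ⟨le_rfl, hs.1⟩ hu hu.1
        simpa [hy0] using this
      have hHl : ∀ u ∈ Icc 0 s, η ≤ (y u).2.1 := by
        intro u hu
        have hexp : ∀ v : ℝ, HasDerivAt (fun v => Real.exp ((1 + Q) * v))
            (Real.exp ((1 + Q) * v) * ((1 + Q) * 1)) v := fun v =>
          ((hasDerivAt_id v).const_mul (1 + Q)).exp
        have := monotoneOn_of_hasDerivWithinAt_nonneg
          (f := fun u => (y u).2.1 * Real.exp ((1 + Q) * u)) (convex_Icc 0 s)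
          (hyc.snd.fst.mul (by fun_prop))
          (fun u hu => (hasDerivWithinAt_fst (hasDerivWithinAt_snd (hint u hu))).mul (hexp u).hasDerivWithinAt) (fun v hv => by
            have h1 := (abs_le.1 (hQ _ (hph v (interior_subset hv)))).2
            have h2 : 0 < (y v).2.1 := (hy v (interior_subset hv)).1
            have h3 := mul_nonneg (mul_nonneg (sub_nonneg.2 h1) h2.le)
              (Real.exp_pos ((1 + Q) * v)).le
            simp only [averagedVectorField]
            linarith) ⟨le_rfl, hs.1⟩ hu hu.1
        simp only [hy0, mul_zero, Real.exp_zero, mul_one] at this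
        have h4 : H₀ * Real.exp (-(1 + Q) * u) ≤ (y u).2.1 := by
          have := mul_le_mul_of_nonneg_right this (Real.exp_pos (-(1 + Q) * u)).le
          rwa [mul_assoc (y u).2.1, ← Real.exp_add, show (1 + Q) * u + -(1 + Q) * u = 0 by ring,
            Real.exp_zero, mul_one] at this
        refine le_trans ?_ h4
        rw [hη]
        have := mul_le_mul_of_nonneg_left (hu.2.trans hs.2) hQ0
        exact mul_le_mul_of_nonneg_left (Real.exp_le_exp.2 (by linarith)) hH₀.le
      refine ⟨hph s ⟨hs.1, le_rfl⟩, ⟨hHl s ⟨hs.1, le_rfl⟩, hHu s ⟨hs.1, le_rfl⟩⟩, ?_, ?_⟩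
      · have := monotoneOn_of_hasDerivWithinAt_nonneg (f := fun u => (y u).2.2) (convex_Icc 0 s)
          hyc.snd.snd (fun u hu => hasDerivWithinAt_snd (hasDerivWithinAt_snd (hint u hu))) (fun u hu => by
            have h2 : 0 < (y u).2.1 := (hy u (interior_subset hu)).1
            simp only [averagedVectorField]
            positivity) ⟨le_rfl, hs.1⟩ ⟨hs.1, le_rfl⟩ hs.1
        simpa [hy0] using this
      · have := antitoneOn_of_hasDerivWithinAt_nonpos
          (f := fun u => (y u).2.2 - 1 / η * u) (convex_Icc 0 s)
          (hyc.snd.snd.sub (by fun_prop)) (fun u hu => (hasDerivWithinAt_snd (hasDerivWithinAt_snd (hint u hu))).sub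
            ((hasDerivWithinAt_id u _).const_mul (1 / η))) (fun u hu => by
            have h2 := hHl u (interior_subset hu)
            have := one_div_le_one_div_of_le hη0 h2
            simp only [averagedVectorField]
            linarith) ⟨le_rfl, hs.1⟩ ⟨hs.1, le_rfl⟩ hs.1
        simp only [hy0, mul_zero, sub_zero] at this
        have h3 : 1 / η * s ≤ 1 / η * T := mul_le_mul_of_nonneg_left hs.2 (by positivity)
        linarith)
  refine ⟨fun τ => (y τ).1, fun _ => Φ₀, fun τ => (y τ).2.1, fun τ => (y τ).2.2,
    ⟨fun τ hτ => hmem τ hτ y hy0 (hsol τ hτ) τ ⟨hτ, le_rfl⟩,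
      fun τ hτ => (hsol τ hτ τ ⟨hτ, le_rfl⟩).1, fun τ hτ => (hder τ hτ).fst,
      fun τ _ => hasDerivWithinAt_const _ _ _, fun τ hτ => (hder τ hτ).snd.fst,
      fun τ hτ => (hder τ hτ).snd.snd⟩, by simp [hy0], rfl, by simp [hy0], by simp [hy0]⟩

theorem IsAveragedSolution.tendsto_t {γ : ℝ} (hγ : 0 < γ) {x : ℝ → ℝ × ℝ × ℝ} {Φ H t : ℝ → ℝ}
    (h : IsAveragedSolution γ x Φ H t) : Tendsto t atTop atTop := by
  have hH0 := h.H_pos 0 (mem_Ici.2 le_rfl)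
  have key : ∀ τ ∈ Ici (0 : ℝ), t 0 + 1 / H 0 * τ ≤ t τ := by
    intro τ hτ
    have := le_of_hasDerivWithinAt_nonneg (f := fun τ => t τ - 1 / H 0 * τ)
      (f' := fun τ => 1 / H τ - 1 / H 0 * 1) (le_refl (0 : ℝ)) hτ
      (fun u hu => (h.deriv_t u hu.1).sub ((hasDerivWithinAt_id u _).const_mul _)) (fun u hu => by
        have := one_div_le_one_div_of_le (h.H_pos u hu.1) (h.H_le hγ u hu.1)
        linarith)
    simp only [mul_zero, sub_zero] at this
    linarith
  refine tendsto_atTop_mono' atTop (f₁ := fun τ => t 0 + 1 / H 0 * τ) ?_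
    (tendsto_atTop_add_const_left _ _ (tendsto_id.const_mul_atTop (by positivity)))
  filter_upwards [Ici_mem_atTop (0 : ℝ)] with τ hτ using key τ hτ

/-- A ball in the energy variables around a point without scalar field lies in any given
neighbourhood. -/
theorem exists_ball_toEnergy {p : ℝ × ℝ × ℝ} (hp : p.1 = 0) {U : Set (ℝ × ℝ × ℝ)} (hU : U ∈ 𝓝 p)
    {a : ℝ} (ha : 0 < a) : ∃ ε > 0, ∀ (x X : ℝ × ℝ × ℝ), X ∈ Metric.ball p ε → X.2 = x.2 →
      a * x.1 ^ 2 ≤ X.1 → x ∈ U := by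
  obtain ⟨ε, hε, hball⟩ := Metric.mem_nhds_iff.1 hU
  refine ⟨min ε (a * ε ^ 2), lt_min hε (by positivity), fun x X hX h2 h1 => hball ?_⟩
  rw [Metric.mem_ball, Prod.dist_eq, max_lt_iff] at hX ⊢
  refine ⟨?_, by rw [← h2]; exact hX.2.trans_le (min_le_left _ _)⟩
  have h3 := hX.1.trans_le (min_le_right _ _)
  rw [hp, Real.dist_eq, sub_zero] at h3 ⊢
  have h4 : a * x.1 ^ 2 < a * ε ^ 2 := h1.trans_lt ((le_abs_self _).trans_lt h3)
  exact abs_lt_of_sq_lt_sq (lt_of_mul_lt_mul_left h4 ha.le) hε.le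

theorem tendsto_of_toEnergy {p : ℝ × ℝ × ℝ} (hp : p.1 = 0) {a : ℝ} (ha : 0 < a)
    {x X : ℝ → ℝ × ℝ × ℝ} (hX : Tendsto X atTop (𝓝 p)) {t₀ : ℝ}
    (h2 : ∀ t ∈ Ici t₀, (X t).2 = (x t).2) (h1 : ∀ t ∈ Ici t₀, a * (x t).1 ^ 2 ≤ (X t).1) :
    Tendsto x atTop (𝓝 p) := by
  intro U hU
  obtain ⟨ε, hε, h⟩ := exists_ball_toEnergy hp hU ha
  change ∀ᶠ t in atTop, x t ∈ U
  filter_upwards [hX (Metric.ball_mem_nhds p hε), Ici_mem_atTop t₀] with t ht ht0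
  exact h (x t) (X t) ht (h2 t ht0) (h1 t ht0)

theorem isAveragedAttractor_iff {γ : ℝ} (h0 : 0 < γ) (h2 : γ ≤ 2) (p : ℝ × ℝ × ℝ) :
    IsAveragedAttractor γ p ↔ IsSelected γ p := by
  constructor
  · rintro ⟨hp, h⟩
    obtain ⟨W, hW, hWs⟩ := h univ univ_mem
    obtain ⟨x₀, hx₀W, hx1, -, hxk, hxM⟩ := exists_interior_near hp hW
    have hx₀ : x₀ ∈ phaseSpace := ⟨by simp only [omegaM] at hxM; linarith, hxk.le⟩
    obtain ⟨⟨x, Φ, H, t, hsol, e1, e2, e3, e4⟩, hall⟩ := hWs x₀ hx₀W hx₀ 0 1 0 one_pos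
    obtain ⟨-, hlim, hH, -⟩ := hall x Φ H t hsol e1 e2 e3 e4
    have hfl := hsol.isFlow h0 one_pos (by rw [e3]; norm_num)
    have hlimX : Tendsto (fun τ => toEnergy (x τ)) atTop (𝓝 (toEnergy p)) :=
      (continuous_toEnergy.tendsto p).comp hlim
    obtain ⟨c1, c2, c3, c4⟩ := hfl.limit_conditions le_rfl hlimX (by simpa using hH)
      (hfl.fst_pos (b := 1) (fun _ _ => le_rfl) (by simp only [e1, toEnergy]; positivity))
      (hfl.snd_snd_pos (b := 1) (fun _ _ => le_rfl) (by simp only [e1, toEnergy]; exact hxk))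
      (hfl.matter_pos (b := 1) (fun _ _ => le_rfl) (by
        simp only [e1, toEnergy]; simp only [omegaM] at hxM; linarith))
    exact (isSelected_of_limit_conditions (hfl.limit_mem_region hlimX) c1 c2 c3 c4).of_toEnergy
  · intro hp
    have hp1 := hp.fst_eq_zero
    obtain ⟨L, ρ, hL⟩ := exists_isStrictLyapunov h0 h2 hp
    refine ⟨toEnergy_mem_region.1 (by rw [toEnergy_eq_self hp1]; exact hL.mem), fun U hU => ?_⟩
    obtain ⟨ε, hε, hεU⟩ := exists_ball_toEnergy hp1 hU one_pos
    obtain ⟨δ₁, hδ₁, η₁, hη₁, hst⟩ := hL.stable le_rfl hε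
    obtain ⟨δ₂, hδ₂, η₂, hη₂, hte⟩ := hL.tendsto le_rfl
    refine ⟨toEnergy ⁻¹' (Metric.ball p δ₁ ∩ Metric.ball p δ₂), ?_, ?_⟩
    · apply continuous_toEnergy.continuousAt
      rw [toEnergy_eq_self hp1]
      exact inter_mem (Metric.ball_mem_nhds p hδ₁) (Metric.ball_mem_nhds p hδ₂)
    · intro x₀ hx₀W hx₀ Φ₀ H₀ t₀ hH₀
      refine ⟨exists_averagedSolution h0 hx₀ Φ₀ hH₀ t₀, ?_⟩
      intro x Φ H t hsol e1 e2 e3 e4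
      -- With this scale, `a * H₀` is below `1` and below both smallness thresholds.
      set a := min 1 (min η₁ η₂) / (2 * H₀) with ha
      have hm : 0 < min 1 (min η₁ η₂) := lt_min one_pos (lt_min hη₁ hη₂)
      have ha0 : 0 < a := by positivity
      have haH : a * H 0 = min 1 (min η₁ η₂) / 2 := by rw [e3, ha]; field_simp
      have g1 : min 1 (min η₁ η₂) ≤ 1 := min_le_left _ _
      have g2 : min 1 (min η₁ η₂) ≤ η₁ := (min_le_right _ _).trans (min_le_left _ _)
      have g3 : min 1 (min η₁ η₂) ≤ η₂ := (min_le_right _ _).trans (min_le_right _ _)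
      have hfl := hsol.isFlow h0 ha0 (by rw [haH]; linarith)
      have hlim := hte _ _ _ _ _ _ _ hfl (by simp only [e1]; exact hx₀W.2)
        (by simp only [haH]; linarith)
      refine ⟨fun τ hτ => ?_, ?_, ?_, hsol.tendsto_t h0⟩
      · exact hεU (x τ) (toEnergy (x τ)) (hst _ _ _ _ _ _ _ hfl (by simp only [e1]; exact hx₀W.1)
          (by simp only [haH]; linarith) τ hτ) rfl (by simp [toEnergy])
      · exact tendsto_of_toEnergy hp1 one_pos hlim.1 (t₀ := 0) (fun _ _ => rfl)
          (fun _ _ => by simp [toEnergy])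
      · have := hlim.2.const_mul a⁻¹
        simpa [← mul_assoc, inv_mul_cancel₀ ha0.ne'] using this

/-! ## The full system -/

namespace HarmonicPotential

variable (P : HarmonicPotential)

theorem ω_ne_zero : P.ω ≠ 0 := by
  intro h
  have h1 := P.two_mul_sq_lt
  rw [h] at h1
  nlinarith [sq_nonneg P.μ]

theorem gap_pos : 0 < P.ω ^ 2 - 2 * P.μ ^ 2 := by linarith [P.two_mul_sq_lt]

theorem f_pos : 0 < P.f := by
  have h2 := P.gap_pos
  have h3 := P.μ_pos
  have h4 := P.b_pos
  unfold HarmonicPotential.f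
  positivity

theorem tuning : P.b * P.μ ^ 3 = P.f * (P.ω ^ 2 - 2 * P.μ ^ 2) := by
  have h2 := P.gap_pos.ne'
  rw [HarmonicPotential.f, div_mul_cancel₀ _ h2]

/-- The derivative of the potential. -/
def dV (φ : ℝ) : ℝ := P.μ ^ 3 * (P.b * Real.sin (φ / P.f) + 2 * φ / P.μ)

theorem hasDerivAt_V (φ : ℝ) : HasDerivAt P.V (P.dV φ) φ := by
  have hf := P.f_pos.ne'
  have h1 := (((((hasDerivAt_id φ).div_const P.f).cos.const_sub 1).const_mul
    (P.b * P.f)).add (((hasDerivAt_id φ).pow 2).div_const P.μ)).const_mul (P.μ ^ 3)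
  refine h1.congr_deriv ?_
  have hμ := P.μ_pos.ne'
  simp only [dV, id]
  field_simp
  norm_num
  ring

theorem le_V (φ : ℝ) : P.μ ^ 2 * φ ^ 2 ≤ P.V φ := by
  have h1 := Real.cos_le_one (φ / P.f)
  have h2 : 0 ≤ P.μ ^ 3 * (P.b * P.f * (1 - Real.cos (φ / P.f))) :=
    mul_nonneg (pow_nonneg P.μ_pos.le 3)
      (mul_nonneg (mul_nonneg P.b_pos.le P.f_pos.le) (by linarith))
  have h3 : P.V φ = P.μ ^ 3 * (P.b * P.f * (1 - Real.cos (φ / P.f))) + P.μ ^ 2 * φ ^ 2 := by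
    have := P.μ_pos.ne'
    unfold V; field_simp
  linarith

theorem V_nonneg (φ : ℝ) : 0 ≤ P.V φ := le_trans (by positivity) (P.le_V φ)

theorem V_sub (φ : ℝ) : P.V φ - P.ω ^ 2 * φ ^ 2 / 2
    = P.μ ^ 3 * P.b * P.f * (1 - Real.cos (φ / P.f) - (φ / P.f) ^ 2 / 2) := by
  have h1 := P.μ_pos.ne'
  have h2 := P.f_pos.ne'
  have h3 : P.μ ^ 3 * P.b * P.f * ((φ / P.f) ^ 2 / 2) = (P.ω ^ 2 - 2 * P.μ ^ 2) * φ ^ 2 / 2 := by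
    rw [mul_comm (P.μ ^ 3), P.tuning]; field_simp
  have h4 : P.V φ = P.μ ^ 3 * P.b * P.f * (1 - Real.cos (φ / P.f)) + P.μ ^ 2 * φ ^ 2 := by
    unfold V; field_simp
  rw [h4]
  linear_combination h3

theorem V_le (φ : ℝ) : P.V φ ≤ P.ω ^ 2 * φ ^ 2 / 2 := by
  have h1 := P.V_sub φ
  have h2 := Real.one_sub_sq_div_two_le_cos (x := φ / P.f)
  have h3 : 0 ≤ P.μ ^ 3 * P.b * P.f :=
    mul_nonneg (mul_nonneg (pow_nonneg P.μ_pos.le 3) P.b_pos.le) P.f_pos.le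
  have := mul_nonneg h3 (show 0 ≤ Real.cos (φ / P.f) - (1 - (φ / P.f) ^ 2 / 2) by linarith)
  linarith

end HarmonicPotential

/-! ### Cubic remainder bounds for the anharmonic part of the potential -/

theorem abs_one_sub_cos_sub_le (x : ℝ) : |1 - Real.cos x - x ^ 2 / 2| ≤ 3 * |x| ^ 3 := by
  have hx := abs_nonneg x
  rcases le_or_gt |x| 1 with h | h
  · have h1 := Real.cos_bound h
    have h2 : |x| ^ 4 ≤ |x| ^ 3 := pow_le_pow_of_le_one hx h (by norm_num)
    rw [show 1 - Real.cos x - x ^ 2 / 2 = -(Real.cos x - (1 - x ^ 2 / 2)) by ring, abs_neg]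
    have h3 : 0 ≤ |x| ^ 3 := by positivity
    linarith
  · have h1 := Real.cos_le_one x
    have h2 := Real.neg_one_le_cos x
    have h3 : |x| ^ 2 ≤ |x| ^ 3 := pow_le_pow_right₀ h.le (by norm_num)
    have h4 : 1 ≤ |x| ^ 3 := one_le_pow₀ h.le
    have h5 : x ^ 2 = |x| ^ 2 := (sq_abs x).symm
    rw [h5, abs_le]
    constructor <;> nlinarith [sq_nonneg |x|]

/-- Both `2 (1 - cos x)` and `x sin x` equal `x²` up to fourth order. A cubic bound suffices later
and also holds for large `x`, where the left side grows linearly. -/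
theorem abs_virial_le (x : ℝ) : |2 * (1 - Real.cos x) - x * Real.sin x| ≤ 5 * |x| ^ 3 := by
  have hx := abs_nonneg x
  rcases le_or_gt |x| 1 with h | h
  · have h1 := Real.cos_bound h
    have h2 : |Real.sin x - (x - x ^ 3 / 6)| ≤ |x| ^ 4 * (5 / 96) := by
      have g1 := Real.sin_bound h
      have g2 : |x| ^ 5 ≤ |x| ^ 4 := pow_le_pow_of_le_one hx h (by norm_num)
      have g3 : 0 ≤ |x| ^ 4 := by positivity
      linarith
    have h3 : |x| ^ 4 ≤ |x| ^ 3 := pow_le_pow_of_le_one hx h (by norm_num)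
    have h4 : 0 ≤ |x| ^ 3 := by positivity
    have h5 : 2 * (1 - Real.cos x) - x * Real.sin x
        = -2 * (Real.cos x - (1 - x ^ 2 / 2)) - x * (Real.sin x - (x - x ^ 3 / 6)) + x ^ 4 / 6 := by
      ring
    rw [h5]
    calc _ ≤ |-2 * (Real.cos x - (1 - x ^ 2 / 2)) - x * (Real.sin x - (x - x ^ 3 / 6))|
          + |x ^ 4 / 6| := abs_add_le _ _
      _ ≤ |-2 * (Real.cos x - (1 - x ^ 2 / 2))| + |x * (Real.sin x - (x - x ^ 3 / 6))|
          + |x ^ 4 / 6| := by gcongr; exact abs_sub _ _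
      _ = 2 * |Real.cos x - (1 - x ^ 2 / 2)| + |x| * |Real.sin x - (x - x ^ 3 / 6)|
          + |x| ^ 4 / 6 := by
        rw [abs_mul, abs_mul, abs_div, abs_pow]; norm_num
      _ ≤ 2 * (|x| ^ 4 * (5 / 96)) + 1 * (|x| ^ 4 * (5 / 96)) + |x| ^ 4 / 6 := by gcongr
      _ ≤ 5 * |x| ^ 3 := by linarith
  · have h1 := Real.cos_le_one x
    have h2 := Real.neg_one_le_cos x
    have h3 : |x| ^ 1 ≤ |x| ^ 3 := pow_le_pow_right₀ h.le (by norm_num)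
    have h4 : 1 ≤ |x| ^ 3 := one_le_pow₀ h.le
    calc _ ≤ |2 * (1 - Real.cos x)| + |x * Real.sin x| := abs_sub _ _
      _ ≤ 4 + |x| * 1 := by
        rw [abs_mul x]
        gcongr
        · rw [abs_le]; constructor <;> linarith
        · exact Real.abs_sin_le_one x
      _ ≤ 5 * |x| ^ 3 := by linarith

/-! ### Energy and pressure of the scalar field in terms of amplitude and phase -/

section State

variable (P : HarmonicPotential)

/-- The scalar field `φ`. -/
def scalarField (θ H Ω : ℝ) : ℝ := √6 * H * Ω * Real.sin θ / P.ω

/-- The time derivative of the scalar field. -/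
def scalarVel (θ H Ω : ℝ) : ℝ := √6 * H * Ω * Real.cos θ

/-- The energy fraction of the scalar field. -/
def energyFrac (θ H Ω : ℝ) : ℝ :=
  (scalarVel θ H Ω ^ 2 / 2 + P.V (scalarField P θ H Ω)) / (3 * H ^ 2)

/-- The pressure fraction of the scalar field. -/
def pressureFrac (θ H Ω : ℝ) : ℝ :=
  (scalarVel θ H Ω ^ 2 / 2 - P.V (scalarField P θ H Ω)) / (3 * H ^ 2)

/-- The corrector `φ φ' / (6 H)`. -/
def corrector (θ H Ω : ℝ) : ℝ := scalarField P θ H Ω * scalarVel θ H Ω / (6 * H)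

def energyState (θ H : ℝ) (x : ℝ × ℝ × ℝ) : ℝ × ℝ × ℝ := (energyFrac P θ H x.1, x.2)

variable {P}

theorem scalarVel_sq (θ H Ω : ℝ) : scalarVel θ H Ω ^ 2 = 6 * H ^ 2 * Ω ^ 2 * Real.cos θ ^ 2 := by
  have h6 : √(6 : ℝ) ^ 2 = 6 := Real.sq_sqrt (by norm_num)
  simp only [scalarVel, mul_pow, h6]

theorem scalarField_sq (θ H Ω : ℝ) :
    scalarField P θ H Ω ^ 2 = 6 * H ^ 2 * Ω ^ 2 * Real.sin θ ^ 2 / P.ω ^ 2 := by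
  have h6 : √(6 : ℝ) ^ 2 = 6 := Real.sq_sqrt (by norm_num)
  simp only [scalarField, mul_pow, div_pow, h6]

theorem V_scalarField (θ H Ω : ℝ) : P.V (scalarField P θ H Ω)
    = P.μ ^ 3 * P.b * P.f * (1 - Real.cos (scalarField P θ H Ω / P.f))
      + 6 * P.μ ^ 2 * H ^ 2 * Ω ^ 2 * Real.sin θ ^ 2 / P.ω ^ 2 := by
  have h1 := P.μ_pos.ne'
  rw [HarmonicPotential.V, scalarField_sq]
  field_simp

theorem energyFrac_eq {θ H Ω : ℝ} (hH : H ≠ 0) : energyFrac P θ H Ω = Ω ^ 2 * Real.cos θ ^ 2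
    + (P.μ ^ 3 * P.b * P.f * (1 - Real.cos (scalarField P θ H Ω / P.f)) / (3 * H ^ 2)
      + 2 * P.μ ^ 2 * Ω ^ 2 * Real.sin θ ^ 2 / P.ω ^ 2) := by
  have h2 := P.ω_ne_zero
  rw [energyFrac, V_scalarField, scalarVel_sq]
  field_simp
  ring

theorem pressureFrac_eq {θ H Ω : ℝ} (hH : H ≠ 0) : pressureFrac P θ H Ω = Ω ^ 2 * Real.cos θ ^ 2
    - (P.μ ^ 3 * P.b * P.f * (1 - Real.cos (scalarField P θ H Ω / P.f)) / (3 * H ^ 2)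
      + 2 * P.μ ^ 2 * Ω ^ 2 * Real.sin θ ^ 2 / P.ω ^ 2) := by
  have h2 := P.ω_ne_zero
  rw [pressureFrac, V_scalarField, scalarVel_sq]
  field_simp
  ring

theorem sin_arg (θ H Ω : ℝ) :
    √6 * H * Real.sin θ * Ω / (P.f * P.ω) = scalarField P θ H Ω / P.f := by
  have h1 := P.f_pos.ne'
  have h2 := P.ω_ne_zero
  rw [scalarField]
  field_simp

theorem sin_half_arg_sq (θ H Ω : ℝ) :
    Real.sin (√(3 / 2) * H * Real.sin θ * Ω / (P.f * P.ω)) ^ 2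
      = (1 - Real.cos (scalarField P θ H Ω / P.f)) / 2 := by
  have h6 : √(6 : ℝ) = 2 * √(3 / 2) := by
    rw [show (6 : ℝ) = 2 ^ 2 * (3 / 2) by norm_num, Real.sqrt_mul (by norm_num),
      Real.sqrt_sq (by norm_num)]
  rw [Real.sin_sq_eq_half_sub, ← sin_arg, h6]
  have : 2 * (√(3 / 2) * H * Real.sin θ * Ω / (P.f * P.ω))
      = 2 * √(3 / 2) * H * Real.sin θ * Ω / (P.f * P.ω) := by ring
  rw [this]
  ring

theorem fullQ_eq {γ θ H : ℝ} (hH : H ≠ 0) (x : ℝ × ℝ × ℝ) :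
    fullQ P γ θ H x = energyQ γ (energyState P θ H x) + 3 / 2 * pressureFrac P θ H x.1 := by
  obtain ⟨Ω, S, k⟩ := x
  have h2 := P.ω_ne_zero
  simp only [fullQ, energyQ, energyState, energyFrac_eq hH, pressureFrac_eq hH, sin_half_arg_sq]
  field_simp
  ring

theorem fullField_snd_fst {γ θ H : ℝ} (hH : H ≠ 0) (x : ℝ × ℝ × ℝ) :
    (fullField P γ θ H x).2.1 = H * (x.2.1 * (fullQ P γ θ H x - 2) + x.2.2) := by
  obtain ⟨Ω, S, k⟩ := x
  have h2 := P.ω_ne_zero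
  simp only [fullField, fullQ]
  field_simp
  ring

theorem fullField_snd_snd {γ θ H : ℝ} (hH : H ≠ 0) (x : ℝ × ℝ × ℝ) :
    (fullField P γ θ H x).2.2 = 2 * H * (fullQ P γ θ H x - x.2.1) * x.2.2 := by
  obtain ⟨Ω, S, k⟩ := x
  have h2 := P.ω_ne_zero
  simp only [fullField, fullQ, sin_half_arg_sq, sin_arg]
  field_simp
  ring

theorem fullField_fst {γ θ H : ℝ} (hH : H ≠ 0) (x : ℝ × ℝ × ℝ) :
    (fullField P γ θ H x).1 = (1 + fullQ P γ θ H x) * H * x.1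
      + (-(P.b * P.μ ^ 3 / (√6 * H)) * Real.cos θ * Real.sin (scalarField P θ H x.1 / P.f)
        + (P.ω ^ 2 - 2 * P.μ ^ 2) / P.ω * x.1 * Real.sin θ * Real.cos θ
        - 3 * H * x.1 * Real.cos θ ^ 2) := by
  obtain ⟨Ω, S, k⟩ := x
  have h2 := P.ω_ne_zero
  have h6 : √(6 : ℝ) ≠ 0 := by positivity
  simp only [fullField, fullQ, sin_half_arg_sq, sin_arg, Real.sin_two_mul]
  have hs : Real.sin θ ^ 2 = 1 - Real.cos θ ^ 2 := Real.sin_sq θ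
  rw [hs]
  field_simp
  ring

theorem sin_eq_mul_sinc (θ H Ω : ℝ) : Real.sin (scalarField P θ H Ω / P.f)
    = √6 * H * Real.sin θ * Ω / (P.f * P.ω) * Real.sinc (√6 * H * Real.sin θ * Ω / (P.f * P.ω)) := by
  rw [← sin_arg]
  by_cases h : √6 * H * Real.sin θ * Ω / (P.f * P.ω) = 0
  · rw [h]; simp
  · rw [Real.sinc_of_ne_zero h, mul_div_cancel₀ _ h]

/-- The form without division by `Ω`; together with `fullField_fst` it determines the derivatives of
`φ` and `φ'`, also where `Ω = 0`. -/
theorem mul_fullPhaseRate {θ H Ω : ℝ} (hH : H ≠ 0) : Ω * fullPhaseRate P θ H Ω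
    = -(P.b * P.μ ^ 3 / (√6 * H)) * Real.sin θ * Real.sin (scalarField P θ H Ω / P.f)
      + (P.ω ^ 2 - 2 * P.μ ^ 2) / P.ω * Ω * Real.sin θ ^ 2
      - 3 * H * Ω * Real.sin θ * Real.cos θ := by
  have h1 := P.f_pos.ne'
  have h2 := P.ω_ne_zero
  have h6 : √(6 : ℝ) ≠ 0 := by positivity
  rw [sin_eq_mul_sinc, fullPhaseRate]
  generalize Real.sinc (√6 * H * Real.sin θ * Ω / (P.f * P.ω)) = σ
  field_simp

theorem energyFrac_nonneg (θ H Ω : ℝ) : 0 ≤ energyFrac P θ H Ω := by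
  have := P.V_nonneg (scalarField P θ H Ω)
  unfold energyFrac
  positivity

theorem abs_pressureFrac_le (θ H Ω : ℝ) : |pressureFrac P θ H Ω| ≤ energyFrac P θ H Ω := by
  have h1 := P.V_nonneg (scalarField P θ H Ω)
  unfold pressureFrac energyFrac
  rw [abs_div, abs_of_nonneg (by positivity : 0 ≤ 3 * H ^ 2)]
  gcongr
  rw [abs_le]
  constructor <;> nlinarith [sq_nonneg (scalarVel θ H Ω)]

theorem energyFrac_le {θ H Ω : ℝ} (hH : H ≠ 0) : energyFrac P θ H Ω ≤ Ω ^ 2 := by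
  have h1 := P.V_le (scalarField P θ H Ω)
  have h2 := P.ω_ne_zero
  have h3 : 0 < 3 * H ^ 2 := by positivity
  rw [scalarField_sq] at h1
  rw [energyFrac, div_le_iff₀ h3, scalarVel_sq]
  have h4 : P.ω ^ 2 * (6 * H ^ 2 * Ω ^ 2 * Real.sin θ ^ 2 / P.ω ^ 2) / 2
      = 3 * H ^ 2 * Ω ^ 2 * Real.sin θ ^ 2 := by field_simp; ring
  have h5 := Real.sin_sq θ
  rw [h4, h5] at h1
  linarith

/-- From `μ² φ² ≤ V` and `2 μ² < ω²`. With `energyFrac_le`, `E` and `Ω²` are comparable uniformly in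
the phase, so closeness to a point with `Ω = 0` means the same in both variables. -/
theorem le_energyFrac {θ H Ω : ℝ} (hH : H ≠ 0) :
    2 * P.μ ^ 2 / P.ω ^ 2 * Ω ^ 2 ≤ energyFrac P θ H Ω := by
  have h1 := P.le_V (scalarField P θ H Ω)
  have h2 := P.ω_ne_zero
  have h3 : 0 < 3 * H ^ 2 := by positivity
  rw [scalarField_sq] at h1
  rw [energyFrac, le_div_iff₀ h3, scalarVel_sq]
  have h4 : 2 * P.μ ^ 2 / P.ω ^ 2 ≤ 1 := by
    rw [div_le_one (by positivity)]; exact P.two_mul_sq_lt.le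
  have h5 : P.μ ^ 2 * (6 * H ^ 2 * Ω ^ 2 * Real.sin θ ^ 2 / P.ω ^ 2)
      = 2 * P.μ ^ 2 / P.ω ^ 2 * (3 * H ^ 2 * Ω ^ 2 * Real.sin θ ^ 2) := by ring
  have h6 := Real.sin_sq θ
  rw [h5, h6] at h1
  have h7 : 2 * P.μ ^ 2 / P.ω ^ 2 * (3 * H ^ 2 * Ω ^ 2 * Real.cos θ ^ 2)
      ≤ 1 * (3 * H ^ 2 * Ω ^ 2 * Real.cos θ ^ 2) :=
    mul_le_mul_of_nonneg_right h4 (by positivity)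
  linarith

/-- The tuning of `f` makes the quadratic part of `V` equal to `ω² φ² / 2`, which contributes
exactly `Ω²`. Hence `E - Ω² → 0` as `H → 0`, even if the limit of `Ω` is not `0`. -/
theorem abs_energyFrac_sub_le {θ H Ω : ℝ} (hH : 0 < H) : |energyFrac P θ H Ω - Ω ^ 2|
    ≤ P.μ ^ 3 * P.b * P.f * (√6 / (|P.ω| * P.f)) ^ 3 * (H * |Ω| ^ 3) := by
  have h2 := P.ω_ne_zero
  have hf := P.f_pos
  have hcoef : 0 ≤ P.μ ^ 3 * P.b * P.f :=
    mul_nonneg (mul_nonneg (pow_nonneg P.μ_pos.le 3) P.b_pos.le) hf.le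
  have h1 : energyFrac P θ H Ω - Ω ^ 2
      = (P.V (scalarField P θ H Ω) - P.ω ^ 2 * scalarField P θ H Ω ^ 2 / 2) / (3 * H ^ 2) := by
    rw [energyFrac, scalarVel_sq, scalarField_sq]
    have hs := Real.cos_sq' θ
    rw [hs]
    field_simp
    ring
  have h3 : |scalarField P θ H Ω / P.f| ≤ √6 / (|P.ω| * P.f) * (H * |Ω|) := by
    rw [scalarField, abs_div, abs_div, abs_mul, abs_mul, abs_mul, abs_of_pos hf, abs_of_pos hH,
      abs_of_nonneg (Real.sqrt_nonneg 6)]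
    have hω : 0 < |P.ω| := abs_pos.2 h2
    have : √6 * H * |Ω| * |Real.sin θ| / |P.ω| / P.f
        = √6 / (|P.ω| * P.f) * (H * |Ω|) * |Real.sin θ| := by field_simp
    rw [this]
    exact mul_le_of_le_one_right (by positivity) (Real.abs_sin_le_one θ)
  rw [h1, P.V_sub, abs_div, abs_mul, abs_of_nonneg hcoef, abs_of_pos (by positivity : 0 < 3 * H ^ 2),
    div_le_iff₀ (by positivity)]
  calc P.μ ^ 3 * P.b * P.f * |1 - Real.cos (scalarField P θ H Ω / P.f)
        - (scalarField P θ H Ω / P.f) ^ 2 / 2|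
      ≤ P.μ ^ 3 * P.b * P.f * (3 * (√6 / (|P.ω| * P.f) * (H * |Ω|)) ^ 3) := by
        gcongr
        exact (abs_one_sub_cos_sub_le _).trans (by gcongr)
    _ = P.μ ^ 3 * P.b * P.f * (√6 / (|P.ω| * P.f)) ^ 3 * (H * |Ω| ^ 3) * (3 * H ^ 2) := by ring

theorem fullOmegaM_eq (θ H : ℝ) (x : ℝ × ℝ × ℝ) :
    fullOmegaM P θ H x = 1 - energyFrac P θ H x.1 - x.2.1 ^ 2 - x.2.2 := by
  simp only [fullOmegaM, energyFrac, scalarVel, scalarField]; ring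

theorem IsPhysical.mem_region {θ H : ℝ} {x : ℝ × ℝ × ℝ} (h : IsPhysical P θ H x) :
    energyState P θ H x ∈ region := by
  have h1 := h.2.2.2
  rw [fullOmegaM_eq] at h1
  exact ⟨energyFrac_nonneg _ _ _, h.2.2.1, by simp only [energyState]; linarith⟩

/-- `1 + q` is a sum of nonnegative fractions, since `E + w ≥ 0`; consequently `H` never increases.
-/
theorem IsPhysical.one_add_fullQ_nonneg {γ θ H : ℝ} (hγ : 0 < γ) {x : ℝ × ℝ × ℝ}
    (h : IsPhysical P θ H x) : 0 ≤ 1 + fullQ P γ θ H x := by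
  have h1 := h.2.2.2
  rw [fullOmegaM_eq] at h1
  have h2 := (abs_le.1 (abs_pressureFrac_le (P := P) θ H x.1)).1
  have h3 := h.2.2.1
  rw [fullQ_eq h.1.ne']
  have h4 := mul_nonneg hγ.le h1
  have h5 : 1 + (energyQ γ (energyState P θ H x) + 3 / 2 * pressureFrac P θ H x.1)
      = 3 * x.2.1 ^ 2 + 3 / 2 * (γ * (1 - energyFrac P θ H x.1 - x.2.1 ^ 2 - x.2.2)) + x.2.2
        + 3 / 2 * (energyFrac P θ H x.1 + pressureFrac P θ H x.1) := by
    simp only [energyQ, energyState]; ring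
  rw [h5]
  nlinarith [sq_nonneg x.2.1]

/-- A bound for the deceleration parameter of physical states. -/
theorem exists_fullQ_le (P : HarmonicPotential) (γ : ℝ) : ∃ Q : ℝ, 0 ≤ Q ∧
    ∀ (θ H : ℝ) (x : ℝ × ℝ × ℝ), IsPhysical P θ H x → |fullQ P γ θ H x| ≤ Q := by
  obtain ⟨Q, hQ, hQ'⟩ := exists_abs_le_region (contDiff_energyQ γ (n := 0)).continuous
  refine ⟨Q + 3 / 2, by positivity, fun θ H x h => ?_⟩
  have h1 := hQ' _ h.mem_region
  have h2 := (abs_pressureFrac_le (P := P) θ H x.1).trans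
    (fst_le_one_of_mem_region h.mem_region)
  rw [fullQ_eq h.1.ne']
  rw [abs_le] at *
  constructor <;> linarith

end State

/-! ### Differential equations for the physical variables -/

section Curve

variable {P : HarmonicPotential} {γ t : ℝ} {s : Set ℝ} {x : ℝ → ℝ × ℝ × ℝ} {θ H : ℝ → ℝ}

/-- The amplitude and phase equations come from variation of constants: the contributions of `Ω'`
and `Φ'` cancel, apart from the rotation by `ω`. -/
theorem hasDerivWithinAt_scalarField (hH : H t ≠ 0)
    (hx : HasDerivWithinAt x (fullField P γ (θ t) (H t) (x t)) s t)
    (hθ : HasDerivWithinAt θ (P.ω - fullPhaseRate P (θ t) (H t) (x t).1) s t)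
    (hH' : HasDerivWithinAt H (-(1 + fullQ P γ (θ t) (H t) (x t)) * H t ^ 2) s t) :
    HasDerivWithinAt (fun u => scalarField P (θ u) (H u) (x u).1)
      (scalarVel (θ t) (H t) (x t).1) s t := by
  have h2 := P.ω_ne_zero
  have h := (((hH'.const_mul √6).mul (hasDerivWithinAt_fst hx)).mul hθ.sin).div_const P.ω
  refine h.congr_deriv ?_
  rw [fullField_fst hH]
  have e := mul_fullPhaseRate (P := P) (θ := θ t) (Ω := (x t).1) hH
  simp only [scalarVel, Pi.mul_apply]
  rw [div_eq_iff h2]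
  linear_combination (-√6 * H t * Real.cos (θ t)) * e

theorem hasDerivWithinAt_scalarVel (hH : H t ≠ 0)
    (hx : HasDerivWithinAt x (fullField P γ (θ t) (H t) (x t)) s t)
    (hθ : HasDerivWithinAt θ (P.ω - fullPhaseRate P (θ t) (H t) (x t).1) s t)
    (hH' : HasDerivWithinAt H (-(1 + fullQ P γ (θ t) (H t) (x t)) * H t ^ 2) s t) :
    HasDerivWithinAt (fun u => scalarVel (θ u) (H u) (x u).1)
      (-3 * H t * scalarVel (θ t) (H t) (x t).1
        - P.dV (scalarField P (θ t) (H t) (x t).1)) s t := by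
  have h2 := P.ω_ne_zero
  have h3 := P.μ_pos.ne'
  have h6 : √(6 : ℝ) ≠ 0 := by positivity
  have h := ((hH'.const_mul √6).mul (hasDerivWithinAt_fst hx)).mul hθ.cos
  refine h.congr_deriv ?_
  rw [fullField_fst hH]
  have e := mul_fullPhaseRate (P := P) (θ := θ t) (Ω := (x t).1) hH
  simp only [HarmonicPotential.dV, Pi.mul_apply]
  generalize Real.sin (scalarField P (θ t) (H t) (x t).1 / P.f) = σ at *
  simp only [scalarVel, scalarField]
  have hs := Real.sin_sq_add_cos_sq (θ t)
  have e2 : √6 * H t * Real.sin (θ t) * ((x t).1 * fullPhaseRate P (θ t) (H t) (x t).1)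
      = √6 * H t * Real.sin (θ t) * (-(P.b * P.μ ^ 3 / (√6 * H t)) * Real.sin (θ t) * σ
      + (P.ω ^ 2 - 2 * P.μ ^ 2) / P.ω * (x t).1 * Real.sin (θ t) ^ 2
      - 3 * H t * (x t).1 * Real.sin (θ t) * Real.cos (θ t)) := by rw [e]
  generalize fullPhaseRate P (θ t) (H t) (x t).1 = R at *
  generalize fullQ P γ (θ t) (H t) (x t) = Q at *
  have e3 : √6 * H t * ((P.b * P.μ ^ 3 / (√6 * H t)) * σ) = P.b * P.μ ^ 3 * σ := by
    field_simp
  have e4 : P.μ ^ 3 * (P.b * σ + 2 * (√6 * H t * (x t).1 * Real.sin (θ t) / P.ω) / P.μ)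
      = P.b * P.μ ^ 3 * σ + 2 * P.μ ^ 2 / P.ω * √6 * H t * (x t).1 * Real.sin (θ t) := by
    field_simp
  have e5 : (P.ω ^ 2 - 2 * P.μ ^ 2) / P.ω = P.ω - 2 * P.μ ^ 2 / P.ω := by field_simp
  rw [e5] at e2 ⊢
  rw [e4]
  linear_combination e2 + (-P.b * P.μ ^ 3 * σ
    + (P.ω - 2 * P.μ ^ 2 / P.ω) * √6 * H t * (x t).1 * Real.sin (θ t)
    - 3 * √6 * H t ^ 2 * (x t).1 * Real.cos (θ t)) * hs
    - (Real.sin (θ t) ^ 2 + Real.cos (θ t) ^ 2) * e3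

/-- By the Klein–Gordon equation the scalar energy is lost at the rate `3 H φ'² = 9 H³ (E + w)`. -/
theorem hasDerivWithinAt_energyState (hH : H t ≠ 0)
    (hx : HasDerivWithinAt x (fullField P γ (θ t) (H t) (x t)) s t)
    (hθ : HasDerivWithinAt θ (P.ω - fullPhaseRate P (θ t) (H t) (x t).1) s t)
    (hH' : HasDerivWithinAt H (-(1 + fullQ P γ (θ t) (H t) (x t)) * H t ^ 2) s t) :
    HasDerivWithinAt (fun u => energyState P (θ u) (H u) (x u))
      (H t • (energyField γ (energyState P (θ t) (H t) (x t))
        + pressureFrac P (θ t) (H t) (x t).1 • oscField (energyState P (θ t) (H t) (x t)))) s t := by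
  have hφ := hasDerivWithinAt_scalarField hH hx hθ hH'
  have hψ := hasDerivWithinAt_scalarVel hH hx hθ hH'
  have hV := (P.hasDerivAt_V _).comp_hasDerivWithinAt t hφ
  have hE := (((hψ.pow 2).div_const 2).add hV).div ((hH'.pow 2).const_mul 3)
    (by positivity : 3 * H t ^ 2 ≠ 0)
  have hq := fullQ_eq (P := P) (γ := γ) (θ := θ t) hH (x t)
  refine (hE.prodMk (hasDerivWithinAt_snd hx)).congr_deriv ?_
  refine Prod.ext ?_ (Prod.ext ?_ ?_)
  · have e1 : scalarVel (θ t) (H t) (x t).1 ^ 2 / 2 + P.V (scalarField P (θ t) (H t) (x t).1)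
        = 3 * H t ^ 2 * energyFrac P (θ t) (H t) (x t).1 := by
      rw [energyFrac]; field_simp
    have e2 : scalarVel (θ t) (H t) (x t).1 ^ 2
        = 3 * H t ^ 2 * (energyFrac P (θ t) (H t) (x t).1
          + pressureFrac P (θ t) (H t) (x t).1) := by
      rw [energyFrac, pressureFrac]; field_simp; ring
    simp only [Function.comp_apply, Pi.add_apply, Pi.pow_apply, Prod.smul_fst, Prod.fst_add,
      smul_eq_mul, energyField, oscField]
    have hq' : energyQ γ (energyState P (θ t) (H t) (x t))
        = fullQ P γ (θ t) (H t) (x t) - 3 / 2 * pressureFrac P (θ t) (H t) (x t).1 := by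
      rw [hq]; ring
    rw [hq', div_eq_iff (by positivity)]
    simp only [energyState, e1, Nat.cast_ofNat, Nat.add_one_sub_one, pow_one]
    generalize energyFrac P (θ t) (H t) (x t).1 = E at *
    generalize pressureFrac P (θ t) (H t) (x t).1 = w at *
    linear_combination (-9 * H t ^ 3) * e2
  · have := fullField_snd_fst (P := P) (γ := γ) (θ := θ t) hH (x t)
    simp only [this, hq, Prod.smul_snd, Prod.smul_fst, Prod.snd_add, Prod.fst_add, smul_eq_mul,
      energyField, oscField, energyState]
    ring
  · have := fullField_snd_snd (P := P) (γ := γ) (θ := θ t) hH (x t)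
    simp only [this, hq, Prod.smul_snd, Prod.snd_add, smul_eq_mul,
      energyField, oscField, energyState]
    ring

/-- The virial theorem: `(φ φ')' = φ'² - φ V' - 3 H φ φ'`, and replacing `φ V'` by `2 V` gives `6 H²
w`. The remainder vanishes for a harmonic potential up to the expansion terms. -/
theorem hasDerivWithinAt_corrector (hH : H t ≠ 0)
    (hx : HasDerivWithinAt x (fullField P γ (θ t) (H t) (x t)) s t)
    (hθ : HasDerivWithinAt θ (P.ω - fullPhaseRate P (θ t) (H t) (x t).1) s t)
    (hH' : HasDerivWithinAt H (-(1 + fullQ P γ (θ t) (H t) (x t)) * H t ^ 2) s t) :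
    HasDerivWithinAt (fun u => corrector P (θ u) (H u) (x u).1)
      (H t * pressureFrac P (θ t) (H t) (x t).1
        + ((2 * P.V (scalarField P (θ t) (H t) (x t).1) - scalarField P (θ t) (H t) (x t).1
            * P.dV (scalarField P (θ t) (H t) (x t).1)) / (6 * H t)
          + scalarField P (θ t) (H t) (x t).1 * scalarVel (θ t) (H t) (x t).1
            * (fullQ P γ (θ t) (H t) (x t) - 2) / 6)) s t := by
  have hφ := hasDerivWithinAt_scalarField hH hx hθ hH'
  have hψ := hasDerivWithinAt_scalarVel hH hx hθ hH'
  have h := (hφ.mul hψ).div (hH'.const_mul 6) (by positivity : 6 * H t ≠ 0)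
  refine h.congr_deriv ?_
  simp only [pressureFrac, Pi.mul_apply]
  field_simp
  ring

end Curve

theorem virial_eq (P : HarmonicPotential) (φ : ℝ) : 2 * P.V φ - φ * P.dV φ
    = P.μ ^ 3 * P.b * P.f * (2 * (1 - Real.cos (φ / P.f)) - φ / P.f * Real.sin (φ / P.f)) := by
  have h1 := P.μ_pos.ne'
  have h2 := P.f_pos.ne'
  unfold HarmonicPotential.V HarmonicPotential.dV
  field_simp
  ring

/-- Every solution of the full system is a flow in the energy variables. -/
theorem exists_isFlow_of_full (P : HarmonicPotential) (γ : ℝ) : ∃ C : ℝ, 0 ≤ C ∧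
    ∀ (t₀ : ℝ) (x : ℝ → ℝ × ℝ × ℝ) (Φ H : ℝ → ℝ), IsFullSolution P γ t₀ x Φ H →
      ∃ w Z r : ℝ → ℝ, IsFlow γ C t₀ H H w Z r
        (fun t => energyState P (t * P.ω - Φ t) (H t) (x t)) := by
  obtain ⟨Q, hQ, hQ'⟩ := exists_fullQ_le P γ
  have hμ := P.μ_pos
  have hf := P.f_pos
  have hb := P.b_pos
  -- From `φ² ≤ 3 H² E / μ²` and `φ'² ≤ 6 H² E`: `a` bounds `|φ φ'|` by `a H² E`, and `d` bounds `(φ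
  -- / f)²` by `d H² E`. The summand `1` gives `d ≤ d²`, hence `|φ / f| ≤ d H`.
  set a := 3 / (2 * P.μ ^ 2) + 3 with ha
  set d := 1 + 3 / (P.μ ^ 2 * P.f ^ 2) with hd
  have ha0 : 0 < a := by positivity
  have hd1 : 1 ≤ d := by rw [hd]; exact le_add_of_nonneg_right (by positivity)
  have hd0 : 0 < d := by linarith
  refine ⟨a + (P.μ ^ 3 * P.b * P.f * 5 * d * d + a * (Q + 2)), by positivity, ?_⟩
  intro t₀ x Φ H hsol
  have hθ : ∀ t ∈ Ici t₀, HasDerivWithinAt (fun t => t * P.ω - Φ t)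
      (P.ω - fullPhaseRate P (t * P.ω - Φ t) (H t) (x t).1) (Ici t₀) t := fun t ht => by
    have h := ((hasDerivWithinAt_id t (Ici t₀)).mul_const P.ω).sub (hsol.deriv_Φ t ht)
    rw [one_mul] at h
    exact h
  have hbound : ∀ t ∈ Ici t₀,
      |scalarField P (t * P.ω - Φ t) (H t) (x t).1 * scalarVel (t * P.ω - Φ t) (H t) (x t).1|
        ≤ a * (H t ^ 2 * energyFrac P (t * P.ω - Φ t) (H t) (x t).1) ∧
      |scalarField P (t * P.ω - Φ t) (H t) (x t).1 / P.f| ^ 3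
        ≤ d * H t * (d * (H t ^ 2 * energyFrac P (t * P.ω - Φ t) (H t) (x t).1)) := by
    intro t ht
    have hph := hsol.physical t ht
    have hH := hph.1
    have h1 := P.le_V (scalarField P (t * P.ω - Φ t) (H t) (x t).1)
    have hE1 := fst_le_one_of_mem_region hph.mem_region
    have e1 : scalarVel (t * P.ω - Φ t) (H t) (x t).1 ^ 2 / 2
        + P.V (scalarField P (t * P.ω - Φ t) (H t) (x t).1)
        = 3 * (H t ^ 2 * energyFrac P (t * P.ω - Φ t) (H t) (x t).1) := by
      rw [energyFrac]; field_simp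
    have hE0 := energyFrac_nonneg (P := P) (t * P.ω - Φ t) (H t) (x t).1
    simp only [energyState] at hE1
    generalize energyFrac P (t * P.ω - Φ t) (H t) (x t).1 = E at *
    generalize scalarField P (t * P.ω - Φ t) (H t) (x t).1 = φ at *
    generalize scalarVel (t * P.ω - Φ t) (H t) (x t).1 = ψ at *
    have hφ : φ ^ 2 ≤ 3 * (H t ^ 2 * E) / P.μ ^ 2 := by
      rw [le_div_iff₀ (by positivity)]
      nlinarith [sq_nonneg ψ]
    have hψ : ψ ^ 2 ≤ 6 * (H t ^ 2 * E) := by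
      have := mul_nonneg (sq_nonneg P.μ) (sq_nonneg φ)
      linarith
    refine ⟨?_, ?_⟩
    · have : |φ * ψ| ≤ (φ ^ 2 + ψ ^ 2) / 2 := by
        rw [abs_le]; constructor <;> nlinarith [sq_nonneg (φ + ψ), sq_nonneg (φ - ψ)]
      refine this.trans ?_
      have : a * (H t ^ 2 * E) = 3 * (H t ^ 2 * E) / P.μ ^ 2 / 2 + 3 * (H t ^ 2 * E) := by
        rw [ha]; field_simp
      rw [this]
      linarith
    · have h2 : |φ / P.f| ^ 2 ≤ d * (H t ^ 2 * E) := by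
        rw [sq_abs, div_pow, div_le_iff₀ (by positivity)]
        have : d * (H t ^ 2 * E) * P.f ^ 2
            = H t ^ 2 * E * P.f ^ 2 + 3 * (H t ^ 2 * E) / P.μ ^ 2 := by
          rw [hd]; field_simp
        rw [this]
        have : 0 ≤ H t ^ 2 * E * P.f ^ 2 := by positivity
        linarith
      have h3 : |φ / P.f| ≤ d * H t := by
        refine (pow_le_pow_iff_left₀ (abs_nonneg _) (by positivity) two_ne_zero).1 ?_
        refine h2.trans ?_
        have g1 : d * (H t ^ 2 * E) ≤ d * (H t ^ 2 * 1) := by gcongr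
        have g2 : d * (H t ^ 2 * 1) ≤ d * d * H t ^ 2 := by
          have := mul_le_mul_of_nonneg_right hd1 (by positivity : 0 ≤ d * H t ^ 2)
          linarith
        calc _ ≤ _ := g1
          _ ≤ _ := g2
          _ = (d * H t) ^ 2 := by ring
      calc |φ / P.f| ^ 3 = |φ / P.f| * |φ / P.f| ^ 2 := by ring
        _ ≤ d * H t * (d * (H t ^ 2 * E)) := by gcongr
  refine ⟨fun t => pressureFrac P (t * P.ω - Φ t) (H t) (x t).1,
    fun t => corrector P (t * P.ω - Φ t) (H t) (x t).1, _,
    fun t ht => (hsol.physical t ht).mem_region, fun t ht => (hsol.physical t ht).1,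
    fun t ht => le_rfl, fun t ht => abs_pressureFrac_le _ _ _, fun t ht => ?_, fun t ht => ?_,
    fun t ht => hasDerivWithinAt_energyState (hsol.physical t ht).1.ne' (hsol.deriv_x t ht)
      (hθ t ht) (hsol.deriv_H t ht), fun t ht => ?_,
    fun t ht => hasDerivWithinAt_corrector (hsol.physical t ht).1.ne' (hsol.deriv_x t ht)
      (hθ t ht) (hsol.deriv_H t ht)⟩
  · have hH := (hsol.physical t ht).1
    have hE0 := energyFrac_nonneg (P := P) (t * P.ω - Φ t) (H t) (x t).1
    rw [corrector, abs_div, abs_of_pos (by positivity : 0 < 6 * H t), div_le_iff₀ (by positivity)]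
    refine (hbound t ht).1.trans ?_
    simp only [energyState]
    have g1 : 0 ≤ (5 * a + 6 * (P.μ ^ 3 * P.b * P.f * 5 * d * d + a * (Q + 2)))
        * (H t ^ 2 * energyFrac P (t * P.ω - Φ t) (H t) (x t).1) := by positivity
    linarith
  · have hH := (hsol.physical t ht).1
    have hE0 := energyFrac_nonneg (P := P) (t * P.ω - Φ t) (H t) (x t).1
    have hq := hQ' _ _ _ (hsol.physical t ht)
    have hq2 : |fullQ P γ (t * P.ω - Φ t) (H t) (x t) - 2| ≤ Q + 2 := by
      rw [abs_le] at *; constructor <;> linarith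
    obtain ⟨h1, h2⟩ := hbound t ht
    rw [virial_eq]
    have hv := abs_virial_le (scalarField P (t * P.ω - Φ t) (H t) (x t).1 / P.f)
    simp only [energyState]
    generalize energyFrac P (t * P.ω - Φ t) (H t) (x t).1 = E at *
    generalize scalarField P (t * P.ω - Φ t) (H t) (x t).1 = φ at *
    generalize scalarVel (t * P.ω - Φ t) (H t) (x t).1 = ψ at *
    generalize fullQ P γ (t * P.ω - Φ t) (H t) (x t) = q at *
    have g1 : |P.μ ^ 3 * P.b * P.f * (2 * (1 - Real.cos (φ / P.f)) - φ / P.f * Real.sin (φ / P.f))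
        / (6 * H t)| ≤ P.μ ^ 3 * P.b * P.f * 5 * d * d * (H t * H t * E) := by
      rw [abs_div, abs_mul, abs_of_pos (by positivity : 0 < P.μ ^ 3 * P.b * P.f),
        abs_of_pos (by positivity : 0 < 6 * H t), div_le_iff₀ (by positivity)]
      calc _ ≤ P.μ ^ 3 * P.b * P.f * (5 * (d * H t * (d * (H t ^ 2 * E)))) := by
            gcongr
            exact hv.trans (by gcongr)
        _ ≤ 6 * (P.μ ^ 3 * P.b * P.f * (5 * (d * H t * (d * (H t ^ 2 * E))))) := by
            have : 0 ≤ P.μ ^ 3 * P.b * P.f * (5 * (d * H t * (d * (H t ^ 2 * E)))) := by positivity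
            linarith
        _ = _ := by ring
    have g2 : |φ * ψ * (q - 2) / 6| ≤ a * (Q + 2) * (H t * H t * E) := by
      rw [abs_div, abs_mul, abs_of_pos (by norm_num : (0 : ℝ) < 6), div_le_iff₀ (by norm_num)]
      calc |φ * ψ| * |q - 2| ≤ a * (H t ^ 2 * E) * (Q + 2) := by gcongr
        _ ≤ 6 * (a * (H t ^ 2 * E) * (Q + 2)) := by
            have : 0 ≤ a * (H t ^ 2 * E) * (Q + 2) := by positivity
            linarith
        _ = _ := by ring
    refine (abs_add_le _ _).trans ((add_le_add g1 g2).trans ?_)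
    have g3 : 0 ≤ a * (H t * H t * E) := by positivity
    linarith
  · refine (hsol.deriv_H t ht).congr_deriv ?_
    rw [fullQ_eq (hsol.physical t ht).1.ne']
    ring

/-! ### Global existence for the full system -/

theorem le_left_of_hasDerivWithinAt_Icc {f f' : ℝ → ℝ} {s : ℝ}
    (hf : ∀ u ∈ Icc 0 s, HasDerivWithinAt f (f' u) (Icc 0 s) u)
    (h : ∀ u ∈ Icc 0 s, f' u ≤ 0) : ∀ u ∈ Icc 0 s, f u ≤ f 0 := by
  intro u hu
  refine antitoneOn_of_hasDerivWithinAt_nonpos (f' := f') (convex_Icc 0 s)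
    (fun v hv => (hf v hv).continuousWithinAt)
    (fun v hv => (hf v (interior_subset hv)).mono interior_subset)
    (fun v hv => h v (interior_subset hv)) ⟨le_rfl, hu.1.trans hu.2⟩ hu hu.1

/-- The full system as an autonomous equation for `(x, θ, H)`. -/
def fullVectorField (P : HarmonicPotential) (γ : ℝ) (y : (ℝ × ℝ × ℝ) × ℝ × ℝ) :
    (ℝ × ℝ × ℝ) × ℝ × ℝ :=
  (fullField P γ y.2.1 y.2.2 y.1, P.ω - fullPhaseRate P y.2.1 y.2.2 y.1.1,
    -(1 + fullQ P γ y.2.1 y.2.2 y.1) * y.2.2 ^ 2)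

/-- The states with `H > 0`. -/
def expanding : Set ((ℝ × ℝ × ℝ) × ℝ × ℝ) := {y | 0 < y.2.2}

theorem isOpen_expanding : IsOpen expanding := isOpen_lt continuous_const (by fun_prop)

theorem expanding.ne_zero {y : (ℝ × ℝ × ℝ) × ℝ × ℝ} (hy : y ∈ expanding) : y.2.2 ≠ 0 :=
  (show 0 < y.2.2 from hy).ne'

theorem expanding.sqrt_mul_ne_zero {y : (ℝ × ℝ × ℝ) × ℝ × ℝ} (hy : y ∈ expanding) :
    √6 * y.2.2 ≠ 0 := mul_ne_zero (by positivity) (expanding.ne_zero hy)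

theorem contDiffOn_fullQ (P : HarmonicPotential) (γ : ℝ) {n : WithTop ℕ∞} :
    ContDiffOn ℝ n (fun y : (ℝ × ℝ × ℝ) × ℝ × ℝ => fullQ P γ y.2.1 y.2.2 y.1) expanding := by
  unfold fullQ
  fun_prop (disch := exact fun y hy => pow_ne_zero 2 (expanding.ne_zero hy))

theorem contDiff_fullPhaseRate (P : HarmonicPotential) :
    ContDiff ℝ 1 (fun y : (ℝ × ℝ × ℝ) × ℝ × ℝ => fullPhaseRate P y.2.1 y.2.2 y.1.1) := by
  have := contDiff_sinc (n := 1)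
  unfold fullPhaseRate
  fun_prop

theorem contDiffOn_fullField (P : HarmonicPotential) (γ : ℝ) {n : WithTop ℕ∞} :
    ContDiffOn ℝ n (fun y : (ℝ × ℝ × ℝ) × ℝ × ℝ => fullField P γ y.2.1 y.2.2 y.1) expanding := by
  unfold fullField
  fun_prop (disch := first
    | exact fun y hy => expanding.ne_zero hy
    | exact fun y hy => expanding.sqrt_mul_ne_zero hy)

theorem contDiffOn_fullVectorField (P : HarmonicPotential) (γ : ℝ) :
    ContDiffOn ℝ 1 (fullVectorField P γ) expanding := by
  have h1 := contDiffOn_fullQ P γ (n := 1)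
  have h2 := (contDiff_fullPhaseRate P).contDiffOn (s := expanding)
  have h3 := contDiffOn_fullField P γ (n := 1)
  unfold fullVectorField
  exact h3.prodMk ((contDiffOn_const.sub h2).prodMk
    (((contDiffOn_const.add h1).neg).mul (by fun_prop)))

theorem hasDerivWithinAt_fullOmegaM {P : HarmonicPotential} {γ t : ℝ} {s : Set ℝ}
    {x : ℝ → ℝ × ℝ × ℝ} {θ H : ℝ → ℝ} (hH : H t ≠ 0)
    (hx : HasDerivWithinAt x (fullField P γ (θ t) (H t) (x t)) s t)
    (hθ : HasDerivWithinAt θ (P.ω - fullPhaseRate P (θ t) (H t) (x t).1) s t)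
    (hH' : HasDerivWithinAt H (-(1 + fullQ P γ (θ t) (H t) (x t)) * H t ^ 2) s t) :
    HasDerivWithinAt (fun u => fullOmegaM P (θ u) (H u) (x u))
      (H t * (2 + 2 * fullQ P γ (θ t) (H t) (x t) - 3 * γ)
        * fullOmegaM P (θ t) (H t) (x t)) s t := by
  have h := hasDerivWithinAt_energyState hH hx hθ hH'
  have h1 := (((hasDerivWithinAt_fst h).const_sub 1).sub
    ((hasDerivWithinAt_fst (hasDerivWithinAt_snd h)).pow 2)).sub
      (hasDerivWithinAt_snd (hasDerivWithinAt_snd h))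
  refine (h1.congr_deriv ?_).congr (fun u _ => fullOmegaM_eq _ _ _) (fullOmegaM_eq _ _ _)
  rw [fullQ_eq hH, fullOmegaM_eq]
  simp only [energyState, energyField, oscField, energyQ, Prod.smul_fst, Prod.smul_snd,
    Prod.fst_add, Prod.snd_add, smul_eq_mul, Nat.cast_ofNat, Nat.add_one_sub_one, pow_one]
  ring

/-- The relative growth rate of the amplitude of the scalar field. -/
def growthRate (P : HarmonicPotential) (γ : ℝ) (y : (ℝ × ℝ × ℝ) × ℝ × ℝ) : ℝ :=
  (1 + fullQ P γ y.2.1 y.2.2 y.1) * y.2.2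
    + (-(P.b * P.μ ^ 3 / (P.f * P.ω)) * Real.cos y.2.1 * Real.sin y.2.1
        * Real.sinc (√6 * y.2.2 * Real.sin y.2.1 * y.1.1 / (P.f * P.ω))
      + (P.ω ^ 2 - 2 * P.μ ^ 2) / P.ω * Real.sin y.2.1 * Real.cos y.2.1
      - 3 * y.2.2 * Real.cos y.2.1 ^ 2)

theorem fullField_fst_eq_growthRate {P : HarmonicPotential} {γ : ℝ} {y : (ℝ × ℝ × ℝ) × ℝ × ℝ}
    (hy : y ∈ expanding) :
    (fullField P γ y.2.1 y.2.2 y.1).1 = growthRate P γ y * y.1.1 := by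
  have hH := expanding.ne_zero hy
  have h1 := P.f_pos.ne'
  have h2 := P.ω_ne_zero
  have h6 : √(6 : ℝ) ≠ 0 := by positivity
  rw [fullField_fst hH, sin_eq_mul_sinc, growthRate]
  generalize Real.sinc (√6 * y.2.2 * Real.sin y.2.1 * y.1.1 / (P.f * P.ω)) = σ
  generalize fullQ P γ y.2.1 y.2.2 y.1 = Q
  field_simp

theorem continuousOn_growthRate (P : HarmonicPotential) (γ : ℝ) :
    ContinuousOn (growthRate P γ) expanding := by
  have h1 := (contDiffOn_fullQ P γ (n := 0)).continuousOn
  have h2 := (contDiff_sinc (n := 0)).continuous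
  unfold growthRate
  fun_prop

/-- `Ω`, `Ω_k` and `Ω_m` each solve a linear homogeneous equation with continuous coefficient, so
their signs persist. For `Ω` this uses `growthRate`, where sinc removes the division by `Ω`. -/
theorem SolvesOn.isPhysical {P : HarmonicPotential} {γ s : ℝ} {y : ℝ → (ℝ × ℝ × ℝ) × ℝ × ℝ}
    (hy : SolvesOn (fullVectorField P γ) expanding s y)
    (h0 : IsPhysical P (y 0).2.1 (y 0).2.2 (y 0).1) :
    ∀ t ∈ Icc 0 s, IsPhysical P (y t).2.1 (y t).2.2 (y t).1 := by
  intro t ht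
  have hyc : ContinuousOn y (Icc 0 s) := fun u hu => (hy u hu).2.continuousWithinAt
  have hmaps : MapsTo y (Icc 0 s) expanding := fun u hu => (hy u hu).1
  have hqc : ContinuousOn (fun u => fullQ P γ (y u).2.1 (y u).2.2 (y u).1) (Icc 0 s) :=
    (contDiffOn_fullQ P γ (n := 0)).continuousOn.comp hyc hmaps
  have hHc : ContinuousOn (fun u => (y u).2.2) (Icc 0 s) := by fun_prop
  have hSc : ContinuousOn (fun u => (y u).1.2.1) (Icc 0 s) := by fun_prop
  refine ⟨(hy t ht).1, ?_, ?_, ?_⟩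
  · exact nonneg_of_linear (f := fun u => (y u).1.1) (a := fun u => growthRate P γ (y u))
      (t₀ := 0) (t₁ := s) ((continuousOn_growthRate P γ).comp hyc hmaps)
      (fun u hu => (hasDerivWithinAt_fst (hasDerivWithinAt_fst (hy u hu).2)).congr_deriv
        (fullField_fst_eq_growthRate (hy u hu).1)) h0.2.1 t ht
  · exact nonneg_of_linear (f := fun u => (y u).1.2.2)
      (a := fun u => 2 * (y u).2.2 * (fullQ P γ (y u).2.1 (y u).2.2 (y u).1 - (y u).1.2.1))
      (t₀ := 0) (t₁ := s) (by fun_prop)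
      (fun u hu => (hasDerivWithinAt_snd (hasDerivWithinAt_snd
        (hasDerivWithinAt_fst (hy u hu).2))).congr_deriv
          (fullField_snd_snd (expanding.ne_zero (hy u hu).1) _)) h0.2.2.1 t ht
  · exact nonneg_of_linear (f := fun u => fullOmegaM P (y u).2.1 (y u).2.2 (y u).1)
      (a := fun u => (y u).2.2 * (2 + 2 * fullQ P γ (y u).2.1 (y u).2.2 (y u).1 - 3 * γ))
      (t₀ := 0) (t₁ := s) (by fun_prop)
      (fun u hu => hasDerivWithinAt_fullOmegaM (x := fun u => (y u).1) (θ := fun u => (y u).2.1)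
        (H := fun u => (y u).2.2) (expanding.ne_zero (hy u hu).1)
        (hasDerivWithinAt_fst (hy u hu).2)
        (hasDerivWithinAt_fst (hasDerivWithinAt_snd (hy u hu).2))
        (hasDerivWithinAt_snd (hasDerivWithinAt_snd (hy u hu).2))) h0.2.2.2 t ht

theorem abs_fullPhaseRate_le (P : HarmonicPotential) {θ H Ω H₀ : ℝ} (hH : 0 < H) (h : H ≤ H₀) :
    |fullPhaseRate P θ H Ω| ≤ |P.b * P.μ ^ 3 / (P.f * P.ω)|
      + |(P.ω ^ 2 - 2 * P.μ ^ 2) / P.ω| + 3 * H₀ := by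
  have h1 := Real.abs_sin_le_one θ
  have h2 := Real.abs_cos_le_one θ
  have h3 : |Real.sinc (√6 * H * Real.sin θ * Ω / (P.f * P.ω))| ≤ 1 := Real.abs_sinc_le_one _
  have h4 : Real.sin θ ^ 2 ≤ 1 := Real.sin_sq_le_one θ
  rw [fullPhaseRate]
  refine (abs_sub _ _).trans (add_le_add ((abs_add_le _ _).trans (add_le_add ?_ ?_)) ?_)
  · rw [abs_mul, abs_mul, abs_neg, abs_of_nonneg (sq_nonneg (Real.sin θ))]
    exact mul_le_of_le_one_right (by positivity) h3 |>.trans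
      (mul_le_of_le_one_right (abs_nonneg _) h4)
  · rw [abs_mul, abs_of_nonneg (sq_nonneg (Real.sin θ))]
    exact mul_le_of_le_one_right (abs_nonneg _) h4
  · rw [abs_mul, abs_mul, abs_mul, abs_of_pos hH, abs_of_pos (by norm_num : (0 : ℝ) < 3)]
    calc 3 * |Real.cos θ| * H * |Real.sin θ| ≤ 3 * 1 * H₀ * 1 := by gcongr; linarith
      _ = 3 * H₀ := by ring

theorem IsPhysical.fst_le {P : HarmonicPotential} {θ H : ℝ} {x : ℝ × ℝ × ℝ}
    (h : IsPhysical P θ H x) : x.1 ≤ 1 + P.ω ^ 2 / (2 * P.μ ^ 2) := by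
  have h1 := le_energyFrac (P := P) (θ := θ) (Ω := x.1) h.1.ne'
  have h2 := h1.trans (fst_le_one_of_mem_region h.mem_region)
  have h3 := P.μ_pos
  have h4 := P.ω_ne_zero
  have h5 : x.1 ^ 2 ≤ P.ω ^ 2 / (2 * P.μ ^ 2) := by
    have := mul_le_mul_of_nonneg_left h2 (by positivity : 0 ≤ P.ω ^ 2 / (2 * P.μ ^ 2))
    rw [mul_one] at this
    rwa [← mul_assoc, show P.ω ^ 2 / (2 * P.μ ^ 2) * (2 * P.μ ^ 2 / P.ω ^ 2) = 1 by field_simp,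
      one_mul] at this
  nlinarith [sq_nonneg (x.1 - 1)]

theorem exists_fullSolution (P : HarmonicPotential) {γ : ℝ} (hγ : 0 < γ) {t₀ Φ₀ H₀ : ℝ}
    {x₀ : ℝ × ℝ × ℝ} (h0 : IsPhysical P (t₀ * P.ω - Φ₀) H₀ x₀) :
    ∃ (x : ℝ → ℝ × ℝ × ℝ) (Φ H : ℝ → ℝ), IsFullSolution P γ t₀ x Φ H ∧
      x t₀ = x₀ ∧ Φ t₀ = Φ₀ ∧ H t₀ = H₀ := by
  -- With `θ = t ω - Φ` in place of `Φ` the system is autonomous.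
  set θ₀ := t₀ * P.ω - Φ₀ with hθ₀
  have hH₀ := h0.1
  obtain ⟨Q, hQ0, hQ⟩ := exists_fullQ_le P γ
  set B := |P.ω| + (|P.b * P.μ ^ 3 / (P.f * P.ω)|
      + |(P.ω ^ 2 - 2 * P.μ ^ 2) / P.ω| + 3 * H₀) with hB
  have hB0 : 0 ≤ B := by positivity
  obtain ⟨y, hy0, hsol, hder⟩ := exists_global_solution isOpen_expanding
    (contDiffOn_fullVectorField P γ) (y₀ := (x₀, θ₀, H₀)) hH₀ (by
    intro T hT
    have hη : 0 < 1 / H₀ + (1 + Q) * T := by positivity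
    -- `Ω` is bounded by the energy, `θ` moves at speed at most `B`, and `(1 / H)' = 1 + q ≤ 1 + Q`
    -- bounds `H` away from `0` up to time `T`.
    refine ⟨(Icc 0 (1 + P.ω ^ 2 / (2 * P.μ ^ 2)) ×ˢ (Icc (-1) 1 ×ˢ Icc 0 1)) ×ˢ
        (Icc (θ₀ - B * T) (θ₀ + B * T) ×ˢ Icc (1 / (1 / H₀ + (1 + Q) * T)) H₀), ?_,
      (isCompact_Icc.prod (isCompact_Icc.prod isCompact_Icc)).prod
        (isCompact_Icc.prod isCompact_Icc), ?_⟩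
    · rintro z ⟨-, -, hz⟩
      exact (by positivity : 0 < 1 / (1 / H₀ + (1 + Q) * T)).trans_le hz.1
    · intro s hs y hy0 hy
      have hph := hy.isPhysical (by rw [hy0]; exact h0)
      have hHu : ∀ u ∈ Icc 0 s, (y u).2.2 ≤ H₀ := by
        have := le_left_of_hasDerivWithinAt_Icc (f := fun u => (y u).2.2)
          (fun u hu => hasDerivWithinAt_snd (hasDerivWithinAt_snd (hy u hu).2)) (fun u hu => by
            have := mul_nonneg ((hph u hu).one_add_fullQ_nonneg hγ) (sq_nonneg (y u).2.2)
            simp only [fullVectorField]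
            linarith)
        simpa [hy0] using this
      have hHl : 1 / (y s).2.2 - (1 + Q) * s ≤ 1 / H₀ := by
        have := le_left_of_hasDerivWithinAt_Icc (f := fun u => 1 / (y u).2.2 - (1 + Q) * u)
          (fun u hu => ((hasDerivWithinAt_const u _ (1 : ℝ)).div
            (hasDerivWithinAt_snd (hasDerivWithinAt_snd (hy u hu).2))
              (expanding.ne_zero (hy u hu).1)).sub
              ((hasDerivWithinAt_id u _).const_mul (1 + Q))) (fun u hu => by
            have h1 := (abs_le.1 (hQ _ _ _ (hph u hu))).2
            have h2 := expanding.ne_zero (hy u hu).1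
            simp only [fullVectorField]
            rw [zero_mul, zero_sub, one_mul, neg_mul, neg_neg, mul_div_cancel_right₀ _
              (pow_ne_zero 2 h2)]
            linarith) s ⟨hs.1, le_rfl⟩
        simpa [hy0] using this
      have hθr : ∀ u ∈ Icc 0 s,
          |P.ω - fullPhaseRate P (y u).2.1 (y u).2.2 (y u).1.1| ≤ B := fun u hu =>
        (abs_sub _ _).trans (add_le_add le_rfl
          (abs_fullPhaseRate_le P (hph u hu).1 (hHu u hu)))
      have hθu := le_left_of_hasDerivWithinAt_Icc (f := fun u => (y u).2.1 - B * u)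
        (fun u hu => (hasDerivWithinAt_fst (hasDerivWithinAt_snd (hy u hu).2)).sub
          ((hasDerivWithinAt_id u _).const_mul B)) (fun u hu => by
          have := (abs_le.1 (hθr u hu)).2
          simp only [fullVectorField]
          linarith) s ⟨hs.1, le_rfl⟩
      have hθl := le_left_of_hasDerivWithinAt_Icc (f := fun u => -(y u).2.1 - B * u)
        (fun u hu => (hasDerivWithinAt_fst (hasDerivWithinAt_snd (hy u hu).2)).neg.sub
          ((hasDerivWithinAt_id u _).const_mul B)) (fun u hu => by
          have := (abs_le.1 (hθr u hu)).1
          simp only [fullVectorField]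
          linarith) s ⟨hs.1, le_rfl⟩
      simp only [hy0, mul_zero, sub_zero] at hθu hθl
      have hBs : B * s ≤ B * T := mul_le_mul_of_nonneg_left hs.2 hB0
      have hps := hph s ⟨hs.1, le_rfl⟩
      obtain ⟨r1, r2, r3⟩ := hps.mem_region
      simp only [energyState] at r1 r2 r3
      have hQs : (1 + Q) * s ≤ (1 + Q) * T := mul_le_mul_of_nonneg_left hs.2 (by positivity)
      refine ⟨⟨⟨hps.2.1, hps.fst_le⟩, abs_le.1 (abs_le_one_iff_mul_self_le_one.2 (by nlinarith)),
        r2, by nlinarith⟩, ⟨by linarith, by linarith⟩, ?_, hHu s ⟨hs.1, le_rfl⟩⟩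
      rw [div_le_iff₀ hη]
      have h1 : 1 / (y s).2.2 ≤ 1 / H₀ + (1 + Q) * T := by linarith
      rw [div_le_iff₀ hps.1] at h1
      linarith)
  have hsub : ∀ t ∈ Ici t₀, t - t₀ ∈ Ici (0 : ℝ) := fun t ht => mem_Ici.2 (sub_nonneg.2 ht)
  have hphys : ∀ t ∈ Ici t₀, IsPhysical P (y (t - t₀)).2.1 (y (t - t₀)).2.2 (y (t - t₀)).1 :=
    fun t ht => (hsol _ (hsub t ht)).isPhysical (by rw [hy0]; exact h0) _ ⟨hsub t ht, le_rfl⟩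
  have hd : ∀ t ∈ Ici t₀, HasDerivWithinAt (fun t => y (t - t₀))
      (fullVectorField P γ (y (t - t₀))) (Ici t₀) t := fun t ht => by
    have := (hder _ (hsub t ht)).scomp t ((hasDerivWithinAt_id t (Ici t₀)).sub_const t₀) hsub
    rwa [one_smul] at this
  have hθ : ∀ t, t * P.ω - (t * P.ω - (y (t - t₀)).2.1) = (y (t - t₀)).2.1 := fun t => by ring
  refine ⟨fun t => (y (t - t₀)).1, fun t => t * P.ω - (y (t - t₀)).2.1,
    fun t => (y (t - t₀)).2.2, ⟨fun t ht => ?_, fun t ht => ?_, fun t ht => ?_, fun t ht => ?_⟩,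
    ?_, ?_, ?_⟩
  · simp only [hθ]; exact hphys t ht
  · simp only [hθ]; exact hasDerivWithinAt_fst (hd t ht)
  · simp only [hθ]
    have := ((hasDerivWithinAt_id t (Ici t₀)).mul_const P.ω).sub
      (hasDerivWithinAt_fst (hasDerivWithinAt_snd (hd t ht)))
    refine this.congr_deriv ?_
    simp only [fullVectorField]; ring
  · simp only [hθ]; exact hasDerivWithinAt_snd (hasDerivWithinAt_snd (hd t ht))
  · simp [hy0]
  · simp [hy0, hθ₀]
  · simp [hy0]

/-! ### Attractors of the full system -/

theorem IsFullSolution.H_le {P : HarmonicPotential} {γ : ℝ} (hγ : 0 < γ) {t₀ : ℝ}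
    {x : ℝ → ℝ × ℝ × ℝ} {Φ H : ℝ → ℝ} (h : IsFullSolution P γ t₀ x Φ H) :
    ∀ t ∈ Ici t₀, H t ≤ H t₀ := by
  intro t ht
  refine le_of_hasDerivWithinAt_nonpos le_rfl ht (fun u hu => h.deriv_H u hu.1) fun u hu => ?_
  have := mul_nonneg ((h.physical u hu.1).one_add_fullQ_nonneg hγ) (sq_nonneg (H u))
  linarith

theorem IsFullSolution.tendsto_energyState {P : HarmonicPotential} {γ t₀ : ℝ}
    {x : ℝ → ℝ × ℝ × ℝ} {Φ H : ℝ → ℝ} (h : IsFullSolution P γ t₀ x Φ H) {p : ℝ × ℝ × ℝ}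
    (hx : Tendsto x atTop (𝓝 p)) (hH : Tendsto H atTop (𝓝 0)) :
    Tendsto (fun t => energyState P (t * P.ω - Φ t) (H t) (x t)) atTop (𝓝 (toEnergy p)) := by
  have h1 : Tendsto (fun t => (x t).1) atTop (𝓝 p.1) := hx.fst_nhds
  have h2 : Tendsto (fun t => (x t).2) atTop (𝓝 p.2) := hx.snd_nhds
  refine Tendsto.prodMk_nhds ?_ h2
  have h3 : Tendsto (fun t => energyFrac P (t * P.ω - Φ t) (H t) (x t).1 - (x t).1 ^ 2) atTop
      (𝓝 0) := by
    refine squeeze_zero_norm' (a := fun t =>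
      P.μ ^ 3 * P.b * P.f * (√6 / (|P.ω| * P.f)) ^ 3 * (H t * |(x t).1| ^ 3)) ?_ ?_
    · filter_upwards [Ici_mem_atTop t₀] with t ht
      exact abs_energyFrac_sub_le (h.physical t ht).1
    · simpa using (hH.mul (h1.abs.pow 3)).const_mul
        (P.μ ^ 3 * P.b * P.f * (√6 / (|P.ω| * P.f)) ^ 3)
  simpa using h3.add (h1.pow 2)

theorem isFullAttractor_iff (P : HarmonicPotential) {γ : ℝ} (h0 : 0 < γ) (h2 : γ ≤ 2)
    (p : ℝ × ℝ × ℝ) : IsFullAttractor P γ p ↔ IsSelected γ p := by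
  obtain ⟨C, hC, hflow⟩ := exists_isFlow_of_full P γ
  constructor
  · rintro ⟨hp, hp1, h⟩
    obtain ⟨W, hW, η, hη, hWs⟩ := h univ univ_mem
    obtain ⟨x₀, hx₀W, -, hx1, hxk, hxM⟩ := exists_interior_near hp hW
    have hx1' := hx1 hp1
    -- Positivity of the averaged matter fraction carries over because `E ≤ Ω²`.
    have hM0 : 0 < fullOmegaM P (0 * P.ω - 0) (η / 2) x₀ := by
      have := energyFrac_le (P := P) (θ := 0 * P.ω - 0) (H := η / 2) (Ω := x₀.1) (by positivity)
      rw [fullOmegaM_eq]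
      simp only [omegaM] at hxM
      linarith
    obtain ⟨⟨x, Φ, H, hsol, e1, e2, e3⟩, hall⟩ := hWs x₀ hx₀W 0 0 (η / 2) (by linarith)
      ⟨by positivity, hx1'.le, hxk.le, hM0.le⟩
    obtain ⟨-, hlim, hH⟩ := hall x Φ H hsol e1 e2 e3
    obtain ⟨w, Z, r, hfl⟩ := hflow 0 x Φ H hsol
    have hlimX := hsol.tendsto_energyState hlim hH
    have hE0 : 0 < energyFrac P (0 * P.ω - 0) (η / 2) x₀.1 := by
      have := le_energyFrac (P := P) (θ := 0 * P.ω - 0) (H := η / 2) (Ω := x₀.1) (by positivity)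
      refine lt_of_lt_of_le ?_ this
      have := P.μ_pos
      have := P.ω_ne_zero
      positivity
    rw [fullOmegaM_eq] at hM0
    obtain ⟨c1, c2, c3, c4⟩ := hfl.limit_conditions hC hlimX hH
      (hfl.fst_pos (b := H 0) (hsol.H_le h0) (by simpa only [e1, e2, e3, energyState] using hE0))
      (hfl.snd_snd_pos (b := H 0) (hsol.H_le h0)
        (by simpa only [e1, e2, e3, energyState] using hxk))
      (hfl.matter_pos (b := H 0) (hsol.H_le h0)
        (by simpa only [e1, e2, e3, energyState] using hM0))
    exact (isSelected_of_limit_conditions (hfl.limit_mem_region hlimX) c1 c2 c3 c4).of_toEnergy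
  · intro hp
    have hp1 := hp.fst_eq_zero
    obtain ⟨L, ρ, hL⟩ := exists_isStrictLyapunov h0 h2 hp
    refine ⟨toEnergy_mem_region.1 (by rw [toEnergy_eq_self hp1]; exact hL.mem), hp1.ge,
      fun U hU => ?_⟩
    have ha : 0 < 2 * P.μ ^ 2 / P.ω ^ 2 := by
      have := P.μ_pos
      have := P.ω_ne_zero
      positivity
    obtain ⟨ε, hε, hεU⟩ := exists_ball_toEnergy hp1 hU ha
    obtain ⟨δ₁, hδ₁, η₁, hη₁, hst⟩ := hL.stable hC hε
    obtain ⟨δ₂, hδ₂, η₂, hη₂, hte⟩ := hL.tendsto hC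
    have hδ : 0 < min δ₁ δ₂ := lt_min hδ₁ hδ₂
    refine ⟨toEnergy ⁻¹' Metric.ball p (min δ₁ δ₂), ?_, min η₁ η₂, lt_min hη₁ hη₂, ?_⟩
    · apply continuous_toEnergy.continuousAt
      rw [toEnergy_eq_self hp1]
      exact Metric.ball_mem_nhds p hδ
    · intro x₀ hx₀W t₀ Φ₀ H₀ hH₀ hphys
      refine ⟨exists_fullSolution P h0 hphys, ?_⟩
      intro x Φ H hsol e1 e2 e3
      obtain ⟨w, Z, r, hfl⟩ := hflow t₀ x Φ H hsol
      have hball : energyState P (t₀ * P.ω - Φ t₀) (H t₀) (x t₀) ∈ Metric.ball p (min δ₁ δ₂) := by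
        rw [e1, e2, e3]
        have hb : dist (toEnergy x₀) p < min δ₁ δ₂ := hx₀W
        rw [Prod.dist_eq, max_lt_iff] at hb
        rw [Metric.mem_ball, Prod.dist_eq, max_lt_iff]
        refine ⟨lt_of_le_of_lt ?_ hb.1, hb.2⟩
        simp only [hp1, Real.dist_eq, sub_zero, energyState, toEnergy]
        rw [abs_of_nonneg (energyFrac_nonneg _ _ _), abs_of_nonneg (sq_nonneg _)]
        exact energyFrac_le hphys.1.ne'
      have hlow : ∀ t ∈ Ici t₀, 2 * P.μ ^ 2 / P.ω ^ 2 * (x t).1 ^ 2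
          ≤ (energyState P (t * P.ω - Φ t) (H t) (x t)).1 := fun t ht =>
        le_energyFrac (hsol.physical t ht).1.ne'
      have hlim := hte _ _ _ _ _ _ _ hfl (Metric.ball_subset_ball (min_le_right _ _) hball)
        (by rw [e3]; exact hH₀.trans_le (min_le_right _ _))
      refine ⟨fun t ht => ?_, tendsto_of_toEnergy hp1 ha hlim.1 (t₀ := t₀) (fun _ _ => rfl) hlow,
        hlim.2⟩
      exact hεU (x t) _ (hst _ _ _ _ _ _ _ hfl
        (Metric.ball_subset_ball (min_le_left _ _) hball)
        (by rw [e3]; exact hH₀.trans_le (min_le_left _ _)) t ht) rfl (hlow t ht)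

/-! ## Line elements -/

theorem eq_zero_of_hasDerivWithinAt_zero {f : ℝ → ℝ}
    (hf : ∀ t ∈ Ici (0 : ℝ), HasDerivWithinAt f 0 (Ici 0) t) : ∀ t, 0 ≤ t → f t = f 0 :=
  fun _ ht => le_antisymm
    (le_of_hasDerivWithinAt_nonpos le_rfl ht (fun u hu => hf u hu.1) fun _ _ => le_rfl)
    (le_of_hasDerivWithinAt_nonneg le_rfl ht (fun u hu => hf u hu.1) fun _ _ => le_rfl)

/-- `1 / H - c t` is constant. -/
theorem hubble_iff {c : ℝ} (hc : 0 < c) (H : ℝ → ℝ) :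
    ((∀ t ∈ Ici (0 : ℝ), 0 < H t) ∧
      ∀ t ∈ Ici (0 : ℝ), HasDerivWithinAt H (-c * H t ^ 2) (Ici 0) t) ↔
    0 < H 0 ∧ ∀ t, 0 ≤ t → H t = H 0 / (1 + c * H 0 * t) := by
  constructor
  · rintro ⟨hpos, hd⟩
    have h0 := hpos 0 (mem_Ici.2 le_rfl)
    refine ⟨h0, fun t ht => ?_⟩
    have := eq_zero_of_hasDerivWithinAt_zero (f := fun t => 1 / H t - c * t) (fun u hu => by
      have h := ((hasDerivWithinAt_const u (Ici 0) (1 : ℝ)).div (hd u hu) (hpos u hu).ne').sub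
        ((hasDerivWithinAt_id u (Ici 0)).const_mul c)
      refine h.congr_deriv ?_
      have := (hpos u hu).ne'
      field_simp
      ring) t ht
    have ht0 := (hpos t ht).ne'
    have h1 : 0 < 1 + c * H 0 * t := by positivity
    simp only [mul_zero, sub_zero] at this
    rw [eq_div_iff h1.ne']
    field_simp at this
    linarith
  · rintro ⟨h0, hH⟩
    have hu : ∀ t ∈ Ici (0 : ℝ), 0 < 1 + c * H 0 * t := fun t ht => by
      have : 0 ≤ t := ht
      positivity
    refine ⟨fun t ht => by rw [hH t ht]; exact div_pos h0 (hu t ht), fun t ht => ?_⟩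
    have h := (hasDerivWithinAt_const t (Ici 0) (H 0)).div
      (((hasDerivWithinAt_id t (Ici 0)).const_mul (c * H 0)).const_add 1) (hu t ht).ne'
    refine (h.congr_deriv ?_).congr (fun s hs => hH s hs) (hH t ht)
    rw [hH t ht, id]
    field_simp
    ring

/-- `A` times the power `-(a / c)` of the affine function is constant. -/
theorem scaleFactor_iff {c h a : ℝ} (hc : 0 < c) (hh : 0 < h) {H : ℝ → ℝ}
    (hH : ∀ t, 0 ≤ t → H t = h / (1 + c * h * t)) (A : ℝ → ℝ) :
    ((∀ t ∈ Ici (0 : ℝ), 0 < A t) ∧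
      ∀ t ∈ Ici (0 : ℝ), HasDerivWithinAt A (a * H t * A t) (Ici 0) t) ↔
    0 < A 0 ∧ ∀ t, 0 ≤ t → A t = A 0 * (1 + c * h * t) ^ (a / c) := by
  have hu : ∀ t ∈ Ici (0 : ℝ), 0 < 1 + c * h * t := fun t ht => by
    have : 0 ≤ t := ht
    positivity
  have hpow : ∀ e : ℝ, ∀ t ∈ Ici (0 : ℝ), HasDerivWithinAt (fun t => (1 + c * h * t) ^ e)
      (e * c * H t * (1 + c * h * t) ^ e) (Ici 0) t := fun e t ht => by
    have h1 := (((hasDerivWithinAt_id t (Ici 0)).const_mul (c * h)).const_add 1).rpow_const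
      (p := e) (Or.inl (hu t ht).ne')
    refine h1.congr_deriv ?_
    rw [hH t ht, id, Real.rpow_sub_one (hu t ht).ne']
    ring
  constructor
  · rintro ⟨hpos, hd⟩
    refine ⟨hpos 0 (mem_Ici.2 le_rfl), fun t ht => ?_⟩
    have := eq_zero_of_hasDerivWithinAt_zero (f := fun t => A t * (1 + c * h * t) ^ (-(a / c)))
      (fun u hu' => by
        refine ((hd u hu').mul (hpow (-(a / c)) u hu')).congr_deriv ?_
        field_simp
        ring) t ht
    simp only [mul_zero, add_zero, Real.one_rpow, mul_one] at this
    rw [← this, mul_assoc, ← Real.rpow_add (hu t ht), neg_add_cancel, Real.rpow_zero, mul_one]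
  · rintro ⟨h0, hA⟩
    refine ⟨fun t ht => by rw [hA t ht]; exact mul_pos h0 (Real.rpow_pos_of_pos (hu t ht) _),
      fun t ht => ?_⟩
    refine (((hpow (a / c) t ht).const_mul (A 0)).congr_deriv ?_).congr (fun s hs => hA s hs)
      (hA t ht)
    rw [hA t ht]
    field_simp

theorem isLineElementOf_iff {γ c : ℝ} {p : ℝ × ℝ × ℝ} (hc : 0 < c) (hq : 1 + averagedQ γ p = c)
    (H A B : ℝ → ℝ) : IsLineElementOf γ p H A B ↔
      (0 < H 0 ∧ 0 < A 0 ∧ 0 < B 0 ∧ ∀ t, 0 ≤ t →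
        H t = H 0 / (1 + c * H 0 * t) ∧
        A t = A 0 * (1 + c * H 0 * t) ^ ((1 - 2 * p.2.1) / c) ∧
        B t = B 0 * (1 + c * H 0 * t) ^ ((1 + p.2.1) / c)) ∧
      (p.2.2 ≠ 0 → ∀ t ∈ Ici (0 : ℝ), 1 / B t ^ 2 = 3 * p.2.2 * H t ^ 2) := by
  have eA : ∀ t, (H t - 2 * (p.2.1 * H t)) * A t = (1 - 2 * p.2.1) * H t * A t := fun t => by ring
  have eB : ∀ t, (H t + p.2.1 * H t) * B t = (1 + p.2.1) * H t * B t := fun t => by ring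
  constructor
  · rintro ⟨h1, h2, h3, h4, h5, h6, h7⟩
    rw [hq] at h4
    simp only [eA] at h5
    simp only [eB] at h6
    obtain ⟨g1, g2⟩ := (hubble_iff hc H).1 ⟨h1, h4⟩
    obtain ⟨g3, g4⟩ := (scaleFactor_iff hc g1 g2 A).1 ⟨h2, h5⟩
    obtain ⟨g5, g6⟩ := (scaleFactor_iff hc g1 g2 B).1 ⟨h3, h6⟩
    exact ⟨⟨g1, g3, g5, fun t ht => ⟨g2 t ht, g4 t ht, g6 t ht⟩⟩, h7⟩
  · rintro ⟨⟨g1, g3, g5, g⟩, h7⟩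
    have g2 := fun t ht => (g t ht).1
    obtain ⟨h1, h4⟩ := (hubble_iff hc H).2 ⟨g1, g2⟩
    obtain ⟨h2, h5⟩ := (scaleFactor_iff hc g1 g2 A).2 ⟨g3, fun t ht => (g t ht).2.1⟩
    obtain ⟨h3, h6⟩ := (scaleFactor_iff hc g1 g2 B).2 ⟨g5, fun t ht => (g t ht).2.2⟩
    simp only [← eA] at h5
    simp only [← eB] at h6
    rw [← hq] at h4
    exact ⟨h1, h2, h3, h4, h5, h6, h7⟩

theorem averagedQ_pointF0 (γ : ℝ) : averagedQ γ pointF0 = 3 * γ / 2 - 1 := by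
  simp only [averagedQ, pointF0]; ring

theorem averagedQ_pointMC (γ : ℝ) : averagedQ γ (pointMC γ) = 3 * γ / 2 - 1 := by
  simp only [averagedQ, pointMC]; ring

theorem averagedQ_pointD (γ : ℝ) : averagedQ γ pointD = 1 / 2 := by
  simp only [averagedQ, pointD]; ring

theorem isLineElementOf_pointF0 {γ : ℝ} (hγ : 0 < γ) (H A B : ℝ → ℝ) :
    IsLineElementOf γ pointF0 H A B ↔
      0 < H 0 ∧ 0 < A 0 ∧ 0 < B 0 ∧ ∀ t : ℝ, 0 ≤ t →
        H t = 2 * H 0 / (3 * γ * H 0 * t + 2) ∧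
        A t = A 0 * (3 * γ * H 0 * t / 2 + 1) ^ (2 / (3 * γ)) ∧
        B t = B 0 * (3 * γ * H 0 * t / 2 + 1) ^ (2 / (3 * γ)) := by
  rw [isLineElementOf_iff (c := 3 * γ / 2) (by positivity) (by rw [averagedQ_pointF0]; ring)]
  have e1 : ∀ t, 1 + 3 * γ / 2 * H 0 * t = 3 * γ * H 0 * t / 2 + 1 := fun t => by ring
  have e2 : ∀ t, H 0 / (3 * γ * H 0 * t / 2 + 1) = 2 * H 0 / (3 * γ * H 0 * t + 2) := fun t => by
    rw [← mul_div_mul_left _ _ (two_ne_zero (α := ℝ))]; congr 1; ring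
  have e3 : 1 / (3 * γ / 2) = 2 / (3 * γ) := by rw [one_div_div]
  simp only [pointF0, mul_zero, sub_zero, add_zero, e1, e2, e3, ne_eq, not_true_eq_false,
    false_imp_iff, and_true]

theorem curvature_pointMC_pos {γ : ℝ} (h1 : 2 / 3 < γ) (h2 : γ < 1) :
    0 < -(9 * γ ^ 2 / 4) + 6 * γ - 3 := by
  have := mul_pos (show 0 < 3 * γ / 2 - 1 by linarith) (show 0 < 3 - 3 * γ / 2 by linarith)
  linarith

theorem isLineElementOf_pointMC {γ : ℝ} (h1 : 2 / 3 < γ) (h2 : γ < 1) (H A B : ℝ → ℝ) :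
    IsLineElementOf γ (pointMC γ) H A B ↔
      0 < H 0 ∧ 0 < A 0 ∧ 0 < B 0 ∧
      1 / B 0 ^ 2 = 3 * (-(9 * γ ^ 2 / 4) + 6 * γ - 3) * H 0 ^ 2 ∧ ∀ t : ℝ, 0 ≤ t →
        H t = 2 * H 0 / (3 * γ * H 0 * t + 2) ∧
        A t = A 0 * (3 * γ * H 0 * t / 2 + 1) ^ (2 * (1 - γ) / γ) ∧
        B t = B 0 * (3 * γ * H 0 * t / 2 + 1) := by
  have hγ : 0 < γ := by linarith
  have hk := curvature_pointMC_pos h1 h2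
  rw [isLineElementOf_iff (c := 3 * γ / 2) (by positivity) (by rw [averagedQ_pointMC]; ring)]
  have e1 : ∀ t, 1 + 3 * γ / 2 * H 0 * t = 3 * γ * H 0 * t / 2 + 1 := fun t => by ring
  have e2 : ∀ t, H 0 / (3 * γ * H 0 * t / 2 + 1) = 2 * H 0 / (3 * γ * H 0 * t + 2) := fun t => by
    rw [← mul_div_mul_left _ _ (two_ne_zero (α := ℝ))]; congr 1; ring
  have e3 : (1 - 2 * (3 * γ / 2 - 1)) / (3 * γ / 2) = 2 * (1 - γ) / γ := by field_simp; ring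
  have e4 : (1 + (3 * γ / 2 - 1)) / (3 * γ / 2) = 1 := by field_simp; ring
  simp only [pointMC, e1, e2, e3, e4, Real.rpow_one]
  generalize -(9 * γ ^ 2 / 4) + 6 * γ - 3 = k at *
  constructor
  · rintro ⟨⟨g1, g2, g3, g⟩, hg⟩
    exact ⟨g1, g2, g3, hg hk.ne' 0 (mem_Ici.2 le_rfl), g⟩
  · rintro ⟨g1, g2, g3, hg, g⟩
    refine ⟨⟨g1, g2, g3, g⟩, fun _ t ht => ?_⟩
    have hu : 0 < 3 * γ * H 0 * t / 2 + 1 := by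
      have : 0 ≤ t := ht
      positivity
    -- `B` and `1 / H` are multiples of the same affine function, so the curvature constraint at `t
    -- = 0` propagates.
    rw [(g t ht).2.2, (g t ht).1, ← e2, div_pow, mul_pow, ← div_div, hg, mul_div_assoc]

theorem isLineElementOf_pointD (γ : ℝ) (H A B : ℝ → ℝ) :
    IsLineElementOf γ pointD H A B ↔
      0 < H 0 ∧ 0 < A 0 ∧ B 0 = 2 / (3 * H 0) ∧ ∀ t : ℝ, 0 ≤ t →
        H t = 2 * H 0 / (3 * H 0 * t + 2) ∧
        A t = A 0 ∧
        B t = B 0 * (3 * H 0 * t + 2) / 2 := by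
  rw [isLineElementOf_iff (c := 3 / 2) (by positivity) (by rw [averagedQ_pointD]; norm_num)]
  have e1 : ∀ t, 1 + 3 / 2 * H 0 * t = (3 * H 0 * t + 2) / 2 := fun t => by ring
  have e2 : ∀ t, H 0 / ((3 * H 0 * t + 2) / 2) = 2 * H 0 / (3 * H 0 * t + 2) := fun t => by
    rw [div_div_eq_mul_div, mul_comm]
  have e3 : (1 - 2 * (1 / 2 : ℝ)) / (3 / 2) = 0 := by norm_num
  have e4 : (1 + (1 / 2 : ℝ)) / (3 / 2) = 1 := by norm_num
  have e5 : ∀ t, B 0 * ((3 * H 0 * t + 2) / 2) = B 0 * (3 * H 0 * t + 2) / 2 := fun t => by ring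
  simp only [pointD, e1, e2, e3, e4, e5, Real.rpow_one, Real.rpow_zero, mul_one]
  constructor
  · rintro ⟨⟨g1, g2, g3, g⟩, hg⟩
    have h0 := hg (by norm_num) 0 (mem_Ici.2 le_rfl)
    refine ⟨g1, g2, ?_, g⟩
    rw [div_eq_iff (by positivity)] at h0
    -- With `Ω_k = 3 / 4` the curvature constraint at `t = 0` fixes `B 0`.
    have h1 : (3 * H 0 * B 0 / 2) ^ 2 = 1 := by linear_combination -h0
    have h2 : 3 * H 0 * B 0 / 2 = 1 :=
      (pow_eq_one_iff_of_nonneg (by positivity) two_ne_zero).1 h1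
    rw [eq_div_iff (by positivity)]
    linarith
  · rintro ⟨g1, g2, hB, g⟩
    refine ⟨⟨g1, g2, by rw [hB]; positivity, g⟩, fun _ t ht => ?_⟩
    have hu : 0 < 3 * H 0 * t + 2 := by
      have : 0 ≤ t := ht
      positivity
    rw [(g t ht).2.2, (g t ht).1, hB]
    field_simp
    norm_num

/-! ### The de Sitter limit -/

theorem tendsto_deSitter_hubble (H₀ t : ℝ) :
    Tendsto (fun g : ℝ => 2 * H₀ / (3 * g * H₀ * t + 2)) (𝓝[>] 0) (𝓝 H₀) := by
  have h : ContinuousAt (fun g : ℝ => 2 * H₀ / (3 * g * H₀ * t + 2)) 0 :=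
    ContinuousAt.div (by fun_prop) (by fun_prop) (by norm_num)
  have h' := h.tendsto
  simp only [mul_zero, zero_mul, zero_add] at h'
  rw [mul_div_cancel_left₀ _ (two_ne_zero (α := ℝ))] at h'
  exact h'.mono_left nhdsWithin_le_nhds

/-- With `x = 2 / (3 g) → ∞` this is the limit of `(1 + H₀ t / x) ^ x`. -/
theorem tendsto_deSitter_scaleFactor (H₀ t : ℝ) :
    Tendsto (fun g : ℝ => (3 * g * H₀ * t / 2 + 1) ^ (2 / (3 * g))) (𝓝[>] 0)
      (𝓝 (Real.exp (H₀ * t))) := by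
  have h1 : Tendsto (fun g : ℝ => 2 / (3 * g)) (𝓝[>] 0) atTop := by
    have : (fun g : ℝ => 2 / (3 * g)) = fun g => 2 / 3 * g⁻¹ := by
      ext g; rw [← div_div, div_eq_mul_inv]
    rw [this]
    exact tendsto_inv_nhdsGT_zero.const_mul_atTop (by norm_num)
  refine ((Real.tendsto_one_add_div_rpow_exp (H₀ * t)).comp h1).congr' ?_
  filter_upwards [self_mem_nhdsWithin] with g hg
  have hg' : g ≠ 0 := (show (0 : ℝ) < g from hg).ne'
  simp only [Function.comp_apply]
  congr 1
  field_simp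
  ring

/-! ## Flatness -/

/-- Minkowski coordinates for the Bianchi III form of flat spacetime. -/
def flatChart (s a : ℝ) (y : Fin 4 → ℝ) : Fin 4 → ℝ :=
  ![(y 0 + s) * Real.cosh (y 2), a * y 1, (y 0 + s) * Real.sinh (y 2) * Real.cos (y 3),
    (y 0 + s) * Real.sinh (y 2) * Real.sin (y 3)]

theorem contDiff_flatChart (s a : ℝ) {n : WithTop ℕ∞} : ContDiff ℝ n (flatChart s a) := by
  rw [contDiff_pi]
  intro i
  fin_cases i <;> simp only [flatChart] <;> simp <;> fun_prop

theorem fderiv_flatChart (s a : ℝ) (y v : Fin 4 → ℝ) : fderiv ℝ (flatChart s a) y v =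
    ![v 0 * Real.cosh (y 2) + (y 0 + s) * (Real.sinh (y 2) * v 2), a * v 1,
      (v 0 * Real.sinh (y 2) + (y 0 + s) * (Real.cosh (y 2) * v 2)) * Real.cos (y 3)
        - (y 0 + s) * Real.sinh (y 2) * (Real.sin (y 3) * v 3),
      (v 0 * Real.sinh (y 2) + (y 0 + s) * (Real.cosh (y 2) * v 2)) * Real.sin (y 3)
        + (y 0 + s) * Real.sinh (y 2) * (Real.cos (y 3) * v 3)] := by
  have hd : ∀ i, HasFDerivAt (fun z : Fin 4 → ℝ => z i)
      (ContinuousLinearMap.proj (R := ℝ) (φ := fun _ : Fin 4 => ℝ) i) y :=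
    fun i => hasFDerivAt_apply i y
  have hF := (contDiff_flatChart s a (n := 1)).differentiable one_ne_zero y
  have hcomp : ∀ i, fderiv ℝ (flatChart s a) y v i = fderiv ℝ (fun z => flatChart s a z i) y v :=
    fun i => by
      have h : fderiv ℝ (fun z => flatChart s a z i) y
          = (ContinuousLinearMap.proj (R := ℝ) (φ := fun _ : Fin 4 => ℝ) i).comp
            (fderiv ℝ (flatChart s a) y) :=
        ((hasFDerivAt_pi'.1 hF.hasFDerivAt) i).fderiv
      rw [h]; rfl
  ext i
  rw [hcomp]
  have hT := (hd 0).add_const s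
  fin_cases i
  · have h := (hT.mul (hd 2).cosh).fderiv
    change fderiv ℝ ((fun z : Fin 4 → ℝ => z 0 + s) * fun z : Fin 4 → ℝ => Real.cosh (z 2)) y v = _
    rw [h]; simp; ring
  · have h := ((hd 1).const_mul a).fderiv
    change fderiv ℝ (fun z : Fin 4 → ℝ => a * z 1) y v = _
    rw [h]; simp
  · have h := ((hT.mul (hd 2).sinh).mul (hd 3).cos).fderiv
    change fderiv ℝ (((fun z : Fin 4 → ℝ => z 0 + s) * fun z : Fin 4 → ℝ => Real.sinh (z 2))
      * fun z : Fin 4 → ℝ => Real.cos (z 3)) y v = _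
    rw [h]; simp; ring
  · have h := ((hT.mul (hd 2).sinh).mul (hd 3).sin).fderiv
    change fderiv ℝ (((fun z : Fin 4 → ℝ => z 0 + s) * fun z : Fin 4 → ℝ => Real.sinh (z 2))
      * fun z : Fin 4 → ℝ => Real.sin (z 3)) y v = _
    rw [h]; simp; ring

/-- Hyperboloids of radius `t + s` foliate the future light cone of three-dimensional Minkowski
space, as in the Milne universe; the coordinate `r` adds a flat line. -/
theorem minkowski_fderiv_flatChart (s a : ℝ) (y v w : Fin 4 → ℝ) :
    minkowski (fderiv ℝ (flatChart s a) y v) (fderiv ℝ (flatChart s a) y w)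
      = lrsMetric (fun _ => a) (fun t => t + s) y v w := by
  rw [fderiv_flatChart, fderiv_flatChart]
  have h1 := Real.cosh_sq (y 2)
  have h2 := Real.sin_sq_add_cos_sq (y 3)
  simp only [minkowski, lrsMetric, Matrix.cons_val]
  generalize Real.cosh (y 2) = c at *
  generalize Real.sinh (y 2) = σ at *
  generalize Real.sin (y 3) = u at *
  generalize Real.cos (y 3) = e at *
  linear_combination
    (-(v 0 * w 0) + (y 0 + s) ^ 2 * v 2 * w 2) * h1
    + ((v 0 * σ + (y 0 + s) * (c * v 2)) * (w 0 * σ + (y 0 + s) * (c * w 2))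
      + (y 0 + s) ^ 2 * σ ^ 2 * v 3 * w 3) * h2

theorem isFlatOn_pointD {γ : ℝ} {H A B : ℝ → ℝ} (h : IsLineElementOf γ pointD H A B) :
    IsFlatOn (lrsMetric A B) {x | 0 < x 0 ∧ 0 < x 2} := by
  obtain ⟨hH, hA, hB, hAB⟩ := (isLineElementOf_pointD γ H A B).1 h
  intro x hx
  refine ⟨{x | 0 < x 0 ∧ 0 < x 2}, (isOpen_lt continuous_const (continuous_apply 0)).inter
    (isOpen_lt continuous_const (continuous_apply 2)), hx, flatChart (2 / (3 * H 0)) (A 0),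
    (contDiff_flatChart _ _).contDiffOn, fun y hy v w => ?_⟩
  obtain ⟨-, h1, h2⟩ := hAB (y 0) hy.1.le
  rw [minkowski_fderiv_flatChart, lrsMetric, lrsMetric, h1, h2, hB]
  have : 2 / (3 * H 0) * (3 * H 0 * y 0 + 2) / 2 = y 0 + 2 / (3 * H 0) := by field_simp
  rw [this]

/-! ### The selected point in each range of the barotropic index -/

theorem isSelected_iff_pointF0 {γ : ℝ} (h : γ ≤ 2 / 3) (p : ℝ × ℝ × ℝ) :
    IsSelected γ p ↔ p = pointF0 := by
  constructor
  · rintro (⟨-, hp⟩ | ⟨h1, -, -⟩ | ⟨h1, -⟩)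
    · exact hp
    · linarith
    · linarith
  · exact fun hp => Or.inl ⟨h, hp⟩

theorem isSelected_iff_pointMC {γ : ℝ} (h : 2 / 3 < γ) (h' : γ < 1) (p : ℝ × ℝ × ℝ) :
    IsSelected γ p ↔ p = pointMC γ := by
  constructor
  · rintro (⟨h1, -⟩ | ⟨-, -, hp⟩ | ⟨h1, -⟩)
    · linarith
    · exact hp
    · linarith
  · exact fun hp => Or.inr (Or.inl ⟨h, h', hp⟩)

theorem isSelected_iff_pointD {γ : ℝ} (h : 1 ≤ γ) (p : ℝ × ℝ × ℝ) :
    IsSelected γ p ↔ p = pointD := by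
  constructor
  · rintro (⟨h1, -⟩ | ⟨-, h1, -⟩ | ⟨-, hp⟩)
    · linarith
    · linarith
    · exact hp
  · exact fun hp => Or.inr (Or.inr ⟨h, hp⟩)

end LRSBianchiIII

end

theorem theorem3 (P : HarmonicPotential) (γ : ℝ) :
    -- matter dominated FLRW universe
    (0 < γ → γ ≤ 2 / 3 →
      (∀ p, IsAveragedAttractor γ p ↔ p = pointF0) ∧
      (∀ p, IsFullAttractor P γ p ↔ p = pointF0) ∧
      omegaM pointF0 = 1 ∧
      (γ < 2 / 3 → -1 < averagedQ γ pointF0 ∧ averagedQ γ pointF0 < 0) ∧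
      (γ = 2 / 3 → averagedQ γ pointF0 = 0) ∧
      (∀ H A B : ℝ → ℝ, IsLineElementOf γ pointF0 H A B ↔
        0 < H 0 ∧ 0 < A 0 ∧ 0 < B 0 ∧ ∀ t : ℝ, 0 ≤ t →
          H t = 2 * H 0 / (3 * γ * H 0 * t + 2) ∧
          A t = A 0 * (3 * γ * H 0 * t / 2 + 1) ^ (2 / (3 * γ)) ∧
          B t = B 0 * (3 * γ * H 0 * t / 2 + 1) ^ (2 / (3 * γ)))) ∧
    -- the de Sitter limit of its line element
    (∀ H₀ t : ℝ, 0 < H₀ → 0 ≤ t →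
      Tendsto (fun g : ℝ => 2 * H₀ / (3 * g * H₀ * t + 2)) (𝓝[>] 0) (𝓝 H₀) ∧
      Tendsto (fun g : ℝ => (3 * g * H₀ * t / 2 + 1) ^ (2 / (3 * g))) (𝓝[>] 0)
        (𝓝 (Real.exp (H₀ * t)))) ∧
    -- matter-curvature scaling solution
    (2 / 3 < γ → γ < 1 →
      (∀ p, IsAveragedAttractor γ p ↔ p = pointMC γ) ∧
      (∀ p, IsFullAttractor P γ p ↔ p = pointMC γ) ∧
      omegaM (pointMC γ) = 3 * (1 - γ) ∧
      (∀ H A B : ℝ → ℝ, IsLineElementOf γ (pointMC γ) H A B ↔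
        0 < H 0 ∧ 0 < A 0 ∧ 0 < B 0 ∧
        1 / B 0 ^ 2 = 3 * (-(9 * γ ^ 2 / 4) + 6 * γ - 3) * H 0 ^ 2 ∧ ∀ t : ℝ, 0 ≤ t →
          H t = 2 * H 0 / (3 * γ * H 0 * t + 2) ∧
          A t = A 0 * (3 * γ * H 0 * t / 2 + 1) ^ (2 * (1 - γ) / γ) ∧
          B t = B 0 * (3 * γ * H 0 * t / 2 + 1))) ∧
    -- Bianchi III form of flat spacetime
    (1 ≤ γ → γ ≤ 2 →
      (∀ p, IsAveragedAttractor γ p ↔ p = pointD) ∧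
      (∀ p, IsFullAttractor P γ p ↔ p = pointD) ∧
      (∀ H A B : ℝ → ℝ, IsLineElementOf γ pointD H A B ↔
        0 < H 0 ∧ 0 < A 0 ∧ B 0 = 2 / (3 * H 0) ∧ ∀ t : ℝ, 0 ≤ t →
          H t = 2 * H 0 / (3 * H 0 * t + 2) ∧
          A t = A 0 ∧
          B t = B 0 * (3 * H 0 * t + 2) / 2) ∧
      (∀ H A B : ℝ → ℝ, IsLineElementOf γ pointD H A B →
        IsFlatOn (lrsMetric A B) {x | 0 < x 0 ∧ 0 < x 2})) := by
  refine ⟨fun h0 h1 => ⟨fun p => ?_, fun p => ?_, ?_, fun h => ?_, fun h => ?_,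
      isLineElementOf_pointF0 h0⟩,
    fun H₀ t _ _ => ⟨tendsto_deSitter_hubble H₀ t, tendsto_deSitter_scaleFactor H₀ t⟩,
    fun h1 h2 => ⟨fun p => ?_, fun p => ?_, ?_, isLineElementOf_pointMC h1 h2⟩,
    fun h1 h2 => ⟨fun p => ?_, fun p => ?_, isLineElementOf_pointD γ,
      fun _ _ _ h => isFlatOn_pointD h⟩⟩
  · rw [isAveragedAttractor_iff h0 (by linarith), isSelected_iff_pointF0 h1]
  · rw [isFullAttractor_iff P h0 (by linarith), isSelected_iff_pointF0 h1]
  · norm_num [omegaM, pointF0]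
  · rw [averagedQ_pointF0]
    constructor <;> linarith
  · rw [averagedQ_pointF0, h]
    norm_num
  · rw [isAveragedAttractor_iff (by linarith) (by linarith), isSelected_iff_pointMC h1 h2]
  · rw [isFullAttractor_iff P (by linarith) (by linarith), isSelected_iff_pointMC h1 h2]
  · simp only [omegaM, pointMC]
    ring
  · rw [isAveragedAttractor_iff (by linarith) h2, isSelected_iff_pointD h1]
  · rw [isFullAttractor_iff P (by linarith) h2, isSelected_iff_pointD h1]
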